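/- Let $L=2^n$, $n\ge 0$ an integer. A configuration is a function $h:\{0,\dots,L\}\to\mathbb R$ with $h(0)=h(L)=0$. Let $W(x,\cdot)$, $x=1,\dots,L-1$, be independent two-sided standard Brownian motions, and put $$D(h)=\tfrac12\sum_{x=1}^{L}(h(x)-h(x-1))^2,\quad W(h)=\sum_{x=1}^{L-1}W(x,h(x)),\quad E(h)=D(h)-W(h),\quad D_p(h)=2^{-p/2}\sum_{x=1}^{L}|h(x)-h(x-1)|^p .$$ For a dyadic scale $l\in\{1,2,4,\dots,L\}$ let $h_{\ge l}$ be the piecewise linear interpolation of $h$ in the points of $\{0,\dots,L\}\cap l\mathbb Z$, and for $l\le L/2$ let $h_l=h_{\ge l}-h_{\ge 2l}$. For a random variable $X$ let $\|X\|_1=\inf\{\nu>0:\mathbb E\exp(|X|/\nu)\le e\}$. Almost surely $E$ has a unique minimizer $h_*$ among all configurations, and $h_*$ is a random variable (measurable up to a null set). Moreover, for every $2\le p<3$ there is a constant $C_p<\infty$, depending only on $p$, such that for all $L=2^n$ and all $l\in\{1,2,4,\dots,L/2\}$ $$\Big\|\frac{D_p(h_{*,l})}{L}\Big\|_1\le C_p\qquad\text{and}\qquad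 \Big\|\frac{D_p(h_{*,\ge l})}{L}\Big\|_1\le C_p\,\Big(\ln\frac{L}{l}\Big)^{p/2}.$$ -/

import Mathlib

open MeasureTheory ProbabilityTheory
open scoped ENNReal NNReal

noncomputable section

namespace BrownianField

/-- The configurations on the lattice `{0, …, L}`: height functions with `h 0 = h L = 0`.
They are represented by functions on `ℕ`, extended by zero beyond `L`, so that two configurations
are equal if and only if they agree on `{0, …, L}`. -/
def IsConfiguration (L : ℕ) (h : ℕ → ℝ) : Prop :=
  h 0 = 0 ∧ ∀ x, L ≤ x → h x = 0

/-- The discrete Dirichlet energy `D(h) = (1/2) ∑_{x=1}^L (h(x) - h(x-1))²`. -/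
def dirichletEnergy (L : ℕ) (h : ℕ → ℝ) : ℝ :=
  1 / 2 * ∑ x ∈ Finset.Icc 1 L, (h x - h (x - 1)) ^ 2

/-- The `p`-Dirichlet energy `D_p(h) = 2^{-p/2} ∑_{x=1}^L |h(x) - h(x-1)|^p`. -/
def pDirichletEnergy (p : ℝ) (L : ℕ) (h : ℕ → ℝ) : ℝ :=
  1 / (2 : ℝ) ^ (p / 2) * ∑ x ∈ Finset.Icc 1 L, |h x - h (x - 1)| ^ p

/-- The field term `W(h) = ∑_{x=1}^{L-1} W(x, h(x))` of one realization `w` of the field. -/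
def fieldTerm (L : ℕ) (w : ℕ → ℝ → ℝ) (h : ℕ → ℝ) : ℝ :=
  ∑ x ∈ Finset.Ioo 0 L, w x (h x)

/-- The energy `E = D - W`. -/
def energy (L : ℕ) (w : ℕ → ℝ → ℝ) (h : ℕ → ℝ) : ℝ :=
  dirichletEnergy L h - fieldTerm L w h

/-- `h` minimizes `E` among all configurations. -/
def IsMinimizer (L : ℕ) (w : ℕ → ℝ → ℝ) (h : ℕ → ℝ) : Prop :=
  IsConfiguration L h ∧ ∀ g : ℕ → ℝ, IsConfiguration L g → energy L w h ≤ energy L w g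

/-- The piecewise linear interpolation `h_{≥ l}` of `h` in the points of `l ℤ`. -/
def coarse (l : ℕ) (h : ℕ → ℝ) (x : ℕ) : ℝ :=
  h (x / l * l) + ((x % l : ℕ) : ℝ) / (l : ℝ) * (h ((x / l + 1) * l) - h (x / l * l))

/-- The component `h_l = h_{≥ l} - h_{≥ 2 l}` of scale `l`. -/
def scaleComponent (l : ℕ) (h : ℕ → ℝ) (x : ℕ) : ℝ :=
  coarse l h x - coarse (2 * l) h x

variable {Ω : Type*} [MeasurableSpace Ω]

/-- A two-sided Brownian motion: its two halves are independent Brownian motions started in `0`. -/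
structure IsTwoSidedBrownian (B : ℝ → Ω → ℝ) (μ : Measure Ω) : Prop where
  right : IsBrownianReal (fun (t : ℝ≥0) ω ↦ B (t : ℝ) ω) μ
  left : IsBrownianReal (fun (t : ℝ≥0) ω ↦ B (-(t : ℝ)) ω) μ
  indep : IndepFun (fun ω (t : ℝ≥0) ↦ B (t : ℝ) ω) (fun ω (t : ℝ≥0) ↦ B (-(t : ℝ)) ω) μ

/-- `W(1, ·), …, W(L-1, ·)` are independent two-sided Brownian motions. -/
structure IsBrownianField (L : ℕ) (W : ℕ → ℝ → Ω → ℝ) (μ : Measure Ω) : Prop where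
  brownian : ∀ x ∈ Finset.Ioo 0 L, IsTwoSidedBrownian (W x) μ
  indep : iIndepFun (fun (x : Finset.Ioo 0 L) ω (y : ℝ) ↦ W x y ω) μ

/-- The Orlicz norm `‖X‖_s = inf {ν > 0 | 𝔼 exp (|X / ν|^s) ≤ e}`, which is `∞` if there is no
such `ν`. -/
def orliczNorm (s : ℝ) (X : Ω → ℝ) (μ : Measure Ω) : ℝ≥0∞ :=
  ⨅ (ν : ℝ≥0) (_ : 0 < ν ∧
    ∫⁻ ω, ENNReal.ofReal (Real.exp (|X ω / (ν : ℝ)| ^ s)) ∂μ ≤ ENNReal.ofReal (Real.exp 1)),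
    (ν : ℝ≥0∞)

end BrownianField

end

/-!
The fluctuations of the minimizer are controlled by the fluctuations of maxima of the Gaussian
process `X k = W(k) - W(0)` over paths `k`, and these by a self-improving concentration estimate.

*Concentration.* Let `N` be the maximum of `X k - D(k)` over the rational paths on a block of
length `Λ` with zero boundary values. The variance of `X k` is `∑ |k x|`. The Maurey–Pisier
argument bounds `Q(l) = E exp(l N) * E exp(-l N)` by the expectation of `exp(c * l ^ 2 * ∑ |k x|)`
at the maximizing path `k`. As the maximum is convex in its drift, this is in turn at most an
average over the sites of exponential moments of the *responses* `N_θ - N`, where `N_θ` is the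
maximum with the drift `D(k) - θ * k x` (`mgf_mul_mgf_neg_iSup_le`). Now `X` has stationary
increments, and subtracting `θ * k x` from the quadratic form `D` amounts to a translation by a
multiple of the Green function (`pathEnergy_shear`); hence `N_θ` has the law of `N` up to a
constant and a Gaussian variable, and the Cauchy–Schwarz inequality bounds the moments of the
response by `Q(l) ^ (1 / 4)`. Solving the resulting inequality for `Q` gives
`Q(ρ / Λ) ≤ 3 * exp(5 * ρ ^ 3)` (`expMoment_mul_le`), and tails `exp(-c * |θ| ^ 3)` for the event
that the response exceeds `θ ^ 2 * Λ` (`measure_response_le`). All of this presupposes that `N`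
has finite exponential moments, which follows from a first-passage maximal inequality
(`hasExpMoments_pathEnergy`).

*Comparison.* The energy is submodular. Comparing a minimizer `h` on a block with a rational path
by means of their pointwise maximum or minimum shows that `θ` times the deviation of `h` from the
linear interpolation of suitable boundary values is at most the response `N_θ - N`
(`mul_sub_baseLine_le`). For `θ → 0` on the whole interval this squeezes the minimizer between the
difference quotients of the convex function `θ ↦ N_θ`. The mean of `N_θ` is explicit and
differentiable in `θ`, so the difference quotients meet almost surely; this gives uniqueness and
measurability. Existence holds because the energy is coercive.

*The union bound.* Let `l` be a dyadic scale and `L = 2 ^ M * l`. The heights of `h_*` at the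
points of `l ℤ`, in units of `l` and rounded up, form an integer net. On each of the `M` dyadic
scales above `l`, the responses on disjoint blocks are independent and bound the probability of a
given net by `∏ exp(-c * |σ| ^ 3)`, where the `σ` are the relative deviations at the midpoints of
the intervals of this scale. The geometric mean of these bounds with the weights `1 / 2, 1 / 4, …`
can be summed over all nets, by recursion over the binary tree of dyadic intervals, with the
result `exp(C * 2 ^ M)` (`tsum_netWeight_bendWeight_le`). It leaves room for a small multiple of
the sum of `|σ| ^ 3` over the finest scale, whose exponential moment is therefore at most
`exp(C * 2 ^ M)` (`lintegral_exp_sum_bend_le`).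

*Conclusion.* The component `h_l` consists of tents, whose slopes are comparable to the `σ` on the
finest scale; as `p < 3`, `D_p(h_l) / L` is at most a constant times `1` plus the average of
`|σ| ^ 3`, and Jensen's inequality bounds its Orlicz norm. For `h_{≥ l}`, a two-point inequality
and Minkowski's inequality in `ℓ^{p / 2}` give
`D_p(h_{≥ l}) ^ (2 / p) ≤ 3 * ∑ D_p(h_{l'}) ^ (2 / p)`, the sum being over the `M` dyadic scales
`l' ≥ l`. This is an orthogonality of the scales; it accounts for the power `p / 2` of the
logarithm.
-/

noncomputable section

namespace BrownianField

/-! ### Concentration of Gaussian soft-maxima -/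

/-- The interpolation `cos x + sin y` between two points, run at unit time, and Jensen's
inequality for `exp`, both in time and in the weights `p i`. -/
lemma exp_sub_le_integral_rotation {ι : Type*} [Fintype ι] {F : (ι → ℝ) → ℝ}
    {p : ι → (ι → ℝ) → ℝ} (hp0 : ∀ i x, 0 ≤ p i x) (hp1 : ∀ x, ∑ i, p i x = 1)
    (hpc : ∀ i, Continuous (p i))
    (hF' : ∀ (g : ℝ → ι → ℝ) (g' : ι → ℝ) (t : ℝ),
      (∀ i, HasDerivAt (fun s ↦ g s i) (g' i) t) →
        HasDerivAt (fun s ↦ F (g s)) (∑ i, p i (g t) * g' i) t)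
    (l : ℝ) (z : (ι → ℝ) × (ι → ℝ)) :
    Real.exp (l * (F z.2 - F z.1)) ≤
      ∫ t in Set.Ioc (0 : ℝ) 1, ∑ i, p i (ContinuousLinearMap.rotation (Real.pi / 2 * t) z).1 *
        Real.exp (l * (Real.pi / 2) *
          (ContinuousLinearMap.rotation (Real.pi / 2 * t) z).2 i) := by
  obtain ⟨x, y⟩ := z
  simp only [ContinuousLinearMap.rotation_apply]
  set r : ℝ → ι → ℝ := fun t ↦ Real.cos (Real.pi / 2 * t) • x + Real.sin (Real.pi / 2 * t) • y
    with hr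
  set r' : ℝ → ι → ℝ := fun t ↦ -Real.sin (Real.pi / 2 * t) • x + Real.cos (Real.pi / 2 * t) • y
    with hr'
  have hrc : Continuous r := by rw [hr]; fun_prop
  have hrc' : Continuous r' := by rw [hr']; fun_prop
  have hri' : ∀ i, Continuous fun t ↦ r' t i := fun i ↦ (continuous_apply i).comp hrc'
  have hpr : ∀ i, Continuous fun t ↦ p i (r t) := fun i ↦ (hpc i).comp hrc
  have hd : ∀ t, HasDerivAt (fun s ↦ F (r s)) (∑ i, p i (r t) * (Real.pi / 2 * r' t i)) t := by
    intro t
    refine hF' r _ t fun i ↦ ?_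
    have h1 : HasDerivAt (fun s : ℝ ↦ Real.pi / 2 * s) (Real.pi / 2) t := by
      simpa using (hasDerivAt_id t).const_mul (Real.pi / 2)
    have h2 := (h1.cos.mul_const (x i)).add (h1.sin.mul_const (y i))
    simp only [hr, hr', Pi.add_apply, Pi.smul_apply, smul_eq_mul]
    refine h2.congr_deriv ?_
    ring
  have hcd : Continuous fun t ↦ ∑ i, p i (r t) * (Real.pi / 2 * r' t i) := by fun_prop
  have hftc := intervalIntegral.integral_eq_sub_of_hasDerivAt (fun t _ ↦ hd t)
    (hcd.intervalIntegrable 0 1)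
  have h0 : r 0 = x := by simp [hr]
  have h1 : r 1 = y := by simp [hr]
  rw [h0, h1, intervalIntegral.integral_of_le zero_le_one] at hftc
  have : IsProbabilityMeasure (volume.restrict (Set.Ioc (0 : ℝ) 1)) := ⟨by simp⟩
  have hint : ∀ {f : ℝ → ℝ}, Continuous f → Integrable f (volume.restrict (Set.Ioc (0 : ℝ) 1)) :=
    fun hf ↦ (hf.integrableOn_Icc (a := 0) (b := 1)).mono_set Set.Ioc_subset_Icc_self
  calc Real.exp (l * (F y - F x))
      = Real.exp (∫ t in Set.Ioc (0 : ℝ) 1, l * ∑ i, p i (r t) * (Real.pi / 2 * r' t i)) := by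
        rw [integral_const_mul, hftc]
    _ ≤ ∫ t in Set.Ioc (0 : ℝ) 1, Real.exp (l * ∑ i, p i (r t) * (Real.pi / 2 * r' t i)) :=
        convexOn_exp.map_integral_le (by fun_prop) isClosed_univ (by simp)
          (hint (by fun_prop)) (hint (f := fun t ↦ Real.exp _) (by fun_prop))
    _ ≤ _ := by
        refine integral_mono (hint (by fun_prop)) (hint ?_) fun t ↦ ?_
        · fun_prop
        have := convexOn_exp.map_sum_le (t := Finset.univ) (w := fun i ↦ p i (r t))
          (p := fun i ↦ l * (Real.pi / 2) * r' t i) (fun i _ ↦ hp0 i _) (hp1 _) (by simp)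
        simp only [smul_eq_mul] at this
        convert this using 2
        rw [Finset.mul_sum]
        exact Finset.sum_congr rfl fun i _ ↦ by ring

/-- The Maurey–Pisier inequality, in the form that keeps the variance of the maximizing
coordinate inside the expectation: the fluctuations of a smooth function `F` whose gradient is a
probability vector `p` are controlled by the exponential of the `p`-average variance. -/
theorem mgf_mul_mgf_neg_le {ι : Type*} [Fintype ι] {ν : Measure (ι → ℝ)} [IsProbabilityMeasure ν]
    (hrot : ∀ θ, (ν.prod ν).map (ContinuousLinearMap.rotation θ) = ν.prod ν)
    {v : ι → ℝ} (hv : ∀ i s, ∫⁻ x, ENNReal.ofReal (Real.exp (s * x i)) ∂ν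
      = ENNReal.ofReal (Real.exp (s ^ 2 * v i / 2)))
    {F : (ι → ℝ) → ℝ} (hF : Continuous F)
    {p : ι → (ι → ℝ) → ℝ} (hp0 : ∀ i x, 0 ≤ p i x) (hp1 : ∀ x, ∑ i, p i x = 1)
    (hpc : ∀ i, Continuous (p i))
    (hF' : ∀ (g : ℝ → ι → ℝ) (g' : ι → ℝ) (t : ℝ),
      (∀ i, HasDerivAt (fun s ↦ g s i) (g' i) t) →
        HasDerivAt (fun s ↦ F (g s)) (∑ i, p i (g t) * g' i) t)
    (l : ℝ) :
    (∫⁻ x, ENNReal.ofReal (Real.exp (l * F x)) ∂ν) *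
      (∫⁻ x, ENNReal.ofReal (Real.exp (-(l * F x))) ∂ν) ≤
    ∫⁻ x, ∑ i, ENNReal.ofReal (p i x) *
      ENNReal.ofReal (Real.exp (l ^ 2 * (Real.pi ^ 2 / 8) * v i)) ∂ν := by
  set G : (ι → ℝ) × (ι → ℝ) → ℝ := fun z ↦
    ∑ i, p i z.1 * Real.exp (l * (Real.pi / 2) * z.2 i) with hG
  have hGc : Continuous G := by rw [hG]; fun_prop
  have hG0 : ∀ z, 0 ≤ G z := fun z ↦
    Finset.sum_nonneg fun i _ ↦ mul_nonneg (hp0 i _) (Real.exp_nonneg _)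
  obtain ⟨R, hR⟩ : ∃ R : ℝ → (ι → ℝ) × (ι → ℝ) → (ι → ℝ) × (ι → ℝ),
      ∀ t z, R t z = ContinuousLinearMap.rotation (Real.pi / 2 * t) z := ⟨_, fun _ _ ↦ rfl⟩
  have hRc : Continuous fun q : ((ι → ℝ) × (ι → ℝ)) × ℝ ↦ R q.2 q.1 := by
    simp only [hR, ContinuousLinearMap.rotation_apply]
    fun_prop
  have hRm : ∀ t, (ν.prod ν).map (R t) = ν.prod ν := fun t ↦ by
    rw [funext fun z ↦ hR t z]
    exact hrot _
  have hexp : ∀ z : (ι → ℝ) × (ι → ℝ), Real.exp (l * (F z.2 - F z.1)) ≤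
      ∫ t in Set.Ioc (0 : ℝ) 1, G (R t z) := fun z ↦ by
    simp only [hR]
    exact exp_sub_le_integral_rotation hp0 hp1 hpc hF' l z
  have hRGc : Continuous fun q : ((ι → ℝ) × (ι → ℝ)) × ℝ ↦ G (R q.2 q.1) := hGc.comp hRc
  have hpt : ∀ z : (ι → ℝ) × (ι → ℝ), ENNReal.ofReal (Real.exp (l * (F z.2 - F z.1))) ≤
      ∫⁻ t in Set.Ioc (0 : ℝ) 1,
        ENNReal.ofReal (G (R t z)) := by
    intro z
    have hc : Continuous fun t : ℝ ↦ G (R t z) :=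
      hRGc.comp (continuous_const.prodMk continuous_id : Continuous fun t : ℝ ↦ (z, t))
    rw [← ofReal_integral_eq_lintegral_ofReal
      ((hc.integrableOn_Icc (a := 0) (b := 1)).mono_set Set.Ioc_subset_Icc_self)
      (Filter.Eventually.of_forall fun t ↦ hG0 _)]
    exact ENNReal.ofReal_le_ofReal (hexp z)
  calc (∫⁻ x, ENNReal.ofReal (Real.exp (l * F x)) ∂ν) *
      (∫⁻ x, ENNReal.ofReal (Real.exp (-(l * F x))) ∂ν)
      = ∫⁻ z, ENNReal.ofReal (Real.exp (l * (F z.2 - F z.1))) ∂(ν.prod ν) := by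
        rw [mul_comm, ← lintegral_prod_mul (by fun_prop) (by fun_prop)]
        refine lintegral_congr fun z ↦ ?_
        rw [← ENNReal.ofReal_mul (Real.exp_nonneg _), ← Real.exp_add]
        congr 2
        ring
    _ ≤ ∫⁻ z, (∫⁻ t in Set.Ioc (0 : ℝ) 1, ENNReal.ofReal (G (R t z))) ∂(ν.prod ν) :=
        lintegral_mono hpt
    _ = ∫⁻ t in Set.Ioc (0 : ℝ) 1, (∫⁻ z, ENNReal.ofReal (G (R t z)) ∂(ν.prod ν)) := by
        refine lintegral_lintegral_swap ?_
        have : Continuous (Function.uncurry fun (z : (ι → ℝ) × (ι → ℝ)) (t : ℝ) ↦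
          ENNReal.ofReal (G (R t z))) :=
          ENNReal.continuous_ofReal.comp hRGc
        exact this.measurable.aemeasurable
  -- the rotated pair `R t z` has the law of `z`: no dependence on the time is left
    _ = ∫⁻ t in Set.Ioc (0 : ℝ) 1, (∫⁻ z, ENNReal.ofReal (G z) ∂(ν.prod ν)) := by
        refine lintegral_congr fun t ↦ ?_
        have hm : Measurable fun z ↦ ENNReal.ofReal (G z) := by fun_prop
        have hRt : Measurable (R t) :=
          (hRc.comp (continuous_id.prodMk continuous_const)).measurable
        conv_rhs => rw [← hRm t]
        rw [lintegral_map hm hRt]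
    _ = ∫⁻ z, ENNReal.ofReal (G z) ∂(ν.prod ν) := by simp
    _ = _ := by
        have h1 : ∀ z, ENNReal.ofReal (G z) = ∑ i, ENNReal.ofReal (p i z.1) *
            ENNReal.ofReal (Real.exp (l * (Real.pi / 2) * z.2 i)) := by
          intro z
          rw [hG, ENNReal.ofReal_sum_of_nonneg
            fun i _ ↦ mul_nonneg (hp0 i _) (Real.exp_nonneg _)]
          exact Finset.sum_congr rfl fun i _ ↦ ENNReal.ofReal_mul (hp0 i _)
        simp_rw [h1]
        have hpm : ∀ i, Measurable (p i) := fun i ↦ (hpc i).measurable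
        rw [lintegral_finsetSum _ (by fun_prop), lintegral_finsetSum _ (by fun_prop)]
        refine Finset.sum_congr rfl fun i _ ↦ ?_
        have hprod := lintegral_prod_mul (μ := ν) (ν := ν) (f := fun x ↦ ENNReal.ofReal (p i x))
          (g := fun x ↦ ENNReal.ofReal (Real.exp (l * (Real.pi / 2) * x i)))
          (by fun_prop) (Measurable.aemeasurable (by fun_prop))
        rw [hprod, hv, lintegral_mul_const _ (by fun_prop)]
        congr 4
        ring

/-- The soft-maximum `β⁻¹ log ∑ exp (β y i)` at inverse temperature `β`. -/
def softMax {ι : Type*} [Fintype ι] (β : ℝ) (y : ι → ℝ) : ℝ :=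
  β⁻¹ * Real.log (∑ i, Real.exp (β * y i))

/-- The Gibbs weights of the soft-maximum. -/
def gibbs {ι : Type*} [Fintype ι] (β : ℝ) (y : ι → ℝ) (i : ι) : ℝ :=
  Real.exp (β * y i) / ∑ j, Real.exp (β * y j)

section SoftMax

variable {ι : Type*} [Fintype ι] [Nonempty ι]

lemma sum_exp_pos (β : ℝ) (y : ι → ℝ) : 0 < ∑ i, Real.exp (β * y i) :=
  Finset.sum_pos (fun _ _ ↦ Real.exp_pos _) Finset.univ_nonempty

lemma exp_mul_softMax {β : ℝ} (hβ : 0 < β) (y : ι → ℝ) :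
    Real.exp (β * softMax β y) = ∑ i, Real.exp (β * y i) := by
  rw [softMax, mul_inv_cancel_left₀ hβ.ne', Real.exp_log (sum_exp_pos β y)]

lemma gibbs_nonneg (β : ℝ) (y : ι → ℝ) (i : ι) : 0 ≤ gibbs β y i :=
  div_nonneg (Real.exp_nonneg _) (sum_exp_pos β y).le

lemma sum_gibbs (β : ℝ) (y : ι → ℝ) : ∑ i, gibbs β y i = 1 := by
  simp only [gibbs]
  rw [← Finset.sum_div, div_self (sum_exp_pos β y).ne']

lemma iSup_le_softMax {β : ℝ} (hβ : 0 < β) (y : ι → ℝ) : ⨆ i, y i ≤ softMax β y := by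
  refine ciSup_le fun i ↦ ?_
  have h : Real.exp (β * y i) ≤ Real.exp (β * softMax β y) := by
    rw [exp_mul_softMax hβ]
    exact Finset.single_le_sum (f := fun i ↦ Real.exp (β * y i))
      (fun j _ ↦ Real.exp_nonneg _) (Finset.mem_univ i)
  exact le_of_mul_le_mul_left (Real.exp_le_exp.1 h) hβ

lemma softMax_le {β : ℝ} (hβ : 0 < β) (y : ι → ℝ) :
    softMax β y ≤ (⨆ i, y i) + Real.log (Fintype.card ι) / β := by
  have hc : (0 : ℝ) < Fintype.card ι := by exact_mod_cast Fintype.card_pos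
  have h : Real.exp (β * softMax β y) ≤
      Real.exp (β * ((⨆ i, y i) + Real.log (Fintype.card ι) / β)) := by
    rw [exp_mul_softMax hβ, mul_add, mul_div_cancel₀ _ hβ.ne', Real.exp_add, Real.exp_log hc,
      mul_comm, ← nsmul_eq_mul, ← Finset.card_univ]
    refine Finset.sum_le_card_nsmul _ _ _ fun i _ ↦ Real.exp_le_exp.2 ?_
    exact mul_le_mul_of_nonneg_left (le_ciSup (Set.finite_range y).bddAbove i) hβ.le
  exact le_of_mul_le_mul_left (Real.exp_le_exp.1 h) hβ

lemma hasDerivAt_softMax {β : ℝ} (hβ : 0 < β) (c : ι → ℝ) (g : ℝ → ι → ℝ) (g' : ι → ℝ) (t : ℝ)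
    (hg : ∀ i, HasDerivAt (fun s ↦ g s i) (g' i) t) :
    HasDerivAt (fun s ↦ softMax β (g s + c)) (∑ i, gibbs β (g t + c) i * g' i) t := by
  have h1 : ∀ i, HasDerivAt (fun s ↦ Real.exp (β * (g s + c) i))
      (Real.exp (β * (g t + c) i) * (β * g' i)) t := fun i ↦
    (((hg i).add_const (c i)).const_mul β).exp
  have h2 : HasDerivAt (fun s ↦ ∑ i, Real.exp (β * (g s + c) i))
      (∑ i, Real.exp (β * (g t + c) i) * (β * g' i)) t :=
    HasDerivAt.fun_sum fun i _ ↦ h1 i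
  refine ((h2.log (sum_exp_pos β _).ne').const_mul β⁻¹).congr_deriv ?_
  rw [Finset.sum_div, Finset.mul_sum]
  refine Finset.sum_congr rfl fun i _ ↦ ?_
  rw [gibbs]
  field_simp

/-- Exponential moments of a function `f` under the Gibbs weights are controlled by the response
of the soft-maximum to the tilt `θ f`; this is Jensen's inequality for the power `β θ / t ≥ 1`. -/
lemma sum_gibbs_mul_exp_le {β t θ : ℝ} (ht : 0 < t) (hθ : 0 < θ) (hβ : t / θ ≤ β)
    (y f : ι → ℝ) :
    ∑ i, gibbs β y i * Real.exp (t * f i) ≤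
      Real.exp (t / θ * (softMax β (y + θ • f) - softMax β y)) := by
  have hβ0 : 0 < β := (div_pos ht hθ).trans_le hβ
  have hp : 1 ≤ β * θ / t := by
    rw [le_div_iff₀ ht, one_mul]
    rwa [div_le_iff₀ hθ] at hβ
  refine (Real.arith_mean_le_rpow_mean _ _ _ (fun i _ ↦ gibbs_nonneg β y i) (sum_gibbs β y)
    (fun i _ ↦ (Real.exp_nonneg _)) hp).trans_eq ?_
  have h1 : ∑ i, gibbs β y i * Real.exp (t * f i) ^ (β * θ / t) =
      Real.exp (β * (softMax β (y + θ • f) - softMax β y)) := by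
    rw [mul_sub, Real.exp_sub, exp_mul_softMax hβ0, exp_mul_softMax hβ0, Finset.sum_div]
    refine Finset.sum_congr rfl fun i _ ↦ ?_
    rw [gibbs, ← Real.exp_mul, div_mul_eq_mul_div, ← Real.exp_add]
    congr 2
    simp only [Pi.add_apply, Pi.smul_apply, smul_eq_mul]
    field_simp
  rw [h1, ← Real.exp_mul]
  congr 1
  field_simp

/-- Zero-temperature form of the Maurey–Pisier inequality for a finite maximum of Gaussian
variables with drifts `c`: the variance of the maximizing coordinate has been replaced by the
response of the maximum to tilts. -/
theorem mgf_mul_mgf_neg_iSup_le {ν : Measure (ι → ℝ)} [IsProbabilityMeasure ν]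
    (hrot : ∀ θ, (ν.prod ν).map (ContinuousLinearMap.rotation θ) = ν.prod ν)
    {v : ι → ℝ} (hv : ∀ i s, ∫⁻ x, ENNReal.ofReal (Real.exp (s * x i)) ∂ν
      = ENNReal.ofReal (Real.exp (s ^ 2 * v i / 2)))
    (c : ι → ℝ) {l t θ w : ℝ} (hl : 0 ≤ l) (ht : 0 < t) (hθ : 0 < θ) (hw : 0 ≤ w)
    {J : Type*} [Fintype J] (f : J → ι → ℝ)
    (hf : ∀ i, Real.exp (l ^ 2 * (Real.pi ^ 2 / 8) * v i) ≤ w * ∑ j, Real.exp (t * f j i)) :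
    (∫⁻ x, ENNReal.ofReal (Real.exp (l * ⨆ i, (x + c) i)) ∂ν) *
      (∫⁻ x, ENNReal.ofReal (Real.exp (-(l * ⨆ i, (x + c) i))) ∂ν) ≤
    ENNReal.ofReal w * ∑ j, ∫⁻ x, ENNReal.ofReal (Real.exp
      (t / θ * ((⨆ i, (x + c + θ • f j) i) - ⨆ i, (x + c) i))) ∂ν := by
  set A := (∫⁻ x, ENNReal.ofReal (Real.exp (l * ⨆ i, (x + c) i)) ∂ν) *
      (∫⁻ x, ENNReal.ofReal (Real.exp (-(l * ⨆ i, (x + c) i))) ∂ν) with hA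
  set B := ENNReal.ofReal w * ∑ j, ∫⁻ x, ENNReal.ofReal (Real.exp
      (t / θ * ((⨆ i, (x + c + θ • f j) i) - ⨆ i, (x + c) i))) ∂ν with hB
  -- The soft-maximum and the maximum differ by at most `K / β`, which vanishes as `β → ∞`.
  set K := Real.log (Fintype.card ι) with hK
  have key : ∀ β : ℝ, t / θ ≤ β → A ≤ ENNReal.ofReal (Real.exp ((l + t / θ) * K / β)) * B := by
    intro β hβ
    have hβ0 : 0 < β := (div_pos ht hθ).trans_le hβ
    have hFc : Continuous fun x : ι → ℝ ↦ softMax β (x + c) := by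
      unfold softMax
      refine continuous_const.mul (Continuous.log (by fun_prop) fun x ↦ (sum_exp_pos β _).ne')
    have hgc : ∀ i, Continuous fun x : ι → ℝ ↦ gibbs β (x + c) i := fun i ↦ by
      unfold gibbs
      exact Continuous.div (by fun_prop) (by fun_prop) fun x ↦ (sum_exp_pos β _).ne'
    have h1 := mgf_mul_mgf_neg_le hrot hv hFc (p := fun i x ↦ gibbs β (x + c) i)
      (fun i x ↦ gibbs_nonneg β _ i) (fun x ↦ sum_gibbs β _) hgc
      (fun g g' s hg ↦ hasDerivAt_softMax hβ0 c g g' s hg) l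
    have h2 : ENNReal.ofReal (Real.exp (-(l * K / β))) * A ≤
        (∫⁻ x, ENNReal.ofReal (Real.exp (l * softMax β (x + c))) ∂ν) *
      (∫⁻ x, ENNReal.ofReal (Real.exp (-(l * softMax β (x + c)))) ∂ν) := by
      rw [hA, mul_left_comm, ← lintegral_const_mul' _ _ ENNReal.ofReal_ne_top]
      refine mul_le_mul' (lintegral_mono fun x ↦ ?_) (lintegral_mono fun x ↦ ?_)
      · gcongr
        exact iSup_le_softMax hβ0 _
      · rw [← ENNReal.ofReal_mul (Real.exp_nonneg _), ← Real.exp_add]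
        refine ENNReal.ofReal_le_ofReal (Real.exp_le_exp.2 ?_)
        have := mul_le_mul_of_nonneg_left (softMax_le hβ0 (x + c)) hl
        rw [mul_add, ← hK, ← mul_div_assoc] at this
        linarith
    have h3 : ∫⁻ x, ∑ i, ENNReal.ofReal (gibbs β (x + c) i) *
        ENNReal.ofReal (Real.exp (l ^ 2 * (Real.pi ^ 2 / 8) * v i)) ∂ν ≤
        ENNReal.ofReal (Real.exp (t / θ * K / β)) * B := by
      have hm : ∀ d : ι → ℝ, Measurable fun x : ι → ℝ ↦ ⨆ i, (x + d) i := fun d ↦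
        Measurable.iSup fun i ↦ (by simp only [Pi.add_apply]; fun_prop)
      have hm' : ∀ j, Measurable fun x : ι → ℝ ↦ ENNReal.ofReal (Real.exp
          (t / θ * ((⨆ i, (x + c + θ • f j) i) - ⨆ i, (x + c) i))) := fun j ↦ by
        have h := hm (c + θ • f j)
        simp only [← add_assoc] at h
        exact (Real.measurable_exp.comp ((h.sub (hm c)).const_mul _)).ennreal_ofReal
      rw [hB, ← lintegral_finsetSum _ fun j _ ↦ hm' j, ← mul_assoc,
        ← ENNReal.ofReal_mul (Real.exp_nonneg _), ← lintegral_const_mul' _ _ ENNReal.ofReal_ne_top]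
      refine lintegral_mono fun x ↦ ?_
      simp only [← ENNReal.ofReal_mul (gibbs_nonneg β _ _)]
      rw [← ENNReal.ofReal_sum_of_nonneg
          fun i _ ↦ mul_nonneg (gibbs_nonneg β _ _) (Real.exp_nonneg _),
        ← ENNReal.ofReal_sum_of_nonneg fun i _ ↦ Real.exp_nonneg _,
        ← ENNReal.ofReal_mul (mul_nonneg (Real.exp_nonneg _) hw)]
      refine ENNReal.ofReal_le_ofReal ?_
      calc ∑ i, gibbs β (x + c) i * Real.exp (l ^ 2 * (Real.pi ^ 2 / 8) * v i)
          ≤ ∑ i, gibbs β (x + c) i * (w * ∑ j, Real.exp (t * f j i)) :=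
            Finset.sum_le_sum fun i _ ↦
              mul_le_mul_of_nonneg_left (hf i) (gibbs_nonneg β _ _)
        _ = w * ∑ j, ∑ i, gibbs β (x + c) i * Real.exp (t * f j i) := by
            simp only [Finset.mul_sum]
            rw [Finset.sum_comm]
            exact Finset.sum_congr rfl fun j _ ↦ Finset.sum_congr rfl fun i _ ↦ by ring
        _ ≤ w * ∑ j, Real.exp (t / θ * K / β) * Real.exp
              (t / θ * ((⨆ i, (x + c + θ • f j) i) - ⨆ i, (x + c) i)) := by
            refine mul_le_mul_of_nonneg_left (Finset.sum_le_sum fun j _ ↦ ?_) hw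
            refine (sum_gibbs_mul_exp_le ht hθ hβ (x + c) (f j)).trans ?_
            rw [← Real.exp_add, mul_div_assoc, ← mul_add]
            refine Real.exp_le_exp.2 (mul_le_mul_of_nonneg_left ?_ (div_pos ht hθ).le)
            have e1 := softMax_le hβ0 (x + c + θ • f j)
            have e2 := iSup_le_softMax hβ0 (x + c)
            rw [← hK] at e1
            linarith
        _ = _ := by rw [← Finset.mul_sum]; ring
    have h4 := (h2.trans h1).trans h3
    calc A = ENNReal.ofReal (Real.exp (l * K / β)) *
          (ENNReal.ofReal (Real.exp (-(l * K / β))) * A) := by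
          rw [← mul_assoc, ← ENNReal.ofReal_mul (Real.exp_nonneg _), ← Real.exp_add]
          simp
      _ ≤ ENNReal.ofReal (Real.exp (l * K / β)) *
          (ENNReal.ofReal (Real.exp (t / θ * K / β)) * B) := by gcongr
      _ = _ := by
          rw [← mul_assoc, ← ENNReal.ofReal_mul (Real.exp_nonneg _), ← Real.exp_add]
          congr 3
          ring
  have hlim : Filter.Tendsto (fun β : ℝ ↦ ENNReal.ofReal (Real.exp ((l + t / θ) * K / β)) * B)
      Filter.atTop (nhds (1 * B)) := by
    refine ENNReal.Tendsto.mul_const ?_ (Or.inl one_ne_zero)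
    have h1 : Filter.Tendsto (fun β : ℝ ↦ Real.exp ((l + t / θ) * K / β)) Filter.atTop
        (nhds (Real.exp 0)) :=
      (Real.continuous_exp.tendsto 0).comp (Filter.Tendsto.const_div_atTop Filter.tendsto_id _)
    rw [Real.exp_zero] at h1
    simpa using ENNReal.tendsto_ofReal h1
  rw [one_mul] at hlim
  exact ge_of_tendsto hlim (Filter.eventually_atTop.2 ⟨t / θ, key⟩)

end SoftMax

/-! ### Gaussian processes with stationary increments on a countable group -/

lemma memLp_two_of_isGaussianProcess {T Ω : Type*} [MeasurableSpace Ω] {μ : Measure Ω}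
    {X : T → Ω → ℝ} (hX : IsGaussianProcess X μ) (t : T) : MemLp (X t) 2 μ :=
  (hX.hasGaussianLaw_eval t).memLp_two

/-- A linear form on `ℝ ^ ι`, in coordinates. -/
lemma strongDual_pi_apply {ι : Type*} [Fintype ι] [DecidableEq ι] (L : StrongDual ℝ (ι → ℝ))
    (x : ι → ℝ) : L x = ∑ i, L (Pi.single i 1) * x i := by
  conv_lhs => rw [pi_eq_sum_univ' x, map_sum]
  refine Finset.sum_congr rfl fun i _ ↦ ?_
  rw [map_smul, smul_eq_mul, mul_comm]

/-- A centered Gaussian process is determined by its covariance. -/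
theorem measure_ext_of_covariance {T : Type*} {P P' : Measure (T → ℝ)}
    (hP : IsGaussianProcess (fun t (x : T → ℝ) ↦ x t) P)
    (hP' : IsGaussianProcess (fun t (x : T → ℝ) ↦ x t) P')
    (h0 : ∀ t, ∫ x, x t ∂P = 0) (h0' : ∀ t, ∫ x, x t ∂P' = 0)
    (hc : ∀ s t, cov[fun x : T → ℝ ↦ x s, fun x ↦ x t; P] =
      cov[fun x : T → ℝ ↦ x s, fun x ↦ x t; P']) : P = P' := by
  classical
  have := hP.isProbabilityMeasure
  have := hP'.isProbabilityMeasure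
  have key : ∀ {Q : Measure (T → ℝ)} (hQ : IsGaussianProcess (fun t (x : T → ℝ) ↦ x t) Q)
      (_ : ∀ t, ∫ x, x t ∂Q = 0) (I : Finset T) (L : StrongDual ℝ (I → ℝ)),
      charFunDual (Q.map I.restrict) L = Complex.exp (-(∑ i : I, ∑ j : I, L (Pi.single i 1) *
        (L (Pi.single j 1) * cov[fun x : T → ℝ ↦ x i, fun x ↦ x j; Q]) : ℝ) / 2) := by
    intro Q hQ hQ0 I L
    have := hQ.isProbabilityMeasure
    have hG : IsGaussian (Q.map I.restrict) := (hQ.hasGaussianLaw I).isGaussian_map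
    have hI : Measurable (I.restrict (π := fun _ ↦ ℝ)) := Finset.measurable_restrict I
    have hm : ∀ t, MemLp (fun x : T → ℝ ↦ x t) 2 Q := memLp_two_of_isGaussianProcess hQ
    rw [IsGaussian.charFunDual_eq_of_forall_strongDual_eq_zero]
    · congr 4
      rw [variance_map (by fun_prop) (by fun_prop)]
      have : (⇑L ∘ I.restrict : (T → ℝ) → ℝ) = fun x ↦ ∑ i : I, L (Pi.single i 1) * x i := by
        funext x
        rw [Function.comp_apply, strongDual_pi_apply]
        rfl
      rw [this, variance_fun_sum fun i ↦ (hm _).const_mul _]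
      refine Finset.sum_congr rfl fun i _ ↦ Finset.sum_congr rfl fun j _ ↦ ?_
      rw [covariance_const_mul_left, covariance_const_mul_right]
    · intro L
      rw [integral_map (by fun_prop) (by fun_prop)]
      have hL : ∫ x, L (I.restrict x) ∂Q = ∫ x : T → ℝ, ∑ i : I, L (Pi.single i 1) * x i ∂Q :=
        integral_congr_ae (ae_of_all _ fun x ↦ strongDual_pi_apply L _)
      rw [hL]
      rw [integral_finsetSum _ fun i _ ↦ ((hm _).integrable one_le_two).const_mul _]
      refine Finset.sum_eq_zero fun i _ ↦ ?_
      rw [integral_const_mul]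
      exact mul_eq_zero_of_right _ (hQ0 i)
  have hproj : ∀ I : Finset T, P.map I.restrict = P'.map I.restrict := by
    intro I
    have : IsProbabilityMeasure (P.map (I.restrict (π := fun _ ↦ ℝ))) :=
      Measure.isProbabilityMeasure_map (Finset.measurable_restrict I).aemeasurable
    have : IsProbabilityMeasure (P'.map (I.restrict (π := fun _ ↦ ℝ))) :=
      Measure.isProbabilityMeasure_map (Finset.measurable_restrict I).aemeasurable
    refine Measure.ext_of_charFunDual (funext fun L ↦ ?_)
    simp only [key hP h0, key hP' h0', hc]
  refine IsProjectiveLimit.unique (P := fun I : Finset T ↦ P.map I.restrict) (fun I ↦ rfl)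
    fun I ↦ (hproj I).symm

/-- `P` is the law of a centered Gaussian process indexed by a group which vanishes at `0` and has
stationary increments: the increment between `h` and `g` has variance `v (h - g)`. -/
structure IsShiftGaussian {H : Type*} [AddCommGroup H] (v : H → ℝ) (P : Measure (H → ℝ)) :
    Prop where
  isGaussianProcess : IsGaussianProcess (fun h (x : H → ℝ) ↦ x h) P
  integral_eq_zero : ∀ h, ∫ x, x h ∂P = 0
  zero : ∀ᵐ x ∂P, x 0 = 0
  variance_sub : ∀ h g, Var[fun x : H → ℝ ↦ x h - x g; P] = v (h - g)

namespace IsShiftGaussian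

variable {H : Type*} [AddCommGroup H] {v : H → ℝ} {P P' : Measure (H → ℝ)}

lemma isProbabilityMeasure (hP : IsShiftGaussian v P) : IsProbabilityMeasure P :=
  hP.isGaussianProcess.isProbabilityMeasure

lemma memLp_two (hP : IsShiftGaussian v P) (h : H) : MemLp (fun x : H → ℝ ↦ x h) 2 P :=
  memLp_two_of_isGaussianProcess hP.isGaussianProcess h

lemma variance_eval (hP : IsShiftGaussian v P) (h : H) : Var[fun x : H → ℝ ↦ x h; P] = v h := by
  have := hP.variance_sub h 0
  rw [sub_zero] at this
  rw [← this]
  refine variance_congr ?_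
  filter_upwards [hP.zero] with x hx
  rw [hx, sub_zero]

lemma covariance_eval (hP : IsShiftGaussian v P) (h g : H) :
    cov[fun x : H → ℝ ↦ x h, fun x ↦ x g; P] = (v h + v g - v (h - g)) / 2 := by
  have := hP.isProbabilityMeasure
  have h1 := variance_fun_sub (hP.memLp_two h) (hP.memLp_two g)
  rw [hP.variance_sub, hP.variance_eval, hP.variance_eval] at h1
  linarith

lemma unique (hP : IsShiftGaussian v P) (hP' : IsShiftGaussian v P') : P = P' :=
  measure_ext_of_covariance hP.isGaussianProcess hP'.isGaussianProcess hP.integral_eq_zero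
    hP'.integral_eq_zero fun s t ↦ by rw [hP.covariance_eval, hP'.covariance_eval]

/-- The law of a process on a probability space, given the properties of the process. -/
lemma of_process {Ω : Type*} [MeasurableSpace Ω] {μ : Measure Ω} [Countable H] {X : H → Ω → ℝ}
    (hX : IsGaussianProcess X μ) (h0 : ∀ h, ∫ ω, X h ω ∂μ = 0) (hz : ∀ᵐ ω ∂μ, X 0 ω = 0)
    (hv : ∀ h g, Var[fun ω ↦ X h ω - X g ω; μ] = v (h - g)) :
    IsShiftGaussian v (μ.map fun ω h ↦ X h ω) := by
  have hm : AEMeasurable (fun ω h ↦ X h ω) μ := aemeasurable_pi_lambda _ fun h ↦ hX.aemeasurable h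
  refine ⟨⟨fun I ↦ ⟨?_⟩⟩, fun h ↦ ?_, ?_, fun h g ↦ ?_⟩
  · have := (hX.hasGaussianLaw I).isGaussian_map
    have hI : Measurable (I.restrict (π := fun _ : H ↦ ℝ)) := Finset.measurable_restrict I
    rw [show (fun ω : H → ℝ ↦ I.restrict fun x ↦ ω x) = I.restrict from rfl,
      AEMeasurable.map_map_of_aemeasurable hI.aemeasurable hm]
    exact this
  · rw [integral_map hm (measurable_pi_apply h).aestronglyMeasurable]
    exact h0 h
  · rw [ae_map_iff hm (measurableSet_eq_fun (by fun_prop) (by fun_prop))]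
    exact hz
  · rw [variance_map (by fun_prop) hm]
    exact hv h g

/-- Stationarity of the increments: the law is invariant under `x ↦ x (· + η) - x η`. -/
lemma map_shift [Countable H] (hP : IsShiftGaussian v P) (η : H) :
    P.map (fun (x : H → ℝ) h ↦ x (h + η) - x η) = P := by
  refine unique (of_process (v := v) (X := fun h (x : H → ℝ) ↦ x (h + η) - x η) ?_ ?_ ?_ ?_) hP
  · have := hP.isGaussianProcess.shift η
    simpa only [add_comm] using this
  · intro h
    have := hP.isProbabilityMeasure
    rw [integral_sub ((hP.memLp_two _).integrable one_le_two)
      ((hP.memLp_two _).integrable one_le_two), hP.integral_eq_zero, hP.integral_eq_zero, sub_zero]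
  · simp
  · intro h g
    simp only [sub_sub_sub_cancel_right]
    rw [hP.variance_sub, add_sub_add_right_eq_sub]

lemma lintegral_exp (hP : IsShiftGaussian v P) (h : H) (s : ℝ) :
    ∫⁻ x, ENNReal.ofReal (Real.exp (s * x h)) ∂P
      = ENNReal.ofReal (Real.exp (s ^ 2 * v h / 2)) := by
  have := hP.isProbabilityMeasure
  have hG := (hP.isGaussianProcess.hasGaussianLaw_eval h).map_eq_gaussianReal
  have hm := mgf_gaussianReal hG s
  have hi : Integrable (fun x : H → ℝ ↦ Real.exp (s * x h)) P := by
    have := integrable_exp_mul_gaussianReal (μ := ∫ x, x h ∂P)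
      (v := Var[fun x : H → ℝ ↦ x h; P].toNNReal) s
    rw [← hG] at this
    exact this.comp_measurable (measurable_pi_apply h)
  rw [← ofReal_integral_eq_lintegral_ofReal hi (ae_of_all _ fun x ↦ Real.exp_nonneg _)]
  rw [mgf] at hm
  rw [hm, hP.integral_eq_zero, hP.variance_eval, Real.coe_toNNReal]
  · congr 2
    ring
  · rw [← hP.variance_eval h]
    exact variance_nonneg _ _

/-- The finite-dimensional marginals of `P` are invariant under rotations of two copies. -/
lemma map_rotation_restrict (hP : IsShiftGaussian v P) (I : Finset H) (θ : ℝ) :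
    ((P.map I.restrict).prod (P.map I.restrict)).map
      (ContinuousLinearMap.rotation (E := I → ℝ) θ) =
      (P.map I.restrict).prod (P.map I.restrict) := by
  classical
  have := hP.isProbabilityMeasure
  have hG : IsGaussian (P.map I.restrict) :=
    (hP.isGaussianProcess.hasGaussianLaw I).isGaussian_map
  have hI : Measurable (I.restrict (π := fun _ : H ↦ ℝ)) := Finset.measurable_restrict I
  refine IsGaussian.map_rotation_eq_self_of_forall_strongDual_eq_zero (fun L ↦ ?_) θ
  rw [integral_map (by fun_prop) (by fun_prop)]
  have hL : ∫ x, L (I.restrict x) ∂P = ∫ x : H → ℝ, ∑ i : I, L (Pi.single i 1) * x i ∂P :=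
    integral_congr_ae (ae_of_all _ fun x ↦ strongDual_pi_apply L _)
  rw [hL]
  rw [integral_finsetSum _ fun i _ ↦ ((hP.memLp_two _).integrable one_le_two).const_mul _]
  refine Finset.sum_eq_zero fun i _ ↦ ?_
  rw [integral_const_mul]
  exact mul_eq_zero_of_right _ (hP.integral_eq_zero i)

end IsShiftGaussian

/-! ### Maxima of Gaussian processes with drift -/

/-- The maximum of the process `x` with drift `-D`. -/
def maxVal {H : Type*} (D : H → ℝ) (x : H → ℝ) : ℝ := ⨆ h, (x h - D h)

@[fun_prop]
lemma measurable_maxVal {H : Type*} [Countable H] (D : H → ℝ) : Measurable (maxVal D) :=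
  Measurable.iSup fun h ↦ (measurable_pi_apply h).sub measurable_const

/-- Suprema over an exhausting sequence of finite sets converge to the full supremum. -/
lemma tendsto_iSup_finset {H : Type*} {y : H → ℝ} (hy : BddAbove (Set.range y))
    {S : ℕ → Finset H} (hS : ∀ h, ∀ᶠ n in Filter.atTop, h ∈ S n) [∀ n, Nonempty (S n)] :
    Filter.Tendsto (fun n ↦ ⨆ i : S n, y i) Filter.atTop (nhds (⨆ h, y h)) := by
  have : Nonempty H := ⟨(Classical.arbitrary (S 0)).1⟩
  refine tendsto_order.2 ⟨fun a ha ↦ ?_, fun a ha ↦ ?_⟩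
  · obtain ⟨h, hh⟩ := exists_lt_of_lt_ciSup ha
    filter_upwards [hS h] with n hn
    exact hh.trans_le (le_ciSup (f := fun i : S n ↦ y i) (Set.finite_range _).bddAbove ⟨h, hn⟩)
  · exact Filter.Eventually.of_forall fun n ↦
      (ciSup_le fun i : S n ↦ le_ciSup hy i.1).trans_lt ha

/-- Concentration of the maximum of a Gaussian process with drift: the product of the exponential
moments of `maxVal D` and `-maxVal D` is bounded by exponential moments of the response of the
maximum to tilts of the drift by `θ f j`. -/
theorem IsShiftGaussian.mgf_mul_mgf_neg_maxVal_le {H : Type*} [AddCommGroup H] [Countable H]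
    {v : H → ℝ} {P : Measure (H → ℝ)} (hP : IsShiftGaussian v P) {D : H → ℝ} (hD : D 0 = 0)
    {l t θ w : ℝ} (hl : 0 ≤ l) (ht : 0 < t) (hθ : 0 < θ) (hw : 0 ≤ w)
    {J : Type*} [Fintype J] (f : J → H → ℝ)
    (hf : ∀ h, Real.exp (l ^ 2 * (Real.pi ^ 2 / 8) * v h) ≤ w * ∑ j, Real.exp (t * f j h))
    (hb : ∀ᵐ x ∂P, BddAbove (Set.range fun h ↦ x h - D h))
    (hbj : ∀ j, ∀ᵐ x ∂P, BddAbove (Set.range fun h ↦ x h - (D - θ • f j) h))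
    (hint : ∀ j, ∫⁻ x, ENNReal.ofReal (Real.exp (t / θ * maxVal (D - θ • f j) x)) ∂P ≠ ∞) :
    (∫⁻ x, ENNReal.ofReal (Real.exp (l * maxVal D x)) ∂P) *
      (∫⁻ x, ENNReal.ofReal (Real.exp (-(l * maxVal D x))) ∂P) ≤
    ENNReal.ofReal w * ∑ j, ∫⁻ x, ENNReal.ofReal (Real.exp
      (t / θ * (maxVal (D - θ • f j) x - maxVal D x))) ∂P := by
  classical
  have := hP.isProbabilityMeasure
  have htθ : 0 < t / θ := div_pos ht hθ
  obtain ⟨e, he⟩ := exists_surjective_nat H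
  set S : ℕ → Finset H := fun n ↦ insert 0 ((Finset.range n).image e) with hSdef
  have hS0 : ∀ n, (0 : H) ∈ S n := fun n ↦ Finset.mem_insert_self _ _
  have hSne : ∀ n, Nonempty (S n) := fun n ↦ ⟨⟨0, hS0 n⟩⟩
  have hSmono : Monotone S := fun m n hmn ↦
    Finset.insert_subset_insert _ (Finset.image_subset_image (Finset.range_mono hmn))
  have hS : ∀ h, ∀ᶠ n in Filter.atTop, h ∈ S n := by
    intro h
    obtain ⟨k, rfl⟩ := he h
    filter_upwards [Filter.eventually_gt_atTop k] with n hn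
    exact Finset.mem_insert_of_mem (Finset.mem_image_of_mem e (Finset.mem_range.2 hn))
  -- the maxima over the finite sets `S n`
  set N : ℕ → (H → ℝ) → (H → ℝ) → ℝ := fun n E x ↦ ⨆ i : S n, (x i - E i) with hN
  have hNm : ∀ n E, Measurable (N n E) := fun n E ↦
    Measurable.iSup fun i ↦ (measurable_pi_apply i.1).sub measurable_const
  have hN0 : ∀ n, ∀ᵐ x ∂P, 0 ≤ N n D x := by
    intro n
    filter_upwards [hP.zero] with x hx
    have := le_ciSup (f := fun i : S n ↦ x i - D i) (Set.finite_range _).bddAbove ⟨0, hS0 n⟩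
    simpa [hx, hD] using this
  have hNle : ∀ n E x, BddAbove (Set.range fun h ↦ x h - E h) → N n E x ≤ maxVal E x :=
    fun n E x hx ↦ ciSup_le fun i ↦ le_ciSup hx i.1
  have hNmono : ∀ E x, Monotone fun n ↦ N n E x := fun E x m n hmn ↦
    ciSup_le fun i ↦ le_ciSup (f := fun i : S n ↦ x i - E i) (Set.finite_range _).bddAbove
      ⟨i.1, hSmono hmn i.2⟩
  have hfin : ∀ n, (∫⁻ x, ENNReal.ofReal (Real.exp (l * N n D x)) ∂P) *
      (∫⁻ x, ENNReal.ofReal (Real.exp (-(l * N n D x))) ∂P) ≤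
      ENNReal.ofReal w * ∑ j, ∫⁻ x, ENNReal.ofReal (Real.exp
        (t / θ * (N n (D - θ • f j) x - N n D x))) ∂P := by
    intro n
    have hI : Measurable ((S n).restrict (π := fun _ : H ↦ ℝ)) := Finset.measurable_restrict _
    have : IsProbabilityMeasure (P.map ((S n).restrict (π := fun _ : H ↦ ℝ))) :=
      Measure.isProbabilityMeasure_map hI.aemeasurable
    have hv : ∀ (i : S n) (s : ℝ), ∫⁻ x, ENNReal.ofReal (Real.exp (s * x i)) ∂(P.map (S n).restrict)
        = ENNReal.ofReal (Real.exp (s ^ 2 * v i / 2)) := by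
      intro i s
      rw [lintegral_map (by fun_prop) hI]
      exact hP.lintegral_exp i.1 s
    have h := mgf_mul_mgf_neg_iSup_le (hP.map_rotation_restrict (S n)) hv (fun i ↦ -D i)
      hl ht hθ hw (fun j (i : S n) ↦ f j i) fun i ↦ hf i
    have hsup : ∀ c : S n → ℝ, Measurable fun x : S n → ℝ ↦ ⨆ i, (x + c) i := fun c ↦
      Measurable.iSup fun i ↦ (by simp only [Pi.add_apply]; fun_prop)
    have hsupD := hsup fun i ↦ -D i
    have hsupj : ∀ j, Measurable fun x : S n → ℝ ↦
        ⨆ i, (x + (fun i : S n ↦ -D i) + θ • fun i : S n ↦ f j i) i := fun j ↦ by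
      simpa only [add_assoc] using hsup ((fun i : S n ↦ -D i) + θ • fun i : S n ↦ f j i)
    rw [lintegral_map (by fun_prop) hI, lintegral_map (by fun_prop) hI] at h
    have hR : ∀ j, ∫⁻ x, ENNReal.ofReal (Real.exp (t / θ *
        ((⨆ i, (x + (fun i : S n ↦ -D i) + θ • fun i : S n ↦ f j i) i) -
          ⨆ i, (x + fun i : S n ↦ -D i) i)))
          ∂(P.map (S n).restrict) = ∫⁻ x, ENNReal.ofReal (Real.exp
        (t / θ * (N n (D - θ • f j) x - N n D x))) ∂P := by
      intro j
      have := hsupj j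
      rw [lintegral_map (by fun_prop) hI]
      refine lintegral_congr fun x ↦ ?_
      congr 4
      · refine iSup_congr fun i ↦ ?_
        simp only [Pi.add_apply, Pi.smul_apply, Pi.sub_apply, Finset.restrict, smul_eq_mul]
        ring
    simp only [hR] at h
    exact h
  have hlim1 : Filter.Tendsto (fun n ↦ ∫⁻ x, ENNReal.ofReal (Real.exp (l * N n D x)) ∂P)
      Filter.atTop (nhds (∫⁻ x, ENNReal.ofReal (Real.exp (l * maxVal D x)) ∂P)) := by
    refine lintegral_tendsto_of_tendsto_of_monotone (fun n ↦ ?_) ?_ ?_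
    · have := hNm n D
      fun_prop
    · refine ae_of_all _ fun x m n hmn ↦ ?_
      exact ENNReal.ofReal_le_ofReal (Real.exp_le_exp.2
        (mul_le_mul_of_nonneg_left (hNmono D x hmn) hl))
    · filter_upwards [hb] with x hx
      have := tendsto_iSup_finset hx hS
      exact ENNReal.tendsto_ofReal ((Real.continuous_exp.tendsto _).comp (this.const_mul l))
  have hlim2 : ∀ j, Filter.Tendsto (fun n ↦ ∫⁻ x, ENNReal.ofReal (Real.exp
        (t / θ * (N n (D - θ • f j) x - N n D x))) ∂P) Filter.atTop
      (nhds (∫⁻ x, ENNReal.ofReal (Real.exp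
        (t / θ * (maxVal (D - θ • f j) x - maxVal D x))) ∂P)) := by
    intro j
    refine tendsto_lintegral_of_dominated_convergence
      (fun x ↦ ENNReal.ofReal (Real.exp (t / θ * maxVal (D - θ • f j) x))) (fun n ↦ ?_)
      (fun n ↦ ?_) (hint j) ?_
    · have := hNm n D
      have := hNm n (D - θ • f j)
      fun_prop
    · filter_upwards [hbj j, hN0 n] with x hx hx0
      have := hNle n _ x hx
      refine ENNReal.ofReal_le_ofReal (Real.exp_le_exp.2 (mul_le_mul_of_nonneg_left ?_ htθ.le))
      linarith
    · filter_upwards [hbj j, hb] with x hx hx'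
      have h1 := tendsto_iSup_finset hx hS
      have h2 := tendsto_iSup_finset hx' hS
      exact ENNReal.tendsto_ofReal ((Real.continuous_exp.tendsto _).comp
        ((h1.sub h2).const_mul (t / θ)))
  have hneg : ∀ n, ∫⁻ x, ENNReal.ofReal (Real.exp (-(l * maxVal D x))) ∂P ≤
      ∫⁻ x, ENNReal.ofReal (Real.exp (-(l * N n D x))) ∂P := by
    intro n
    refine lintegral_mono_ae ?_
    filter_upwards [hb] with x hx
    have := hNle n D x hx
    gcongr
  have hneg1 : ∫⁻ x, ENNReal.ofReal (Real.exp (-(l * maxVal D x))) ∂P ≠ ∞ := by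
    refine ne_top_of_le_ne_top ENNReal.one_ne_top
      ((lintegral_mono_ae (g := fun _ ↦ 1) ?_).trans (by simp))
    filter_upwards [hb, hN0 0] with x hx hx0
    have := mul_nonneg hl (hx0.trans (hNle 0 D x hx))
    rw [ENNReal.ofReal_le_one]
    exact Real.exp_le_one_iff.2 (by linarith)
  refine le_of_tendsto_of_tendsto' (ENNReal.Tendsto.mul_const hlim1 (Or.inr hneg1))
    (ENNReal.Tendsto.const_mul (tendsto_finsetSum _ fun j _ ↦ hlim2 j)
      (Or.inr ENNReal.ofReal_ne_top)) fun n ↦ ?_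
  exact (mul_le_mul_right (hneg n) _).trans (hfin n)

/-! ### The self-improving estimate for the fluctuations of the maximum -/

/-- The exponential moments of the maximum of the process with drift `-D`. -/
def expMoment {H : Type*} (P : Measure (H → ℝ)) (D : H → ℝ) (κ : ℝ) : ℝ≥0∞ :=
  ∫⁻ x, ENNReal.ofReal (Real.exp (κ * maxVal D x)) ∂P

/-- The process with drift `-D` is bounded above, and its maximum has all exponential moments. -/
structure HasExpMoments {H : Type*} (P : Measure (H → ℝ)) (D : H → ℝ) : Prop where
  bddAbove : ∀ᵐ x ∂P, BddAbove (Set.range fun h ↦ x h - D h)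
  ne_top : ∀ κ, 0 ≤ κ → expMoment P D κ ≠ ∞

/-- Cauchy–Schwarz for exponentials. -/
lemma lintegral_exp_add_sq_le {Ω : Type*} [MeasurableSpace Ω] (μ : Measure Ω) {a b : Ω → ℝ}
    (ha : AEMeasurable a μ) (hb : AEMeasurable b μ) :
    (∫⁻ ω, ENNReal.ofReal (Real.exp (a ω + b ω)) ∂μ) ^ 2 ≤
      (∫⁻ ω, ENNReal.ofReal (Real.exp (2 * a ω)) ∂μ) *
        ∫⁻ ω, ENNReal.ofReal (Real.exp (2 * b ω)) ∂μ := by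
  have h := ENNReal.lintegral_mul_le_Lp_mul_Lq μ Real.HolderConjugate.two_two
    (f := fun ω ↦ ENNReal.ofReal (Real.exp (a ω))) (g := fun ω ↦ ENNReal.ofReal (Real.exp (b ω)))
    (by fun_prop) (by fun_prop)
  have e : ∀ r : ℝ, ENNReal.ofReal (Real.exp r) ^ (2 : ℝ) = ENNReal.ofReal (Real.exp (2 * r)) := by
    intro r
    rw [ENNReal.ofReal_rpow_of_pos (Real.exp_pos _), ← Real.exp_mul, mul_comm]
  simp only [Pi.mul_apply, ← ENNReal.ofReal_mul (Real.exp_nonneg _), ← Real.exp_add, e] at h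
  have h2 := pow_le_pow_left' h 2
  rw [mul_pow, ← ENNReal.rpow_mul_natCast, ← ENNReal.rpow_mul_natCast] at h2
  norm_num at h2
  exact h2

namespace IsShiftGaussian

variable {H : Type*} [AddCommGroup H] {v : H → ℝ} {P : Measure (H → ℝ)}
  {D g : H → ℝ} {η : H} {γ : ℝ}

lemma measurable_shift (η : H) : Measurable fun (x : H → ℝ) h ↦ x (h + η) - x η :=
  measurable_pi_lambda _ fun _ ↦ (measurable_pi_apply _).sub (measurable_pi_apply _)

/-- A tilt `g` of the drift which, up to the constant `γ`, amounts to a translation by `η`, turns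
the maximum into the maximum of the shifted process, up to the value at `η`. -/
lemma maxVal_sub_eq (hg : ∀ k, D (k + η) - g (k + η) = D k - γ) {x : H → ℝ}
    (hx : BddAbove (Set.range fun h ↦ (x (h + η) - x η) - D h)) :
    BddAbove (Set.range fun h ↦ x h - (D - g) h) ∧
      maxVal (D - g) x = γ + x η + maxVal D (fun h ↦ x (h + η) - x η) := by
  have e : ∀ k, x (k + η) - (D - g) (k + η) = γ + x η + ((x (k + η) - x η) - D k) := by
    intro k
    rw [Pi.sub_apply, hg]
    ring
  have hre : (fun h ↦ x h - (D - g) h) =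
      (fun k ↦ γ + x η + ((x (k + η) - x η) - D k)) ∘ (Equiv.addRight η).symm := by
    funext h
    rw [Function.comp_apply, ← e]
    simp
  have hb : BddAbove (Set.range fun k ↦ γ + x η + ((x (k + η) - x η) - D k)) := by
    obtain ⟨C, hC⟩ := hx
    refine ⟨γ + x η + C, ?_⟩
    rintro _ ⟨k, rfl⟩
    exact add_le_add_right (hC ⟨k, rfl⟩) _
  refine ⟨?_, ?_⟩
  · rw [hre, (Equiv.addRight η).symm.surjective.range_comp]
    exact hb
  · rw [maxVal, hre, maxVal, add_ciSup hx]
    exact Function.Surjective.iSup_comp (f := (Equiv.addRight η).symm) (Equiv.surjective _)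
      (fun k ↦ γ + x η + ((x (k + η) - x η) - D k))

variable [Countable H]

lemma ae_shift (hP : IsShiftGaussian v P) (η : H) {p : (H → ℝ) → Prop} (hp : ∀ᵐ x ∂P, p x) :
    ∀ᵐ x ∂P, p (fun h ↦ x (h + η) - x η) := by
  rw [← hP.map_shift η] at hp
  exact ae_of_ae_map (measurable_shift η).aemeasurable hp

lemma ae_maxVal_sub_eq (hP : IsShiftGaussian v P) (hM : HasExpMoments P D)
    (hg : ∀ k, D (k + η) - g (k + η) = D k - γ) :
    ∀ᵐ x ∂P, BddAbove (Set.range fun h ↦ x h - (D - g) h) ∧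
      maxVal (D - g) x = γ + x η + maxVal D (fun h ↦ x (h + η) - x η) := by
  filter_upwards [hP.ae_shift η hM.bddAbove] with x hx using maxVal_sub_eq hg hx

lemma lintegral_comp_shift (hP : IsShiftGaussian v P) (η : H) {F : (H → ℝ) → ℝ≥0∞}
    (hF : Measurable F) : ∫⁻ x, F (fun h ↦ x (h + η) - x η) ∂P = ∫⁻ x, F x ∂P := by
  conv_rhs => rw [← hP.map_shift η, lintegral_map hF (measurable_shift η)]

/-- The exponential moments of the tilted maximum are finite. -/
lemma lintegral_exp_maxVal_sub_ne_top (hP : IsShiftGaussian v P) (hM : HasExpMoments P D)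
    (hg : ∀ k, D (k + η) - g (k + η) = D k - γ) {τ : ℝ} (hτ : 0 ≤ τ) :
    ∫⁻ x, ENNReal.ofReal (Real.exp (τ * maxVal (D - g) x)) ∂P ≠ ∞ := by
  have hm : Measurable fun x : H → ℝ ↦ maxVal D (fun h ↦ x (h + η) - x η) :=
    (measurable_maxVal D).comp (measurable_shift η)
  have h1 : ∫⁻ x, ENNReal.ofReal (Real.exp (τ * maxVal (D - g) x)) ∂P =
      ENNReal.ofReal (Real.exp (τ * γ)) * ∫⁻ x, ENNReal.ofReal (Real.exp
        (τ * x η + τ * maxVal D (fun h ↦ x (h + η) - x η))) ∂P := by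
    rw [← lintegral_const_mul' _ _ ENNReal.ofReal_ne_top]
    refine lintegral_congr_ae ?_
    filter_upwards [hP.ae_maxVal_sub_eq hM hg] with x hx
    rw [hx.2, ← ENNReal.ofReal_mul (Real.exp_nonneg _), ← Real.exp_add]
    congr 2
    ring
  rw [h1]
  refine ENNReal.mul_ne_top ENNReal.ofReal_ne_top ?_
  have h2 := lintegral_exp_add_sq_le P (a := fun x ↦ τ * x η)
    (b := fun x ↦ τ * maxVal D (fun h ↦ x (h + η) - x η))
    (Measurable.aemeasurable (by fun_prop)) (by fun_prop)
  have h3 : ∫⁻ x, ENNReal.ofReal (Real.exp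
      (2 * (τ * maxVal D (fun h ↦ x (h + η) - x η)))) ∂P = expMoment P D (2 * τ) := by
    simp only [← mul_assoc]
    exact hP.lintegral_comp_shift η (F := fun x ↦ ENNReal.ofReal (Real.exp (2 * τ * maxVal D x)))
      (by fun_prop)
  rw [h3] at h2
  simp only [← mul_assoc] at h2
  rw [hP.lintegral_exp] at h2
  have h4 := ne_top_of_le_ne_top
    (ENNReal.mul_ne_top ENNReal.ofReal_ne_top (hM.ne_top (2 * τ) (by positivity))) h2
  exact fun h ↦ h4 (by rw [h]; simp)

/-- The exponential moments of the response of the maximum to a tilt, in terms of those of the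
fluctuations of the maximum itself. -/
lemma lintegral_exp_response_pow_le (hP : IsShiftGaussian v P) (hM : HasExpMoments P D)
    (hg : ∀ k, D (k + η) - g (k + η) = D k - γ) (τ : ℝ) :
    (∫⁻ x, ENNReal.ofReal (Real.exp (τ * (maxVal (D - g) x - maxVal D x))) ∂P) ^ 4 ≤
      ENNReal.ofReal (Real.exp (4 * τ * γ + 4 * τ ^ 2 * v η)) *
        (expMoment P D (4 * τ) * expMoment P D (-(4 * τ))) := by
  have hm : Measurable fun x : H → ℝ ↦ maxVal D (fun h ↦ x (h + η) - x η) :=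
    (measurable_maxVal D).comp (measurable_shift η)
  have hη : Measurable fun x : H → ℝ ↦ x η := measurable_pi_apply η
  have h1 : ∫⁻ x, ENNReal.ofReal (Real.exp (τ * (maxVal (D - g) x - maxVal D x))) ∂P =
      ∫⁻ x, ENNReal.ofReal (Real.exp ((τ * γ + τ * x η) +
        (τ * maxVal D (fun h ↦ x (h + η) - x η) + -(τ * maxVal D x)))) ∂P := by
    refine lintegral_congr_ae ?_
    filter_upwards [hP.ae_maxVal_sub_eq hM hg] with x hx
    rw [hx.2]
    congr 2
    ring
  -- Cauchy–Schwarz separates the explicit factor from the response, and then the two maxima.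
  have h2 := lintegral_exp_add_sq_le P (a := fun x ↦ τ * γ + τ * x η)
    (b := fun x ↦ τ * maxVal D (fun h ↦ x (h + η) - x η) + -(τ * maxVal D x))
    (Measurable.aemeasurable (by fun_prop)) (by fun_prop)
  have h3 := lintegral_exp_add_sq_le P
    (a := fun x ↦ 2 * (τ * maxVal D (fun h ↦ x (h + η) - x η)))
    (b := fun x ↦ 2 * -(τ * maxVal D x)) (by fun_prop) (by fun_prop)
  have e1 : ∫⁻ x, ENNReal.ofReal (Real.exp (2 * (τ * γ + τ * x η))) ∂P =
      ENNReal.ofReal (Real.exp (2 * τ * γ + 2 * τ ^ 2 * v η)) := by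
    have : ∀ x : H → ℝ, ENNReal.ofReal (Real.exp (2 * (τ * γ + τ * x η))) =
        ENNReal.ofReal (Real.exp (2 * τ * γ)) * ENNReal.ofReal (Real.exp (2 * τ * x η)) := by
      intro x
      rw [← ENNReal.ofReal_mul (Real.exp_nonneg _), ← Real.exp_add]
      congr 2
      ring
    simp only [this]
    rw [lintegral_const_mul' _ _ ENNReal.ofReal_ne_top, hP.lintegral_exp,
      ← ENNReal.ofReal_mul (Real.exp_nonneg _), ← Real.exp_add]
    congr 2
    ring
  have e2 : ∫⁻ x, ENNReal.ofReal (Real.exp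
      (2 * (2 * (τ * maxVal D (fun h ↦ x (h + η) - x η))))) ∂P = expMoment P D (4 * τ) := by
    rw [expMoment, ← hP.lintegral_comp_shift η
      (F := fun x ↦ ENNReal.ofReal (Real.exp (4 * τ * maxVal D x))) (by fun_prop)]
    refine lintegral_congr fun x ↦ ?_
    congr 2
    ring
  have e3 : ∫⁻ x, ENNReal.ofReal (Real.exp (2 * (2 * -(τ * maxVal D x)))) ∂P =
      expMoment P D (-(4 * τ)) := by
    refine lintegral_congr fun x ↦ ?_
    congr 2
    ring
  rw [e1] at h2
  rw [e2, e3] at h3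
  rw [h1, show (4 : ℕ) = 2 * 2 from rfl, pow_mul]
  refine (pow_le_pow_left' h2 2).trans ?_
  rw [mul_pow]
  refine mul_le_mul' (le_of_eq ?_) ?_
  · rw [← ENNReal.ofReal_pow (Real.exp_nonneg _), ← Real.exp_nat_mul]
    congr 2
    push_cast
    ring
  · simpa only [mul_add] using h3

/-- The self-improving estimate: Gaussian concentration bounds the fluctuations of the maximum by
its response to tilts, and stationarity of the increments bounds the response by the
fluctuations, with a smaller power. -/
theorem expMoment_mul_expMoment_neg_pow_le (hP : IsShiftGaussian v P) (hM : HasExpMoments P D)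
    (hD : D 0 = 0) {l θ w : ℝ} (hl : 0 < l) (hθ : 0 < θ) (hw : 0 ≤ w) {J : Type*} [Fintype J]
    (f : J → H → ℝ)
    (hf : ∀ h, Real.exp (l ^ 2 * (Real.pi ^ 2 / 8) * v h) ≤
      w * ∑ j, Real.exp (l / 4 * θ * f j h))
    {η : J → H} {γ : J → ℝ}
    (hg : ∀ j k, D (k + η j) - (θ • f j) (k + η j) = D k - γ j) {γ' v' : ℝ}
    (hγ : ∀ j, γ j ≤ γ') (hv : ∀ j, v (η j) ≤ v') :
    (expMoment P D l * expMoment P D (-l)) ^ 3 ≤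
      ENNReal.ofReal ((w * Fintype.card J) ^ 4 * Real.exp (l * γ' + l ^ 2 / 4 * v')) := by
  have := hP.isProbabilityMeasure
  set Q := expMoment P D l * expMoment P D (-l) with hQ
  set E := ENNReal.ofReal (Real.exp (l * γ' + l ^ 2 / 4 * v')) with hE
  have hl4 : 0 < l / 4 := by positivity
  have h1 := hP.mgf_mul_mgf_neg_maxVal_le hD (t := l / 4 * θ) (θ := θ) hl.le (by positivity) hθ hw
    f hf hM.bddAbove
    (fun j ↦ (hP.ae_maxVal_sub_eq hM (hg j)).mono fun x hx ↦ hx.1)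
    (fun j ↦ hP.lintegral_exp_maxVal_sub_ne_top hM (hg j) (by positivity))
  rw [mul_div_cancel_right₀ _ hθ.ne'] at h1
  set R : J → ℝ≥0∞ := fun j ↦ ∫⁻ x, ENNReal.ofReal (Real.exp
      (l / 4 * (maxVal (D - θ • f j) x - maxVal D x))) ∂P with hR
  have hRj : ∀ j, R j ^ 4 ≤ E * Q := by
    intro j
    refine (hP.lintegral_exp_response_pow_le hM (hg j) (l / 4)).trans ?_
    rw [show 4 * (l / 4) = l by ring]
    refine mul_le_mul' (ENNReal.ofReal_le_ofReal (Real.exp_le_exp.2 ?_)) le_rfl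
    have a1 := mul_le_mul_of_nonneg_left (hγ j) hl.le
    have a2 := mul_le_mul_of_nonneg_left (hv j) (by positivity : 0 ≤ l ^ 2 / 4)
    have a3 : 4 * (l / 4) ^ 2 * v (η j) = l ^ 2 / 4 * v (η j) := by ring
    linarith
  have hQ' : Q = (∫⁻ x, ENNReal.ofReal (Real.exp (l * maxVal D x)) ∂P) *
      (∫⁻ x, ENNReal.ofReal (Real.exp (-(l * maxVal D x))) ∂P) := by
    simp only [hQ, expMoment, neg_mul]
  rw [← hQ'] at h1
  -- Both sides of `h1` are expressed through `Q`, which cancels because it is finite.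
  have hne : expMoment P D (-l) ≤ 1 := by
    refine (lintegral_mono_ae (g := fun _ ↦ 1) ?_).trans (by simp)
    filter_upwards [hM.bddAbove, hP.zero] with x hx hx0
    have h0 : 0 ≤ maxVal D x := by
      have := le_ciSup hx 0
      simp only [hx0, hD, sub_zero] at this
      exact this
    rw [ENNReal.ofReal_le_one]
    exact Real.exp_le_one_iff.2 (by nlinarith)
  have hQtop : Q ≠ ∞ :=
    ENNReal.mul_ne_top (hM.ne_top l hl.le) (ne_top_of_le_ne_top ENNReal.one_ne_top hne)
  have hQ4 : Q ^ 4 ≤ ENNReal.ofReal ((w * Fintype.card J) ^ 4) * E * Q := by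
    set r : ℝ≥0∞ := (E * Q) ^ (1 / 4 : ℝ) with hr
    have hr4 : r ^ 4 = E * Q := by
      rw [hr, ← ENNReal.rpow_mul_natCast]
      norm_num
    have hRr : ∀ j, R j ≤ r := fun j ↦ by
      have := hRj j
      rw [← hr4] at this
      exact (ENNReal.pow_right_strictMono (by norm_num)).le_iff_le.1 this
    have h2 : Q ≤ ENNReal.ofReal (w * Fintype.card J) * r := by
      refine h1.trans ?_
      rw [ENNReal.ofReal_mul hw, mul_assoc, ENNReal.ofReal_natCast, ← nsmul_eq_mul,
        ← Finset.card_univ]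
      exact mul_le_mul_right (Finset.sum_le_card_nsmul _ _ _ fun j _ ↦ hRr j) _
    calc Q ^ 4 ≤ (ENNReal.ofReal (w * Fintype.card J) * r) ^ 4 := pow_le_pow_left' h2 4
      _ = _ := by
        rw [mul_pow, hr4, ← ENNReal.ofReal_pow (by positivity), mul_assoc]
  rw [ENNReal.ofReal_mul (by positivity)]
  by_cases hQ0 : Q = 0
  · rw [hQ0]
    simp
  · rw [pow_succ] at hQ4
    exact (ENNReal.mul_le_mul_iff_left hQ0 hQtop).1 hQ4

end IsShiftGaussian

/-! ### Rational paths, the Dirichlet form and its Green function -/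

/-- Rational-valued configurations on `{0, …, Λ}`, given by their values at the interior points.
They form a countable group, dense in the configurations. -/
abbrev RatPath (Λ : ℕ) : Type := Finset.Ioo 0 Λ → ℚ

variable {Λ : ℕ}

/-- The configuration with the given interior values. -/
def RatPath.toFun (k : RatPath Λ) (x : ℕ) : ℝ :=
  if h : x ∈ Finset.Ioo 0 Λ then (k ⟨x, h⟩ : ℝ) else 0

namespace RatPath

lemma toFun_of_notMem (k : RatPath Λ) {x : ℕ} (hx : x ∉ Finset.Ioo 0 Λ) : k.toFun x = 0 :=
  dif_neg hx

lemma toFun_coe (k : RatPath Λ) (x : Finset.Ioo 0 Λ) : k.toFun x = k x := dif_pos x.2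

lemma isConfiguration (k : RatPath Λ) : IsConfiguration Λ k.toFun :=
  ⟨k.toFun_of_notMem (by simp), fun x hx ↦ k.toFun_of_notMem (by simp; omega)⟩

lemma toFun_add (k g : RatPath Λ) : (k + g).toFun = k.toFun + g.toFun := by
  funext x
  simp only [toFun, Pi.add_apply]
  split_ifs <;> simp

lemma toFun_sub (k g : RatPath Λ) : (k - g).toFun = k.toFun - g.toFun := by
  funext x
  simp only [toFun, Pi.sub_apply]
  split_ifs <;> simp

lemma toFun_smul (q : ℚ) (k : RatPath Λ) : (q • k).toFun = (q : ℝ) • k.toFun := by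
  funext x
  simp only [toFun, Pi.smul_apply]
  split_ifs <;> simp

lemma toFun_zero : (0 : RatPath Λ).toFun = 0 := by
  funext x
  simp only [toFun, Pi.zero_apply]
  split_ifs <;> simp

end RatPath

/-- The variance of the field term along a path. -/
def pathVar (Λ : ℕ) (k : RatPath Λ) : ℝ := ∑ x ∈ Finset.Ioo 0 Λ, |k.toFun x|

/-- The Dirichlet energy on rational paths. -/
def pathEnergy (Λ : ℕ) (k : RatPath Λ) : ℝ := dirichletEnergy Λ k.toFun

/-- Evaluation at the site `x`. -/
def pathEval (x : ℕ) (k : RatPath Λ) : ℝ := k.toFun x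

/-- The Dirichlet form, whose quadratic form is twice the Dirichlet energy. -/
def dirichletForm (L : ℕ) (g h : ℕ → ℝ) : ℝ :=
  ∑ x ∈ Finset.Icc 1 L, (g x - g (x - 1)) * (h x - h (x - 1))

lemma dirichletEnergy_eq (L : ℕ) (h : ℕ → ℝ) :
    dirichletEnergy L h = 1 / 2 * dirichletForm L h h := by
  simp only [dirichletEnergy, dirichletForm, sq]

lemma dirichletEnergy_nonneg (L : ℕ) (h : ℕ → ℝ) : 0 ≤ dirichletEnergy L h := by
  unfold dirichletEnergy
  positivity

lemma dirichletEnergy_add (L : ℕ) (g h : ℕ → ℝ) :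
    dirichletEnergy L (g + h) =
      dirichletEnergy L g + dirichletEnergy L h + dirichletForm L g h := by
  simp only [dirichletEnergy, dirichletForm, Pi.add_apply, Finset.mul_sum,
    ← Finset.sum_add_distrib]
  exact Finset.sum_congr rfl fun x _ ↦ by ring

lemma dirichletForm_smul_left (L : ℕ) (c : ℝ) (g h : ℕ → ℝ) :
    dirichletForm L (c • g) h = c * dirichletForm L g h := by
  simp only [dirichletForm, Pi.smul_apply, smul_eq_mul, Finset.mul_sum]
  exact Finset.sum_congr rfl fun x _ ↦ by ring

lemma dirichletForm_comm (L : ℕ) (g h : ℕ → ℝ) : dirichletForm L g h = dirichletForm L h g := by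
  simp only [dirichletForm, mul_comm]

lemma dirichletEnergy_smul (L : ℕ) (c : ℝ) (h : ℕ → ℝ) :
    dirichletEnergy L (c • h) = c ^ 2 * dirichletEnergy L h := by
  rw [dirichletEnergy_eq, dirichletEnergy_eq, dirichletForm_smul_left, dirichletForm_comm,
    dirichletForm_smul_left]
  ring

/-- The Green function of the discrete Laplacian on `{0, …, Λ}` with zero boundary values. -/
def green (Λ x : ℕ) : RatPath Λ := fun y ↦
  if (y : ℕ) ≤ x then y * (Λ - x) / Λ else x * (Λ - y) / Λ

lemma toFun_green {x y : ℕ} (hx : x ∈ Finset.Ioo 0 Λ) (hy : y ≤ Λ) : (green Λ x).toFun y =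
    if y ≤ x then (y * (Λ - x) / Λ : ℝ) else x * (Λ - y) / Λ := by
  rw [Finset.mem_Ioo] at hx
  unfold RatPath.toFun green
  by_cases h : y ∈ Finset.Ioo 0 Λ
  · rw [dif_pos h]
    split_ifs <;> push_cast <;> rfl
  · rw [dif_neg h]
    rw [Finset.mem_Ioo] at h
    rcases Nat.eq_zero_or_pos y with rfl | h0
    · simp
    · obtain rfl : y = Λ := by omega
      rw [if_neg (by omega)]
      simp

/-- The reproducing property of the Green function. -/
lemma dirichletForm_green {x : ℕ} (hx : x ∈ Finset.Ioo 0 Λ) {h : ℕ → ℝ}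
    (hh : IsConfiguration Λ h) : dirichletForm Λ (green Λ x).toFun h = h x := by
  have hx' := Finset.mem_Ioo.1 hx
  have hΛ : (Λ : ℝ) ≠ 0 := by
    have : Λ ≠ 0 := by omega
    exact_mod_cast this
  have key : ∀ n ≤ Λ, dirichletForm n (green Λ x).toFun h =
      if n ≤ x then (Λ - x) / Λ * h n else (Λ - x) / Λ * h x - x / Λ * (h n - h x) := by
    intro n hn
    induction n with
    | zero => simp [dirichletForm, hh.1]
    | succ n ih =>
      have := ih (by omega)
      unfold dirichletForm at this ⊢
      rw [Finset.sum_Icc_succ_top (by omega), this, Nat.add_sub_cancel, toFun_green hx hn,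
        toFun_green hx (by omega)]
      rcases lt_trichotomy n x with h1 | h1 | h1
      · rw [if_pos (by omega), if_pos (by omega), if_pos (by omega), if_pos (by omega)]
        push_cast
        field_simp
        ring
      · subst h1
        rw [if_pos le_rfl, if_neg (by omega), if_pos le_rfl, if_neg (by omega)]
        push_cast
        field_simp
        ring
      · rw [if_neg (by omega), if_neg (by omega), if_neg (by omega), if_neg (by omega)]
        push_cast
        field_simp
        ring
  rw [key Λ le_rfl, if_neg (by omega), hh.2 Λ le_rfl]
  field_simp
  ring

lemma toFun_green_mem {x : ℕ} (hx : x ∈ Finset.Ioo 0 Λ) (y : ℕ) :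
    0 ≤ (green Λ x).toFun y ∧ (green Λ x).toFun y ≤ Λ := by
  by_cases hy : y ∈ Finset.Ioo 0 Λ
  · rw [toFun_green hx (Finset.mem_Ioo.1 hy).2.le]
    rw [Finset.mem_Ioo] at hx hy
    have h0 : (0 : ℝ) < Λ := by
      have : 0 < Λ := by omega
      exact_mod_cast this
    have h1 : (x : ℝ) ≤ Λ := by exact_mod_cast hx.2.le
    have h2 : (y : ℝ) ≤ Λ := by exact_mod_cast hy.2.le
    have h3 : (0 : ℝ) ≤ x := by positivity
    have h4 : (0 : ℝ) ≤ y := by positivity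
    split_ifs
    · exact ⟨div_nonneg (mul_nonneg h4 (by linarith)) h0.le, by
        rw [div_le_iff₀ h0]; exact mul_le_mul h2 (by linarith) (by linarith) h0.le⟩
    · exact ⟨div_nonneg (mul_nonneg h3 (by linarith)) h0.le, by
        rw [div_le_iff₀ h0]; exact mul_le_mul h1 (by linarith) (by linarith) h0.le⟩
  · rw [RatPath.toFun_of_notMem _ hy]
    exact ⟨le_rfl, by positivity⟩

/-- Tilting the Dirichlet energy at the site `x` amounts to a translation by a multiple of the
Green function. -/
lemma pathEnergy_shear {x : ℕ} (hx : x ∈ Finset.Ioo 0 Λ) (θ : ℚ) (k : RatPath Λ) :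
    pathEnergy Λ (k + θ • green Λ x) - ((θ : ℝ) • pathEval x) (k + θ • green Λ x) =
      pathEnergy Λ k - (θ : ℝ) ^ 2 * ((green Λ x).toFun x / 2) := by
  have h1 := dirichletForm_green hx k.isConfiguration
  have h2 := dirichletForm_green hx (green Λ x).isConfiguration
  simp only [pathEnergy, Pi.smul_apply, pathEval, RatPath.toFun_add, RatPath.toFun_smul,
    Pi.add_apply, dirichletEnergy_add, dirichletEnergy_smul, smul_eq_mul]
  rw [dirichletForm_comm, dirichletForm_smul_left, h1, dirichletEnergy_eq _ (green Λ x).toFun, h2]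
  ring

lemma pathEnergy_zero : pathEnergy Λ 0 = 0 := by
  simp [pathEnergy, RatPath.toFun_zero, dirichletEnergy]

lemma pathVar_smul_green_le {x : ℕ} (hx : x ∈ Finset.Ioo 0 Λ) (θ : ℚ) :
    pathVar Λ (θ • green Λ x) ≤ |(θ : ℝ)| * Λ ^ 2 := by
  have h1 : ∀ y ∈ Finset.Ioo 0 Λ, |(θ • green Λ x).toFun y| ≤ |(θ : ℝ)| * Λ := by
    intro y _
    rw [RatPath.toFun_smul, Pi.smul_apply, smul_eq_mul, abs_mul,
      abs_of_nonneg (toFun_green_mem hx y).1]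
    exact mul_le_mul_of_nonneg_left (toFun_green_mem hx y).2 (abs_nonneg _)
  refine (Finset.sum_le_card_nsmul _ _ _ h1).trans ?_
  rw [nsmul_eq_mul, Nat.card_Ioo]
  have : ((Λ - 0 - 1 : ℕ) : ℝ) ≤ Λ := by exact_mod_cast (by omega : Λ - 0 - 1 ≤ Λ)
  nlinarith [mul_nonneg (abs_nonneg (θ : ℝ)) (Nat.cast_nonneg (α := ℝ) Λ)]

/-- Jensen's inequality for the exponential of a sum. -/
lemma exp_sum_le {ι : Type*} (s : Finset ι) (hs : s.Nonempty) (a : ι → ℝ) :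
    Real.exp (∑ i ∈ s, a i) ≤ (s.card : ℝ)⁻¹ * ∑ i ∈ s, Real.exp (s.card * a i) := by
  have hc : (s.card : ℝ) ≠ 0 := by
    have := hs.card_pos
    positivity
  have := convexOn_exp.map_sum_le (t := s) (w := fun _ ↦ (s.card : ℝ)⁻¹)
    (p := fun i ↦ s.card * a i) (fun _ _ ↦ by positivity) (by simp [hc]) (fun _ _ ↦ trivial)
  simp only [smul_eq_mul, ← Finset.mul_sum] at this
  rwa [inv_mul_cancel_left₀ hc] at this

namespace IsShiftGaussian

variable {P : Measure (RatPath Λ → ℝ)}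

/-- On a block of length `Λ`, the maximum fluctuates on the scale `Λ`, and the tails of its
fluctuations have the exponent `3 / 2`. -/
theorem expMoment_mul_le (hP : IsShiftGaussian (pathVar Λ) P)
    (hM : HasExpMoments P (pathEnergy Λ)) (hΛ : 2 ≤ Λ) {ρ : ℚ} (hρ : 0 < ρ) :
    expMoment P (pathEnergy Λ) (ρ / Λ) * expMoment P (pathEnergy Λ) (-(ρ / Λ)) ≤
      ENNReal.ofReal (3 * Real.exp (5 * ρ ^ 3)) := by
  have hρ' : (0 : ℝ) < ρ := by exact_mod_cast hρ
  have hΛ' : (0 : ℝ) < Λ := by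
    have : 0 < Λ := by omega
    exact_mod_cast this
  have hne : (Finset.Ioo 0 Λ).Nonempty := ⟨1, by simp; omega⟩
  have hcard : ((Finset.Ioo 0 Λ).card : ℝ) ≠ 0 := by
    have := hne.card_pos
    positivity
  have hcardle : ((Finset.Ioo 0 Λ).card : ℝ) ≤ Λ := by
    rw [Nat.card_Ioo]
    exact_mod_cast (by omega : Λ - 0 - 1 ≤ Λ)
  -- the sign of the tilt
  let sg : Bool → ℚ := fun b ↦ if b then 1 else -1
  have hsg : ∀ b, sg b ^ 2 = 1 := by intro b; cases b <;> simp [sg]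
  have hsg' : ∀ b, |sg b| = 1 := by intro b; cases b <;> simp [sg]
  -- Jensen's inequality bounds `exp (∑ |k x|)` by tilts at all sites in both directions. Their
  -- strength `5 ρ` comes from `π ^ 2 / 8 ≤ 5 / 4`, times the `4` of the two applications of the
  -- Cauchy–Schwarz inequality.
  have h := hP.expMoment_mul_expMoment_neg_pow_le hM pathEnergy_zero (l := ρ / Λ) (θ := 5 * ρ)
    (w := ((Finset.Ioo 0 Λ).card : ℝ)⁻¹) (by positivity) (by positivity) (by positivity)
    (J := Finset.Ioo 0 Λ × Bool) (fun j ↦ (sg j.2 : ℝ) • pathEval (j.1 : ℕ)) ?_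
    (η := fun j ↦ (5 * ρ * sg j.2) • green Λ j.1)
    (γ := fun j ↦ ((5 * ρ * sg j.2 : ℚ) : ℝ) ^ 2 * ((green Λ j.1).toFun j.1 / 2)) ?_
    (γ' := 25 / 2 * ρ ^ 2 * Λ) (v' := 5 * ρ * Λ ^ 2) ?_ ?_
  · have e1 : (((Finset.Ioo 0 Λ).card : ℝ)⁻¹ * (Fintype.card (Finset.Ioo 0 Λ × Bool) : ℕ)) = 2 := by
      rw [Fintype.card_prod, Fintype.card_coe, Fintype.card_bool]
      push_cast
      field_simp
    rw [e1] at h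
    have e2 : ρ / Λ * (25 / 2 * ρ ^ 2 * Λ) + (ρ / Λ) ^ 2 / 4 * (5 * ρ * Λ ^ 2) =
        (55 / 4 * ρ ^ 3 : ℝ) := by
      field_simp
      ring
    rw [e2] at h
    refine (ENNReal.pow_right_strictMono (n := 3) (by norm_num)).le_iff_le.1 ?_
    refine h.trans ?_
    rw [← ENNReal.ofReal_pow (by positivity), mul_pow, ← Real.exp_nat_mul]
    refine ENNReal.ofReal_le_ofReal (mul_le_mul (by norm_num) (Real.exp_le_exp.2 ?_)
      (Real.exp_nonneg _) (by norm_num))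
    have : (0 : ℝ) < (ρ : ℝ) ^ 3 := by positivity
    push_cast
    linarith
  · intro k
    have hJ := exp_sum_le _ hne fun x ↦ (ρ / Λ) ^ 2 * (Real.pi ^ 2 / 8) * |k.toFun x|
    rw [← Finset.mul_sum] at hJ
    refine hJ.trans (mul_le_mul_of_nonneg_left ?_ (by positivity))
    rw [Fintype.sum_prod_type, ← Finset.sum_coe_sort]
    refine Finset.sum_le_sum fun x _ ↦ ?_
    have hpi : Real.pi ^ 2 ≤ 10 := by
      have := Real.pi_lt_d2
      nlinarith [Real.pi_pos]
    have hle : ((Finset.Ioo 0 Λ).card : ℝ) * ((ρ / Λ) ^ 2 * (Real.pi ^ 2 / 8) * |k.toFun x|) ≤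
        ρ / Λ / 4 * (5 * ρ) * |k.toFun x| := by
      rw [← mul_assoc]
      refine mul_le_mul_of_nonneg_right ?_ (abs_nonneg _)
      calc ((Finset.Ioo 0 Λ).card : ℝ) * ((ρ / Λ) ^ 2 * (Real.pi ^ 2 / 8))
          ≤ Λ * ((ρ / Λ) ^ 2 * (10 / 8)) := by gcongr
        _ = _ := by
          field_simp
          ring
    refine (Real.exp_le_exp.2 hle).trans ?_
    simp only [Fintype.sum_bool, sg, Pi.smul_apply, pathEval, smul_eq_mul]
    rcases abs_cases (k.toFun x) with ⟨h1, _⟩ | ⟨h1, _⟩ <;> rw [h1]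
    · refine le_trans (le_of_eq ?_) (le_add_of_nonneg_right (Real.exp_nonneg _))
      simp
    · refine le_trans (le_of_eq ?_) (le_add_of_nonneg_left (Real.exp_nonneg _))
      simp
  · intro j k
    rw [← pathEnergy_shear j.1.2]
    simp only [Pi.smul_apply, smul_eq_mul]
    push_cast
    ring
  · intro j
    have e : ((5 * ρ * sg j.2 : ℚ) : ℝ) ^ 2 = 25 * ρ ^ 2 := by
      rw [← Rat.cast_pow, mul_pow, hsg]
      push_cast
      ring
    rw [e]
    have := (toFun_green_mem j.1.2 j.1).2
    nlinarith [sq_nonneg (ρ : ℝ)]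
  · intro j
    refine (pathVar_smul_green_le j.1.2 _).trans (le_of_eq ?_)
    rw [← Rat.cast_abs, abs_mul, hsg', abs_of_pos (by positivity)]
    push_cast
    ring

/-- The maximum on a block responds to a tilt of strength `θ` at a site by more than `θ ^ 2 * Λ`
only with a probability of order `exp (-c |θ| ^ 3)`. -/
theorem measure_response_le (hP : IsShiftGaussian (pathVar Λ) P)
    (hM : HasExpMoments P (pathEnergy Λ)) {x : ℕ} (hx : x ∈ Finset.Ioo 0 Λ) (θ : ℚ) :
    P {y | (θ : ℝ) ^ 2 * Λ ≤
      maxVal (pathEnergy Λ - (θ : ℝ) • pathEval x) y - maxVal (pathEnergy Λ) y} ≤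
      ENNReal.ofReal (2 * Real.exp (-(|(θ : ℝ)| ^ 3 / 200))) := by
  have := hP.isProbabilityMeasure
  rcases eq_or_ne θ 0 with rfl | hθ
  · refine prob_le_one.trans ?_
    rw [← ENNReal.ofReal_one]
    refine ENNReal.ofReal_le_ofReal ?_
    simp
  have hx' := Finset.mem_Ioo.1 hx
  have hΛ : (0 : ℝ) < Λ := by
    have : 0 < Λ := by omega
    exact_mod_cast this
  set s : ℝ := |(θ : ℝ)| with hs
  have hs0 : 0 < s := abs_pos.2 (by exact_mod_cast hθ)
  have hθ2 : (θ : ℝ) ^ 2 = s ^ 2 := (sq_abs _).symm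
  -- With this `τ` the gain `s ^ 3 / 20` in Markov's inequality outweighs the losses `a1` and `a2`.
  set τ : ℝ := s / 20 / Λ / 4 with hτ
  have hτ0 : 0 < τ := by positivity
  have h1 := hP.lintegral_exp_response_pow_le hM (pathEnergy_shear hx θ) τ
  have h2 := hP.expMoment_mul_le hM (by omega) (ρ := |θ| / 20) (by positivity)
  have e4 : 4 * τ = ((|θ| / 20 : ℚ) : ℝ) / Λ := by
    rw [hτ, hs]
    push_cast
    ring
  rw [← e4] at h2
  set R : ℝ≥0∞ := ∫⁻ y, ENNReal.ofReal (Real.exp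
    (τ * (maxVal (pathEnergy Λ - (θ : ℝ) • pathEval x) y - maxVal (pathEnergy Λ) y))) ∂P with hR
  have h3 := h1.trans (mul_le_mul_right h2 _)
  -- Markov's inequality
  have h4 : ENNReal.ofReal (Real.exp (τ * (s ^ 2 * Λ))) * P {y | (θ : ℝ) ^ 2 * Λ ≤
      maxVal (pathEnergy Λ - (θ : ℝ) • pathEval x) y - maxVal (pathEnergy Λ) y} ≤ R := by
    refine le_trans ?_ (mul_meas_ge_le_lintegral₀ (by fun_prop)
      (ENNReal.ofReal (Real.exp (τ * (s ^ 2 * Λ)))))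
    refine mul_le_mul_right (measure_mono fun y hy ↦ ?_) _
    rw [Set.mem_ofPred_eq, hθ2] at hy
    exact ENNReal.ofReal_le_ofReal (Real.exp_le_exp.2 (mul_le_mul_of_nonneg_left hy hτ0.le))
  refine (ENNReal.pow_right_strictMono (n := 4) (by norm_num)).le_iff_le.1 ?_
  have h5 := (pow_le_pow_left' h4 4).trans h3
  rw [mul_pow, ← ENNReal.ofReal_pow (Real.exp_nonneg _), ← Real.exp_nat_mul,
    ← ENNReal.ofReal_mul (Real.exp_nonneg _)] at h5
  have h6 := mul_le_mul_right h5 (ENNReal.ofReal (Real.exp (-((4 : ℕ) * (τ * (s ^ 2 * Λ))))))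
  rw [← mul_assoc, ← ENNReal.ofReal_mul (Real.exp_nonneg _), ← Real.exp_add, neg_add_cancel,
    Real.exp_zero, ENNReal.ofReal_one, one_mul, ← ENNReal.ofReal_mul (Real.exp_nonneg _)] at h6
  refine h6.trans ?_
  rw [← ENNReal.ofReal_pow (by positivity), mul_pow, ← Real.exp_nat_mul]
  refine ENNReal.ofReal_le_ofReal ?_
  have e : Real.exp (-((4 : ℕ) * (τ * (s ^ 2 * Λ)))) * (Real.exp (4 * τ *
      ((θ : ℝ) ^ 2 * ((green Λ x).toFun x / 2)) + 4 * τ ^ 2 * pathVar Λ (θ • green Λ x)) *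
      (3 * Real.exp (5 * ((|θ| / 20 : ℚ) : ℝ) ^ 3))) = 3 * Real.exp (-((4 : ℕ) * (τ * (s ^ 2 * Λ)))
      + (4 * τ * ((θ : ℝ) ^ 2 * ((green Λ x).toFun x / 2)) +
        4 * τ ^ 2 * pathVar Λ (θ • green Λ x)) + 5 * ((|θ| / 20 : ℚ) : ℝ) ^ 3) := by
    simp only [Real.exp_add]
    ring
  rw [e]
  refine mul_le_mul (by norm_num) (Real.exp_le_exp.2 ?_) (Real.exp_nonneg _) (by norm_num)
  have a1 : 4 * τ * ((θ : ℝ) ^ 2 * ((green Λ x).toFun x / 2)) ≤ s ^ 3 / 40 := by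
    rw [hθ2]
    calc 4 * τ * (s ^ 2 * ((green Λ x).toFun x / 2)) ≤ 4 * τ * (s ^ 2 * (Λ / 2)) := by
          have := (toFun_green_mem hx x).2
          gcongr
      _ = s ^ 3 / 40 := by
          rw [hτ]
          field_simp
          ring
  have a2 : 4 * τ ^ 2 * pathVar Λ (θ • green Λ x) ≤ s ^ 3 / 1600 := by
    calc 4 * τ ^ 2 * pathVar Λ (θ • green Λ x) ≤ 4 * τ ^ 2 * (s * Λ ^ 2) := by
          have := pathVar_smul_green_le hx θ
          gcongr
      _ = s ^ 3 / 1600 := by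
          rw [hτ]
          field_simp
          ring
  have a3 : 4 * (τ * (s ^ 2 * Λ)) = s ^ 3 / 20 := by
    rw [hτ]
    field_simp
  have a4 : ((|θ| / 20 : ℚ) : ℝ) = s / 20 := by
    rw [hs]
    push_cast
    ring
  rw [a4]
  push_cast
  rw [a3]
  have : 0 < s ^ 3 := by positivity
  nlinarith

end IsShiftGaussian

/-! ### Exponential moments of the maximum -/

/-- The maximal inequality for a Brownian motion with rational times on a finite set of times,
by decomposition with respect to the first passage. -/
lemma IsShiftGaussian.measure_exists_finset_le {P : Measure (ℚ → ℝ)}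
    (hP : IsShiftGaussian (fun q : ℚ ↦ |(q : ℝ)|) P) {T : ℚ} (S : Finset ℚ)
    (hS : ∀ q ∈ S, 0 ≤ q ∧ q ≤ T) (u : ℝ) {κ : ℝ} (hκ : 0 ≤ κ) :
    P {x | ∃ q ∈ S, u ≤ x q} ≤ ENNReal.ofReal (Real.exp (-(κ * u) + κ ^ 2 * |(T : ℝ)| / 2)) := by
  classical
  have := hP.isProbabilityMeasure
  -- the first passage takes place at `q`
  set A : ℚ → Set (ℚ → ℝ) := fun q ↦ {x | u ≤ x q ∧ ∀ r ∈ S, r < q → x r < u} with hA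
  have hAm : ∀ q, MeasurableSet (A q) := by
    intro q
    have : A q = {x | u ≤ x q} ∩ ⋂ r ∈ S, ⋂ (_ : r < q), {x | x r < u} := by
      ext x
      simp [hA]
    rw [this]
    refine (measurableSet_le measurable_const (measurable_pi_apply q)).inter ?_
    exact Finset.measurableSet_biInter _ fun r _ ↦ MeasurableSet.iInter fun _ ↦
      measurableSet_lt (measurable_pi_apply r) measurable_const
  have hdisj : Set.PairwiseDisjoint (S : Set ℚ) A := by
    intro q hq r hr hqr
    refine Set.disjoint_left.2 fun x hx hx' ↦ ?_
    rcases lt_or_gt_of_ne hqr with h | h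
    · exact absurd (hx'.2 q hq h) (not_lt.2 hx.1)
    · exact absurd (hx.2 r hr h) (not_lt.2 hx'.1)
  have hunion : {x : ℚ → ℝ | ∃ q ∈ S, u ≤ x q} ⊆ ⋃ q ∈ S, A q := by
    rintro x ⟨q, hq, hx⟩
    obtain ⟨r, hr⟩ := (S.filter fun r ↦ u ≤ x r).exists_minimal ⟨q, by simp [hq, hx]⟩
    have hr1 := Finset.mem_filter.1 hr.1
    refine Set.mem_biUnion hr1.1 ⟨hr1.2, fun t ht htr ↦ ?_⟩
    by_contra hcon
    exact absurd (hr.2 (Finset.mem_filter.2 ⟨ht, not_lt.1 hcon⟩) htr.le) (not_le.2 htr)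
  -- the increment after the first passage is independent of it
  have hstep : ∀ q ∈ S, ENNReal.ofReal (Real.exp (κ * u)) * P (A q) ≤
      ∫⁻ x in A q, ENNReal.ofReal (Real.exp (κ * x T)) ∂P := by
    intro q hq
    have hindep : IndepFun (fun (x : ℚ → ℝ) (r : {r // r ∈ S ∧ r ≤ q}) ↦ x r)
        (fun (x : ℚ → ℝ) (_ : Unit) ↦ x T - x q) P := by
      refine IsGaussianProcess.indepFun_of_covariance_eq_zero
        (X := fun (r : {r // r ∈ S ∧ r ≤ q}) (x : ℚ → ℝ) ↦ x r)
        (Y := fun (_ : Unit) (x : ℚ → ℝ) ↦ x T - x q) ?_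
        (fun r ↦ (measurable_pi_apply _).aemeasurable) (fun _ ↦ by fun_prop) ?_
      · refine hP.isGaussianProcess.of_isGaussianProcess ?_
        rintro (r | _)
        · exact ⟨{(r : ℚ)}, ContinuousLinearMap.proj ⟨(r : ℚ), by simp⟩, fun x ↦ rfl⟩
        · exact ⟨{T, q}, ContinuousLinearMap.proj ⟨T, by simp⟩ -
            ContinuousLinearMap.proj ⟨q, by simp⟩, fun x ↦ rfl⟩
      · rintro ⟨r, hrS, hrq⟩ _
        rw [covariance_fun_sub_right (hP.memLp_two _) (hP.memLp_two _) (hP.memLp_two _),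
          hP.covariance_eval, hP.covariance_eval]
        have h1 : (0 : ℝ) ≤ r := by exact_mod_cast (hS r hrS).1
        have h2 : (r : ℝ) ≤ q := by exact_mod_cast hrq
        have h3 : (q : ℝ) ≤ T := by exact_mod_cast (hS q hq).2
        push_cast
        rw [abs_of_nonneg h1, abs_of_nonneg (by linarith : (0 : ℝ) ≤ T),
          abs_of_nonneg (by linarith : (0 : ℝ) ≤ q), abs_of_nonpos (by linarith),
          abs_of_nonpos (by linarith)]
        ring
    obtain ⟨F, hFm, hFx⟩ : ∃ F : ({r // r ∈ S ∧ r ≤ q} → ℝ) → ℝ≥0∞, Measurable F ∧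
        ∀ x : ℚ → ℝ, F (fun r ↦ x r) =
          (A q).indicator (fun x ↦ ENNReal.ofReal (Real.exp (κ * x q))) x := by
      refine ⟨({y | u ≤ y ⟨q, hq, le_rfl⟩} ∩
        ⋂ r : {r // r ∈ S ∧ r ≤ q}, ⋂ (_ : r.1 < q), {y | y r < u}).indicator
          fun y ↦ ENNReal.ofReal (Real.exp (κ * y ⟨q, hq, le_rfl⟩)), ?_, fun x ↦ ?_⟩
      · refine Measurable.indicator (by fun_prop) ?_
        refine (measurableSet_le measurable_const (measurable_pi_apply _)).inter ?_
        exact MeasurableSet.iInter fun r ↦ MeasurableSet.iInter fun _ ↦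
          measurableSet_lt (measurable_pi_apply r) measurable_const
      · by_cases hx : x ∈ A q
        · rw [Set.indicator_of_mem hx, Set.indicator_of_mem]
          refine ⟨hx.1, ?_⟩
          simp only [Set.mem_iInter]
          exact fun r hr ↦ hx.2 r r.2.1 hr
        · rw [Set.indicator_of_notMem hx, Set.indicator_of_notMem]
          rintro ⟨h1, h2⟩
          simp only [Set.mem_iInter] at h2
          exact hx ⟨h1, fun r hr hrq ↦ h2 ⟨r, hr, hrq.le⟩ hrq⟩
    have hi2 := hindep.comp hFm (ψ := fun y : Unit → ℝ ↦ ENNReal.ofReal (Real.exp (κ * y ())))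
      (by fun_prop)
    have hprod := lintegral_mul_eq_lintegral_mul_lintegral_of_indepFun'' (μ := P)
      (f := fun x : ℚ → ℝ ↦ F fun r ↦ x r)
      (g := fun x : ℚ → ℝ ↦ ENNReal.ofReal (Real.exp (κ * (x T - x q))))
      (hFm.comp (by fun_prop)).aemeasurable (by fun_prop)
      hi2
    have hge : 1 ≤ ∫⁻ x, ENNReal.ofReal (Real.exp (κ * (x T - x q))) ∂P := by
      have e := hP.lintegral_comp_shift q
        (F := fun x : ℚ → ℝ ↦ ENNReal.ofReal (Real.exp (κ * x (T - q)))) (by fun_prop)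
      simp only [sub_add_cancel] at e
      rw [e, hP.lintegral_exp, ← ENNReal.ofReal_one]
      exact ENNReal.ofReal_le_ofReal (Real.one_le_exp (by positivity))
    calc ENNReal.ofReal (Real.exp (κ * u)) * P (A q)
        = ∫⁻ _ in A q, ENNReal.ofReal (Real.exp (κ * u)) ∂P := by
          rw [setLIntegral_const]
      _ ≤ ∫⁻ x in A q, ENNReal.ofReal (Real.exp (κ * x q)) ∂P := by
          refine setLIntegral_mono' (hAm q) fun x hx ↦ ?_
          exact ENNReal.ofReal_le_ofReal (Real.exp_le_exp.2 (mul_le_mul_of_nonneg_left hx.1 hκ))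
      _ = ∫⁻ x, F (fun r ↦ x r) ∂P := by
          rw [← lintegral_indicator (hAm q)]
          simp only [hFx]
      _ ≤ (∫⁻ x, F (fun r ↦ x r) ∂P) * ∫⁻ x, ENNReal.ofReal (Real.exp (κ * (x T - x q))) ∂P :=
          le_mul_of_one_le_right' hge
      _ = ∫⁻ x, F (fun r ↦ x r) * ENNReal.ofReal (Real.exp (κ * (x T - x q))) ∂P := hprod.symm
      _ = ∫⁻ x in A q, ENNReal.ofReal (Real.exp (κ * x T)) ∂P := by
          rw [← lintegral_indicator (hAm q)]
          refine lintegral_congr fun x ↦ ?_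
          rw [hFx]
          by_cases hx : x ∈ A q
          · rw [Set.indicator_of_mem hx, Set.indicator_of_mem hx,
              ← ENNReal.ofReal_mul (Real.exp_nonneg _), ← Real.exp_add]
            congr 2
            ring
          · rw [Set.indicator_of_notMem hx, Set.indicator_of_notMem hx, zero_mul]
  have hsum : ENNReal.ofReal (Real.exp (κ * u)) * P {x | ∃ q ∈ S, u ≤ x q} ≤
      ENNReal.ofReal (Real.exp (κ ^ 2 * |(T : ℝ)| / 2)) := by
    calc ENNReal.ofReal (Real.exp (κ * u)) * P {x | ∃ q ∈ S, u ≤ x q}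
        ≤ ENNReal.ofReal (Real.exp (κ * u)) * ∑ q ∈ S, P (A q) :=
          mul_le_mul_right ((measure_mono hunion).trans (measure_biUnion_finset_le _ _)) _
      _ ≤ ∑ q ∈ S, ∫⁻ x in A q, ENNReal.ofReal (Real.exp (κ * x T)) ∂P := by
          rw [Finset.mul_sum]
          exact Finset.sum_le_sum hstep
      _ = ∫⁻ x in ⋃ q ∈ S, A q, ENNReal.ofReal (Real.exp (κ * x T)) ∂P :=
          (lintegral_biUnion_finset hdisj (fun q _ ↦ hAm q) _).symm
      _ ≤ ∫⁻ x, ENNReal.ofReal (Real.exp (κ * x T)) ∂P := setLIntegral_le_lintegral _ _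
      _ = _ := hP.lintegral_exp T κ
  have h6 := mul_le_mul_right hsum (ENNReal.ofReal (Real.exp (-(κ * u))))
  rwa [← mul_assoc, ← ENNReal.ofReal_mul (Real.exp_nonneg _), ← Real.exp_add, neg_add_cancel,
    Real.exp_zero, ENNReal.ofReal_one, one_mul, ← ENNReal.ofReal_mul (Real.exp_nonneg _),
    ← Real.exp_add] at h6

/-- The maximal inequality for a Brownian motion with rational times. -/
lemma IsShiftGaussian.measure_exists_Icc_le {P : Measure (ℚ → ℝ)}
    (hP : IsShiftGaussian (fun q : ℚ ↦ |(q : ℝ)|) P) (T : ℚ) (u : ℝ) {κ : ℝ} (hκ : 0 ≤ κ) :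
    P {x | ∃ q, 0 ≤ q ∧ q ≤ T ∧ u ≤ x q} ≤
      ENNReal.ofReal (Real.exp (-(κ * u) + κ ^ 2 * |(T : ℝ)| / 2)) := by
  classical
  have e : {x : ℚ → ℝ | ∃ q, 0 ≤ q ∧ q ≤ T ∧ u ≤ x q} =
      ⋃ S : Finset (Set.Icc 0 T), {x : ℚ → ℝ | ∃ q ∈ S.map (.subtype _), u ≤ x q} := by
    ext x
    simp only [Set.mem_ofPred_eq, Set.mem_iUnion]
    constructor
    · rintro ⟨q, h0, hT, hq⟩
      exact ⟨{⟨q, h0, hT⟩}, q, by simp, hq⟩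
    · rintro ⟨S, q, hqS, hq⟩
      simp only [Finset.mem_map, Function.Embedding.subtype_apply] at hqS
      obtain ⟨a, _, rfl⟩ := hqS
      exact ⟨a, a.2.1, a.2.2, hq⟩
  rw [e, Directed.measure_iUnion]
  · refine iSup_le fun S ↦ hP.measure_exists_finset_le _ (fun q hq ↦ ?_) u hκ
    simp only [Finset.mem_map, Function.Embedding.subtype_apply] at hq
    obtain ⟨a, _, rfl⟩ := hq
    exact a.2
  · refine Monotone.directed_le fun S S' hSS' x ⟨q, hq, hx⟩ ↦ ⟨q, ?_, hx⟩
    exact Finset.map_subset_map.2 hSS' hq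

/-- Time reversal. -/
lemma IsShiftGaussian.map_neg {P : Measure (ℚ → ℝ)}
    (hP : IsShiftGaussian (fun q : ℚ ↦ |(q : ℝ)|) P) :
    P.map (fun (x : ℚ → ℝ) q ↦ x (-q)) = P := by
  refine unique (of_process (v := fun q : ℚ ↦ |(q : ℝ)|) (X := fun q (x : ℚ → ℝ) ↦ x (-q))
    (hP.isGaussianProcess.comp_right fun q : ℚ ↦ -q) (fun q ↦ hP.integral_eq_zero _) ?_ ?_) hP
  · simpa using hP.zero
  · intro q r
    rw [hP.variance_sub]
    push_cast
    rw [neg_sub_neg, abs_sub_comm]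

/-- Tails of a two-sided Brownian motion with parabolic drift. -/
lemma IsShiftGaussian.exists_measure_parabola_le {P : Measure (ℚ → ℝ)}
    (hP : IsShiftGaussian (fun q : ℚ ↦ |(q : ℝ)|) P) {c : ℝ} (hc : 0 < c) {κ : ℝ} (hκ : 0 < κ) :
    ∃ C : ℝ≥0∞, C ≠ ∞ ∧ ∀ m : ℝ, P {x | ∃ q : ℚ, m ≤ x q - c * (q : ℝ) ^ 2} ≤
      C * ENNReal.ofReal (Real.exp (-(κ * m))) := by
  have hsumm : Summable fun j : ℕ ↦ Real.exp (-(κ * c * j ^ 2) + κ ^ 2 * (j + 1) / 2) := by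
    set a := κ * c with ha
    have ha0 : 0 < a := by positivity
    set b := κ ^ 2 / 2 + 1 with hb
    refine Summable.of_nonneg_of_le (fun _ ↦ (Real.exp_pos _).le) (fun j ↦ ?_)
      (Real.summable_exp_neg_nat.mul_left (Real.exp (b ^ 2 / (4 * a) + κ ^ 2 / 2)))
    rw [← Real.exp_add]
    refine Real.exp_le_exp.2 ?_
    have h1 : b * j - a * j ^ 2 ≤ b ^ 2 / (4 * a) := by
      rw [le_div_iff₀ (by positivity)]
      nlinarith [sq_nonneg (2 * a * j - b)]
    rw [hb] at h1 ⊢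
    linarith
  refine ⟨2 * ∑' j : ℕ, ENNReal.ofReal (Real.exp (-(κ * c * j ^ 2) + κ ^ 2 * (j + 1) / 2)),
    ENNReal.mul_ne_top (by simp) hsumm.tsum_ofReal_ne_top, fun m ↦ ?_⟩
  -- For times in `[j, j + 1]` the drift is at least `c * j ^ 2`.
  set B : ℕ → Set (ℚ → ℝ) := fun j ↦
    {x | ∃ q, 0 ≤ q ∧ q ≤ ((j + 1 : ℕ) : ℚ) ∧ m + c * (j : ℝ) ^ 2 ≤ x q} with hB
  have hBm : ∀ j, MeasurableSet (B j) := by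
    intro j
    rw [hB]
    simp only [Set.ofPred_exists]
    refine MeasurableSet.iUnion fun q ↦ ?_
    exact (MeasurableSet.const _).inter ((MeasurableSet.const _).inter
      (measurableSet_le measurable_const (measurable_pi_apply q)))
  have hBle : ∀ j, P (B j) ≤ ENNReal.ofReal (Real.exp (-(κ * c * j ^ 2) + κ ^ 2 * (j + 1) / 2)) *
      ENNReal.ofReal (Real.exp (-(κ * m))) := by
    intro j
    refine (hP.measure_exists_Icc_le ((j + 1 : ℕ) : ℚ) (m + c * (j : ℝ) ^ 2) hκ.le).trans ?_
    rw [← ENNReal.ofReal_mul (Real.exp_nonneg _), ← Real.exp_add]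
    refine ENNReal.ofReal_le_ofReal (Real.exp_le_exp.2 (le_of_eq ?_))
    push_cast
    rw [abs_of_nonneg (by positivity)]
    ring
  have hneg : Measurable fun (x : ℚ → ℝ) q ↦ x (-q) :=
    measurable_pi_lambda _ fun _ ↦ measurable_pi_apply _
  have hsub : {x : ℚ → ℝ | ∃ q : ℚ, m ≤ x q - c * (q : ℝ) ^ 2} ⊆
      (⋃ j, B j) ∪ ⋃ j, (fun (x : ℚ → ℝ) q ↦ x (-q)) ⁻¹' B j := by
    rintro x ⟨q, hq⟩
    have key : ∀ r : ℚ, 0 ≤ r → (r : ℝ) ^ 2 = (q : ℝ) ^ 2 →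
        r ≤ ((⌊r⌋₊ + 1 : ℕ) : ℚ) ∧ m + c * (⌊r⌋₊ : ℝ) ^ 2 ≤ x q := by
      intro r hr hrq
      refine ⟨by exact_mod_cast (Nat.lt_floor_add_one r).le, ?_⟩
      have h1 : ((⌊r⌋₊ : ℕ) : ℝ) ≤ r := by exact_mod_cast Nat.floor_le hr
      have h2 : ((⌊r⌋₊ : ℕ) : ℝ) ^ 2 ≤ (r : ℝ) ^ 2 := pow_le_pow_left₀ (by positivity) h1 2
      rw [hrq] at h2
      nlinarith
    rcases le_total 0 q with h | h
    · exact Or.inl (Set.mem_iUnion.2 ⟨⌊q⌋₊, q, h, (key q h rfl).1, (key q h rfl).2⟩)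
    · have h' : 0 ≤ -q := by linarith
      refine Or.inr (Set.mem_iUnion.2 ⟨⌊-q⌋₊, -q, h', ?_⟩)
      have := key (-q) h' (by push_cast; ring)
      exact ⟨this.1, by simpa using this.2⟩
  refine (measure_mono hsub).trans ((measure_union_le _ _).trans ?_)
  have hle : ∀ B' : ℕ → Set (ℚ → ℝ), (∀ j, P (B' j) = P (B j)) → P (⋃ j, B' j) ≤
      (∑' j : ℕ, ENNReal.ofReal (Real.exp (-(κ * c * j ^ 2) + κ ^ 2 * (j + 1) / 2))) *
        ENNReal.ofReal (Real.exp (-(κ * m))) := by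
    intro B' hB'
    refine (measure_iUnion_le _).trans ?_
    rw [← ENNReal.tsum_mul_right]
    exact ENNReal.tsum_le_tsum fun j ↦ (hB' j).le.trans (hBle j)
  rw [two_mul, add_mul]
  refine add_le_add (hle _ fun _ ↦ rfl) (hle _ fun j ↦ ?_)
  conv_rhs => rw [← hP.map_neg, Measure.map_apply hneg (hBm j)]

/-- A two-sided Brownian motion with parabolic drift is bounded above, with exponential moments. -/
lemma IsShiftGaussian.hasExpMoments_parabola {P : Measure (ℚ → ℝ)}
    (hP : IsShiftGaussian (fun q : ℚ ↦ |(q : ℝ)|) P) {c : ℝ} (hc : 0 < c) :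
    HasExpMoments P fun q : ℚ ↦ c * (q : ℝ) ^ 2 := by
  have := hP.isProbabilityMeasure
  set A : ℕ → Set (ℚ → ℝ) := fun m ↦ {x | ∃ q : ℚ, (m : ℝ) ≤ x q - c * (q : ℝ) ^ 2} with hA
  have hAm : ∀ m, MeasurableSet (A m) := by
    intro m
    rw [hA]
    simp only [Set.ofPred_exists]
    exact MeasurableSet.iUnion fun q ↦ measurableSet_le measurable_const
      ((measurable_pi_apply q).sub measurable_const)
  have hb : ∀ᵐ x ∂P, BddAbove (Set.range fun q : ℚ ↦ x q - c * (q : ℝ) ^ 2) := by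
    obtain ⟨C, hC, h⟩ := hP.exists_measure_parabola_le hc one_pos
    have h0 : P (⋂ m, A m) = 0 := by
      refine le_antisymm (ge_of_tendsto' (x := Filter.atTop) (b := P (⋂ m, A m))
        (f := fun m : ℕ ↦ C * ENNReal.ofReal (Real.exp (-(1 * (m : ℝ))))) ?_
        fun m ↦ (measure_mono (Set.iInter_subset _ m)).trans (h m)) bot_le
      rw [show (0 : ℝ≥0∞) = C * 0 by simp]
      refine ENNReal.Tendsto.const_mul ?_ (Or.inr hC)
      rw [← ENNReal.ofReal_zero]
      refine (ENNReal.continuous_ofReal.tendsto 0).comp ?_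
      simp only [one_mul]
      exact Real.tendsto_exp_neg_atTop_nhds_zero.comp tendsto_natCast_atTop_atTop
    have h1 : ∀ᵐ x ∂P, x ∉ ⋂ m, A m := measure_eq_zero_iff_ae_notMem.1 h0
    filter_upwards [h1] with x hx
    simp only [Set.mem_iInter, not_forall, hA, Set.mem_ofPred_eq, not_exists, not_le] at hx
    obtain ⟨m, hm⟩ := hx
    exact ⟨m, by rintro _ ⟨q, rfl⟩; exact (hm q).le⟩
  refine ⟨hb, fun κ hκ ↦ ?_⟩
  obtain ⟨C, hC, h⟩ := hP.exists_measure_parabola_le hc (κ := κ + 1) (by linarith)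
  have hle : expMoment P (fun q : ℚ ↦ c * (q : ℝ) ^ 2) κ ≤
      ∫⁻ x, ∑' m : ℕ, (A m).indicator (fun _ ↦ ENNReal.ofReal (Real.exp (κ * (m + 2)))) x ∂P := by
    refine lintegral_mono_ae ?_
    filter_upwards [hb, hP.zero] with x hx hx0
    set N := maxVal (fun q : ℚ ↦ c * (q : ℝ) ^ 2) x with hN
    have hN0 : 0 ≤ N := by
      have := le_ciSup hx 0
      simp only [hx0, Rat.cast_zero, ne_eq, OfNat.ofNat_ne_zero, not_false_eq_true, zero_pow,
        mul_zero, sub_zero] at this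
      exact this
    have hmem : x ∈ A (⌊N⌋₊ - 1) := by
      rcases Nat.eq_zero_or_pos ⌊N⌋₊ with h0 | h0
      · rw [h0]
        exact ⟨0, by simp [hx0]⟩
      · have h1 : ((⌊N⌋₊ - 1 : ℕ) : ℝ) < N := by
          rw [Nat.cast_sub h0]
          have := Nat.floor_le hN0
          push_cast
          linarith
        obtain ⟨q, hq⟩ := exists_lt_of_lt_ciSup h1
        exact ⟨q, hq.le⟩
    refine le_trans ?_ (ENNReal.le_tsum (⌊N⌋₊ - 1))
    rw [Set.indicator_of_mem hmem]
    refine ENNReal.ofReal_le_ofReal (Real.exp_le_exp.2 (mul_le_mul_of_nonneg_left ?_ hκ))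
    have h1 := (Nat.lt_floor_add_one N).le
    have h2 : (⌊N⌋₊ : ℝ) ≤ ((⌊N⌋₊ - 1 : ℕ) : ℝ) + 1 := by
      exact_mod_cast (by omega : ⌊N⌋₊ ≤ ⌊N⌋₊ - 1 + 1)
    linarith
  refine ne_top_of_le_ne_top ?_ hle
  rw [lintegral_tsum fun m ↦ (measurable_const.indicator (hAm m)).aemeasurable]
  have hsumm : Summable fun m : ℕ ↦ Real.exp (2 * κ) * Real.exp (-(m : ℝ)) :=
    Real.summable_exp_neg_nat.mul_left _
  refine ne_top_of_le_ne_top (ENNReal.mul_ne_top hC hsumm.tsum_ofReal_ne_top) ?_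
  rw [← ENNReal.tsum_mul_left]
  refine ENNReal.tsum_le_tsum fun m ↦ ?_
  rw [lintegral_indicator (hAm m), setLIntegral_const]
  refine (mul_le_mul_right (h m) _).trans ?_
  rw [mul_left_comm, ← ENNReal.ofReal_mul (Real.exp_nonneg _), ← Real.exp_add, ← Real.exp_add]
  refine mul_le_mul_right (ENNReal.ofReal_le_ofReal (Real.exp_le_exp.2 (le_of_eq ?_))) _
  ring

/-- A process with stationary increments is additive along orthogonal increments. -/
lemma IsShiftGaussian.ae_eval_add {H : Type*} [AddCommGroup H] {v : H → ℝ} {P : Measure (H → ℝ)}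
    (hP : IsShiftGaussian v P) {h g : H} (h1 : v (h + g) = v h + v g)
    (h2 : v (h - g) = v h + v g) : ∀ᵐ x ∂P, x (h + g) = x h + x g := by
  have := hP.isProbabilityMeasure
  have hm := (hP.memLp_two (h + g)).sub (hP.memLp_two h)
  have hm2 := hm.sub (hP.memLp_two g)
  have hvar : Var[(fun x : H → ℝ ↦ x (h + g)) - (fun x ↦ x h) - fun x ↦ x g; P] = 0 := by
    rw [ProbabilityTheory.variance_sub hm (hP.memLp_two g),
      covariance_sub_left (hP.memLp_two _) (hP.memLp_two _) (hP.memLp_two _), hP.covariance_eval,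
      hP.covariance_eval, hP.variance_eval]
    have := hP.variance_sub (h + g) h
    rw [show ((fun x : H → ℝ ↦ x (h + g)) - fun x ↦ x h) = fun x ↦ x (h + g) - x h from rfl, this]
    rw [add_sub_cancel_left, add_sub_cancel_right, h1, h2]
    ring
  have hint : ∫ x : H → ℝ, ((fun x : H → ℝ ↦ x (h + g)) - (fun x : H → ℝ ↦ x h) -
      fun x : H → ℝ ↦ x g) x ∂P = 0 := by
    have hi := fun h ↦ (hP.memLp_two h).integrable one_le_two
    simp only [Pi.sub_apply]
    rw [integral_sub (f := fun x : H → ℝ ↦ x (h + g) - x h) ((hi _).sub (hi _)) (hi _),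
      integral_sub (hi _) (hi _), hP.integral_eq_zero, hP.integral_eq_zero, hP.integral_eq_zero]
    simp
  filter_upwards [ae_eq_integral_of_variance_eq_zero hm2 hvar] with x hx
  rw [hint] at hx
  simp only [Pi.sub_apply] at hx
  linarith

variable {Λ : ℕ}

lemma pathVar_eq (k : RatPath Λ) : pathVar Λ k = ∑ y, |(k y : ℝ)| := by
  rw [pathVar, ← Finset.sum_coe_sort]
  simp only [RatPath.toFun_coe]

/-- The field term along a path is the sum of its contributions from the sites. -/
lemma IsShiftGaussian.ae_eval_eq_sum {P : Measure (RatPath Λ → ℝ)}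
    (hP : IsShiftGaussian (pathVar Λ) P) :
    ∀ᵐ x ∂P, ∀ k : RatPath Λ, x k = ∑ y, x (Pi.single y (k y)) := by
  rw [ae_all_iff]
  intro k
  have key : ∀ s : Finset (Finset.Ioo 0 Λ), ∀ᵐ x ∂P,
      x (∑ y ∈ s, Pi.single y (k y)) = ∑ y ∈ s, x (Pi.single y (k y)) := by
    intro s
    induction s using Finset.induction_on with
    | empty =>
      filter_upwards [hP.zero] with x hx
      simpa using hx
    | insert a s ha ih =>
      have e : ∀ (c : ℝ) (y : Finset.Ioo 0 Λ), c * c = 1 →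
          |(((∑ y ∈ s, Pi.single y (k y) : RatPath Λ) y : ℚ) : ℝ) +
            c * ((Pi.single a (k a) : RatPath Λ) y : ℚ)| =
          |(((∑ y ∈ s, Pi.single y (k y) : RatPath Λ) y : ℚ) : ℝ)| +
            |(((Pi.single a (k a) : RatPath Λ) y : ℚ) : ℝ)| := by
        intro c y hc
        by_cases hy : y = a
        · subst hy
          have : (∑ z ∈ s, Pi.single z (k z) : RatPath Λ) y = 0 := by
            rw [Finset.sum_apply]
            refine Finset.sum_eq_zero fun z hz ↦ Pi.single_eq_of_ne ?_ _
            rintro rfl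
            exact ha hz
          rw [this]
          simp only [Rat.cast_zero, zero_add, abs_zero, abs_mul]
          rw [show |c| = 1 by
            rcases mul_self_eq_one_iff.1 hc with rfl | rfl <;> simp, one_mul]
        · rw [Pi.single_eq_of_ne hy]
          simp
      have hadd := hP.ae_eval_add (h := ∑ y ∈ s, Pi.single y (k y)) (g := Pi.single a (k a))
        (by
          simp only [pathVar_eq, ← Finset.sum_add_distrib]
          refine Finset.sum_congr rfl fun y _ ↦ ?_
          rw [← e 1 y (by norm_num), Pi.add_apply]
          push_cast
          rw [one_mul])
        (by
          simp only [pathVar_eq, ← Finset.sum_add_distrib]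
          refine Finset.sum_congr rfl fun y _ ↦ ?_
          rw [← e (-1) y (by norm_num), Pi.sub_apply]
          push_cast
          rw [neg_one_mul, sub_eq_add_neg])
      filter_upwards [hadd, ih] with x h1 h2
      rw [Finset.sum_insert ha, Finset.sum_insert ha, add_comm, h1, h2, add_comm]
  filter_upwards [key Finset.univ] with x hx
  rw [← hx, Finset.univ_sum_single]

/-- The contribution from a single site is a two-sided Brownian motion. -/
lemma IsShiftGaussian.map_single {P : Measure (RatPath Λ → ℝ)}
    (hP : IsShiftGaussian (pathVar Λ) P) (y : Finset.Ioo 0 Λ) :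
    IsShiftGaussian (fun q : ℚ ↦ |(q : ℝ)|)
      (P.map fun (x : RatPath Λ → ℝ) (q : ℚ) ↦ x (Pi.single y q)) := by
  refine of_process (X := fun (q : ℚ) (x : RatPath Λ → ℝ) ↦ x (Pi.single y q))
    (hP.isGaussianProcess.comp_right fun q : ℚ ↦ (Pi.single y q : RatPath Λ))
    (fun q ↦ hP.integral_eq_zero _) ?_ fun q r ↦ ?_
  · simpa using hP.zero
  · rw [hP.variance_sub, ← Pi.single_sub, pathVar_eq, Finset.sum_eq_single y]
    · simp
    · intro z _ hz
      rw [Pi.single_eq_of_ne hz]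
      simp
    · simp

/-- A discrete Sobolev inequality. -/
lemma sq_le_dirichletEnergy {h : ℕ → ℝ} (hh : IsConfiguration Λ h) {x : ℕ}
    (hx : x ∈ Finset.Ioo 0 Λ) : h x ^ 2 ≤ 2 * Λ * dirichletEnergy Λ h := by
  have h1 := dirichletForm_green hx hh
  have h2 := dirichletForm_green hx (green Λ x).isConfiguration
  have h3 : dirichletForm Λ (green Λ x).toFun h ^ 2 ≤
      dirichletForm Λ (green Λ x).toFun (green Λ x).toFun * dirichletForm Λ h h := by
    simp only [dirichletForm, ← sq]
    exact Finset.sum_mul_sq_le_sq_mul_sq _ _ _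
  rw [h1, h2] at h3
  have h4 := dirichletEnergy_nonneg Λ h
  rw [dirichletEnergy_eq] at h4 ⊢
  have h5 : 0 ≤ dirichletForm Λ h h := by linarith
  have h6 := mul_le_mul_of_nonneg_right (toFun_green_mem hx x).2 h5
  linarith

/-- A discrete Poincaré inequality. -/
lemma sum_sq_le_dirichletEnergy {h : ℕ → ℝ} (hh : IsConfiguration Λ h) :
    ∑ x ∈ Finset.Ioo 0 Λ, h x ^ 2 ≤ 2 * Λ ^ 2 * dirichletEnergy Λ h := by
  refine (Finset.sum_le_card_nsmul _ _ _ fun x hx ↦ sq_le_dirichletEnergy hh hx).trans ?_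
  rw [nsmul_eq_mul, Nat.card_Ioo]
  have : ((Λ - 0 - 1 : ℕ) : ℝ) ≤ Λ := by exact_mod_cast (by omega : Λ - 0 - 1 ≤ Λ)
  have h4 := dirichletEnergy_nonneg Λ h
  have h5 : 0 ≤ 2 * Λ * dirichletEnergy Λ h := by positivity
  nlinarith [mul_le_mul_of_nonneg_right this h5]

/-- The maximum over all paths is bounded above, with exponential moments: it is dominated by a sum
over the sites of maxima of two-sided Brownian motions with parabolic drift. -/
theorem IsShiftGaussian.hasExpMoments_pathEnergy {P : Measure (RatPath Λ → ℝ)}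
    (hP : IsShiftGaussian (pathVar Λ) P) : HasExpMoments P (pathEnergy Λ) := by
  have := hP.isProbabilityMeasure
  -- Poincaré's inequality leaves a quadratic confinement at each site.
  set c : ℝ := 1 / (2 * ((Λ : ℝ) + 1) ^ 2) with hc
  have hc0 : 0 < c := by positivity
  have hE : ∀ k : RatPath Λ, ∑ y, c * (k y : ℝ) ^ 2 ≤ pathEnergy Λ k := by
    intro k
    have h1 := sum_sq_le_dirichletEnergy k.isConfiguration
    rw [← Finset.sum_coe_sort] at h1
    simp only [RatPath.toFun_coe] at h1
    rw [← Finset.mul_sum, hc, one_div, inv_mul_le_iff₀ (by positivity)]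
    refine h1.trans (mul_le_mul_of_nonneg_right ?_ (dirichletEnergy_nonneg _ _))
    have : (0 : ℝ) ≤ Λ := by positivity
    nlinarith
  -- the process at one site
  set T : Finset.Ioo 0 Λ → (RatPath Λ → ℝ) → (ℚ → ℝ) := fun y x q ↦ x (Pi.single y q) with hT
  have hTm : ∀ y, Measurable (T y) := fun y ↦ measurable_pi_lambda _ fun q ↦ measurable_pi_apply _
  have hU : ∀ y, HasExpMoments (P.map (T y)) fun q : ℚ ↦ c * (q : ℝ) ^ 2 := fun y ↦
    (hP.map_single y).hasExpMoments_parabola hc0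
  have hUb : ∀ᵐ x ∂P, ∀ y, BddAbove (Set.range fun q : ℚ ↦ T y x q - c * (q : ℝ) ^ 2) := by
    rw [ae_all_iff]
    exact fun y ↦ ae_of_ae_map (hTm y).aemeasurable (hU y).bddAbove
  have hle : ∀ᵐ x ∂P, ∀ k, x k - pathEnergy Λ k ≤
      ∑ y, maxVal (fun q : ℚ ↦ c * (q : ℝ) ^ 2) (T y x) := by
    filter_upwards [hP.ae_eval_eq_sum, hUb] with x hx hxb k
    rw [hx k]
    calc ∑ y, x (Pi.single y (k y)) - pathEnergy Λ k
        ≤ ∑ y, (x (Pi.single y (k y)) - c * (k y : ℝ) ^ 2) := by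
          rw [Finset.sum_sub_distrib]
          linarith [hE k]
      _ ≤ _ := Finset.sum_le_sum fun y _ ↦ le_ciSup (hxb y) (k y)
  refine ⟨?_, fun κ hκ ↦ ?_⟩
  · filter_upwards [hle] with x hx
    exact ⟨_, by rintro _ ⟨k, rfl⟩; exact hx k⟩
  · rcases (Finset.univ : Finset (Finset.Ioo 0 Λ)).eq_empty_or_nonempty with he | hne
    · refine ne_top_of_le_ne_top ENNReal.one_ne_top
        ((lintegral_mono_ae (g := fun _ ↦ 1) ?_).trans (by simp))
      filter_upwards [hle] with x hx
      rw [ENNReal.ofReal_le_one, Real.exp_le_one_iff]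
      refine mul_nonpos_of_nonneg_of_nonpos hκ (ciSup_le fun k ↦ ?_)
      have := hx k
      rwa [he, Finset.sum_empty] at this
    · set n : ℝ := ((Finset.univ : Finset (Finset.Ioo 0 Λ)).card : ℝ) with hn
      refine ne_top_of_le_ne_top (b := ∑ y, ENNReal.ofReal n⁻¹ *
        expMoment (P.map (T y)) (fun q : ℚ ↦ c * (q : ℝ) ^ 2) (n * κ)) ?_ ?_
      · exact (ENNReal.sum_lt_top.2 fun y _ ↦ (ENNReal.mul_ne_top ENNReal.ofReal_ne_top
          ((hU y).ne_top _ (by positivity))).lt_top).ne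
      · have e : ∀ y, expMoment (P.map (T y)) (fun q : ℚ ↦ c * (q : ℝ) ^ 2) (n * κ) =
            ∫⁻ x, ENNReal.ofReal (Real.exp
              (n * κ * maxVal (fun q : ℚ ↦ c * (q : ℝ) ^ 2) (T y x))) ∂P := fun y ↦
          lintegral_map (by fun_prop) (hTm y)
        have hmm : ∀ y, Measurable fun x ↦ maxVal (fun q : ℚ ↦ c * (q : ℝ) ^ 2) (T y x) :=
          fun y ↦ (measurable_maxVal _).comp (hTm y)
        simp only [e, ← lintegral_const_mul' _ _ ENNReal.ofReal_ne_top]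
        rw [← lintegral_finsetSum _ fun y _ ↦ by
          have := hmm y
          fun_prop]
        refine lintegral_mono_ae ?_
        filter_upwards [hle] with x hx
        simp only [← ENNReal.ofReal_mul (inv_nonneg.2 (Nat.cast_nonneg _) : 0 ≤ n⁻¹)]
        rw [← ENNReal.ofReal_sum_of_nonneg fun _ _ ↦ by positivity]
        refine ENNReal.ofReal_le_ofReal ?_
        have hJ := exp_sum_le _ hne fun y ↦
          κ * maxVal (fun q : ℚ ↦ c * (q : ℝ) ^ 2) (T y x)
        refine le_trans (Real.exp_le_exp.2 ?_) (hJ.trans (le_of_eq ?_))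
        · rw [← Finset.mul_sum]
          exact mul_le_mul_of_nonneg_left (ciSup_le hx) hκ
        · rw [Finset.mul_sum]
          refine Finset.sum_congr rfl fun y _ ↦ ?_
          rw [mul_assoc]

/-! ### The Brownian field and its restriction to blocks -/

lemma eval_toNNReal_of_nonneg {Ω : Type*} (B : ℝ → Ω → ℝ) {t : ℝ} (ht : 0 ≤ t) :
    B t = (fun (t : ℝ≥0) ω ↦ B (t : ℝ) ω) t.toNNReal := by
  funext ω
  simp only [Real.coe_toNNReal t ht]

lemma eval_toNNReal_of_nonpos {Ω : Type*} (B : ℝ → Ω → ℝ) {t : ℝ} (ht : t ≤ 0) :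
    B t = (fun (t : ℝ≥0) ω ↦ B (-(t : ℝ)) ω) (-t).toNNReal := by
  funext ω
  simp only [Real.coe_toNNReal (-t) (by linarith), neg_neg]

section Field

variable {Ω : Type*} [MeasurableSpace Ω] {μ : Measure Ω}

namespace IsTwoSidedBrownian

variable {B : ℝ → Ω → ℝ}

lemma isGaussianProcess (hB : IsTwoSidedBrownian B μ) : IsGaussianProcess B μ := by
  have hR := hB.right.isGaussianProcess
  have hL := hB.left.isGaussianProcess
  have hZ : IsGaussianProcess (fun (t : ℝ≥0) ω ↦ (B (t : ℝ) ω, B (-(t : ℝ)) ω)) μ := by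
    refine ⟨fun I ↦ ?_⟩
    have hi := hB.indep.comp (φ := I.restrict (π := fun _ ↦ ℝ)) (ψ := I.restrict (π := fun _ ↦ ℝ))
      (measurable_pi_lambda _ fun _ ↦ measurable_pi_apply _)
      (measurable_pi_lambda _ fun _ ↦ measurable_pi_apply _)
    have hG := hi.hasGaussianLaw (hR.hasGaussianLaw I) (hL.hasGaussianLaw I)
    let M : (I → ℝ) × (I → ℝ) →L[ℝ] I → ℝ × ℝ :=
      { toFun x i := (x.1 i, x.2 i)
        map_add' x y := rfl
        map_smul' c x := rfl
        cont := by fun_prop }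
    exact hG.map M
  refine hZ.of_isGaussianProcess fun t ↦ ?_
  rcases le_total 0 t with ht | ht
  · refine ⟨{t.toNNReal}, (ContinuousLinearMap.fst ℝ ℝ ℝ).comp
      (ContinuousLinearMap.proj ⟨t.toNNReal, by simp⟩), fun ω ↦ ?_⟩
    simp [Real.coe_toNNReal t ht]
  · refine ⟨{(-t).toNNReal}, (ContinuousLinearMap.snd ℝ ℝ ℝ).comp
      (ContinuousLinearMap.proj ⟨(-t).toNNReal, by simp⟩), fun ω ↦ ?_⟩
    simp [Real.coe_toNNReal (-t) (by linarith)]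

lemma integral_eq_zero (hB : IsTwoSidedBrownian B μ) (t : ℝ) : ∫ ω, B t ω ∂μ = 0 := by
  rcases le_total 0 t with ht | ht
  · rw [eval_toNNReal_of_nonneg B ht]
    exact hB.right.integral_eval _
  · rw [eval_toNNReal_of_nonpos B ht]
    exact hB.left.integral_eval _

lemma covariance_eval (hB : IsTwoSidedBrownian B μ) (s t : ℝ) :
    cov[B s, B t; μ] = (|s| + |t| - |s - t|) / 2 := by
  have hm := fun t ↦ memLp_two_of_isGaussianProcess hB.isGaussianProcess t
  have hind : ∀ s t : ℝ≥0, cov[B (s : ℝ), B (-(t : ℝ)); μ] = 0 := fun s t ↦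
    IndepFun.covariance_eq_zero (X := B s) (Y := B (-t)) (hB.indep.comp
      (φ := fun x : ℝ≥0 → ℝ ↦ x s) (ψ := fun x : ℝ≥0 → ℝ ↦ x t) (by fun_prop) (by fun_prop))
      (hm s) (hm (-t))
  rcases le_total 0 s with hs | hs <;> rcases le_total 0 t with ht | ht
  · rw [eval_toNNReal_of_nonneg B hs, eval_toNNReal_of_nonneg B ht, hB.right.covariance_eval,
      NNReal.coe_min,
      Real.coe_toNNReal s hs, Real.coe_toNNReal t ht, abs_of_nonneg hs, abs_of_nonneg ht,
      inf_eq_half_smul_add_sub_abs_sub ℝ, smul_eq_mul, invOf_eq_inv,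
      abs_sub_comm]
    ring
  · have := hind s.toNNReal (-t).toNNReal
    rw [Real.coe_toNNReal s hs, Real.coe_toNNReal (-t) (by linarith), neg_neg] at this
    rw [this, abs_of_nonneg hs, abs_of_nonpos ht, abs_of_nonneg (by linarith)]
    ring
  · have := hind t.toNNReal (-s).toNNReal
    rw [Real.coe_toNNReal t ht, Real.coe_toNNReal (-s) (by linarith), neg_neg] at this
    rw [covariance_comm, this, abs_of_nonneg ht, abs_of_nonpos hs, abs_of_nonpos (by linarith)]
    ring
  · rw [eval_toNNReal_of_nonpos B hs, eval_toNNReal_of_nonpos B ht, hB.left.covariance_eval,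
      NNReal.coe_min,
      Real.coe_toNNReal (-s) (by linarith), Real.coe_toNNReal (-t) (by linarith),
      abs_of_nonpos hs, abs_of_nonpos ht, inf_eq_half_smul_add_sub_abs_sub ℝ, smul_eq_mul,
      invOf_eq_inv,
      neg_sub_neg]
    ring

/-- Two-sided Brownian motion vanishes at `0` and has continuous paths, almost surely. -/
lemma ae_continuous (hB : IsTwoSidedBrownian B μ) :
    ∀ᵐ ω ∂μ, B 0 ω = 0 ∧ Continuous fun t ↦ B t ω := by
  filter_upwards [hB.right.cont, hB.left.cont, hB.right.eval_zero_ae_eq_zero] with ω h1 h2 h3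
  refine ⟨by simpa using h3, ?_⟩
  have : (fun t ↦ B t ω) = fun t : ℝ ↦ if 0 ≤ t then B ((t.toNNReal : ℝ≥0) : ℝ) ω
      else B (-((-t).toNNReal : ℝ≥0) : ℝ) ω := by
    funext t
    split_ifs with ht
    · rw [Real.coe_toNNReal t ht]
    · rw [Real.coe_toNNReal (-t) (by linarith), neg_neg]
  rw [this]
  refine Continuous.if_le (h1.comp continuous_real_toNNReal)
    (h2.comp (continuous_real_toNNReal.comp continuous_neg)) continuous_const continuous_id ?_
  rintro t rfl
  simp

end IsTwoSidedBrownian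

/-- The contribution of the field to the energy along a path over the block
`{o + 1, …, o + Λ - 1}`, compared to the base line `m`. -/
def blockProcess (W : ℕ → ℝ → Ω → ℝ) (Λ o : ℕ) (m : ℕ → ℝ) (k : RatPath Λ) (ω : Ω) : ℝ :=
  ∑ x ∈ Finset.Ioo 0 Λ, (W (o + x) (m x + k.toFun x) ω - W (o + x) (m x) ω)

namespace IsBrownianField

variable {L : ℕ} {W : ℕ → ℝ → Ω → ℝ}

lemma isGaussianProcess (hW : IsBrownianField L W μ) :
    IsGaussianProcess (fun (p : Finset.Ioo 0 L × ℝ) ω ↦ W p.1 p.2 ω) μ := by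
  have hZ : IsGaussianProcess (fun (t : ℝ) ω (x : Finset.Ioo 0 L) ↦ W x t ω) μ := by
    refine ⟨fun I ↦ ?_⟩
    have hi : iIndepFun (fun (x : Finset.Ioo 0 L) ω ↦ I.restrict fun y ↦ W x y ω) μ :=
      hW.indep.comp (fun _ ↦ I.restrict (π := fun _ ↦ ℝ))
        fun _ ↦ measurable_pi_lambda _ fun _ ↦ measurable_pi_apply _
    have hG := iIndepFun.hasGaussianLaw
      (X := fun (x : Finset.Ioo 0 L) ω ↦ I.restrict fun y ↦ W x y ω)
      (fun x ↦ (IsTwoSidedBrownian.isGaussianProcess (hW.brownian x x.2)).hasGaussianLaw I) hi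
    let M : (Finset.Ioo 0 L → I → ℝ) →L[ℝ] I → Finset.Ioo 0 L → ℝ :=
      { toFun x i j := x j i
        map_add' x y := rfl
        map_smul' c x := rfl
        cont := by fun_prop }
    exact hG.map M
  refine hZ.of_isGaussianProcess fun p ↦ ⟨{p.2},
    (ContinuousLinearMap.proj (φ := fun _ : Finset.Ioo 0 L ↦ ℝ) p.1).comp
      (ContinuousLinearMap.proj (φ := fun _ : ({p.2} : Finset ℝ) ↦ Finset.Ioo 0 L → ℝ)
        ⟨p.2, Finset.mem_singleton_self _⟩), fun ω ↦ rfl⟩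

lemma isProbabilityMeasure (hW : IsBrownianField L W μ) : IsProbabilityMeasure μ :=
  hW.isGaussianProcess.isProbabilityMeasure

lemma memLp_two (hW : IsBrownianField L W μ) {x : ℕ} (hx : x ∈ Finset.Ioo 0 L) (t : ℝ) :
    MemLp (W x t) 2 μ :=
  memLp_two_of_isGaussianProcess hW.isGaussianProcess (⟨x, hx⟩, t)

lemma covariance_of_ne (hW : IsBrownianField L W μ) {x y : ℕ} (hx : x ∈ Finset.Ioo 0 L)
    (hy : y ∈ Finset.Ioo 0 L) (hxy : x ≠ y) (s t : ℝ) : cov[W x s, W y t; μ] = 0 :=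
  IndepFun.covariance_eq_zero (X := W x s) (Y := W y t)
    ((hW.indep.indepFun (i := ⟨x, hx⟩) (j := ⟨y, hy⟩) (by simpa using hxy)).comp
      (φ := fun f : ℝ → ℝ ↦ f s) (ψ := fun f : ℝ → ℝ ↦ f t) (by fun_prop) (by fun_prop))
    (hW.memLp_two hx s) (hW.memLp_two hy t)

lemma memLp_sub (hW : IsBrownianField L W μ) {x : ℕ} (hx : x ∈ Finset.Ioo 0 L) (s t : ℝ) :
    MemLp (fun ω ↦ W x s ω - W x t ω) 2 μ :=
  (hW.memLp_two hx s).sub (hW.memLp_two hx t)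

lemma covariance_sub_of_ne (hW : IsBrownianField L W μ) {x y : ℕ} (hx : x ∈ Finset.Ioo 0 L)
    (hy : y ∈ Finset.Ioo 0 L) (hxy : x ≠ y) (s s' t t' : ℝ) :
    cov[fun ω ↦ W x s ω - W x s' ω, fun ω ↦ W y t ω - W y t' ω; μ] = 0 := by
  have := hW.isProbabilityMeasure
  rw [covariance_fun_sub_left (hW.memLp_two hx _) (hW.memLp_two hx _) (hW.memLp_sub hy _ _),
    covariance_fun_sub_right (hW.memLp_two hx _) (hW.memLp_two hy _) (hW.memLp_two hy _),
    covariance_fun_sub_right (hW.memLp_two hx _) (hW.memLp_two hy _) (hW.memLp_two hy _)]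
  have h := fun s t ↦ hW.covariance_of_ne hx hy hxy s t
  simp only [h, sub_self]

lemma variance_sub (hW : IsBrownianField L W μ) {x : ℕ} (hx : x ∈ Finset.Ioo 0 L) (s t : ℝ) :
    Var[fun ω ↦ W x s ω - W x t ω; μ] = |s - t| := by
  have := hW.isProbabilityMeasure
  rw [variance_fun_sub (hW.memLp_two hx _) (hW.memLp_two hx _), ← covariance_self
    (hW.memLp_two hx _).aemeasurable, ← covariance_self (hW.memLp_two hx _).aemeasurable]
  have h := (hW.brownian x hx).covariance_eval
  rw [h, h, h]
  simp
  ring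

lemma add_mem {Λ o x : ℕ} (ho : o + Λ ≤ L) (hx : x ∈ Finset.Ioo 0 Λ) :
    o + x ∈ Finset.Ioo 0 L := by
  rw [Finset.mem_Ioo] at *
  omega

lemma memLp_blockProcess (hW : IsBrownianField L W μ) {Λ o : ℕ} (ho : o + Λ ≤ L) (m : ℕ → ℝ)
    (k : RatPath Λ) : MemLp (blockProcess W Λ o m k) 2 μ :=
  memLp_finsetSum _ fun _ hx ↦ hW.memLp_sub (add_mem ho hx) _ _

/-- The block processes are linear images of the field. -/
lemma isGaussianProcess_block (hW : IsBrownianField L W μ) {T : Type*} {Λ : T → ℕ} {o : T → ℕ}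
    (ho : ∀ t, o t + Λ t ≤ L) (m : T → ℕ → ℝ) (k : ∀ t, RatPath (Λ t)) :
    IsGaussianProcess (fun t ω ↦ blockProcess W (Λ t) (o t) (m t) (k t) ω) μ := by
  classical
  refine hW.isGaussianProcess.of_isGaussianProcess fun t ↦ ?_
  let S : Finset (Finset.Ioo 0 L × ℝ) := Finset.univ ×ˢ
    ((Finset.Ioo 0 (Λ t)).image (fun x ↦ m t x + (k t).toFun x) ∪ (Finset.Ioo 0 (Λ t)).image (m t))
  have h1 : ∀ x : Finset.Ioo 0 (Λ t),
      ((⟨o t + x, add_mem (ho t) x.2⟩, m t x + (k t).toFun x) : Finset.Ioo 0 L × ℝ) ∈ S :=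
    fun x ↦ Finset.mem_product.2 ⟨Finset.mem_univ _, Finset.mem_union_left _
      (Finset.mem_image_of_mem (fun x ↦ m t x + (k t).toFun x) x.2)⟩
  have h2 : ∀ x : Finset.Ioo 0 (Λ t),
      ((⟨o t + x, add_mem (ho t) x.2⟩, m t x) : Finset.Ioo 0 L × ℝ) ∈ S :=
    fun x ↦ Finset.mem_product.2 ⟨Finset.mem_univ _, Finset.mem_union_right _
      (Finset.mem_image_of_mem (fun x ↦ m t x) x.2)⟩
  refine ⟨S, ∑ x : Finset.Ioo 0 (Λ t),
    (ContinuousLinearMap.proj (R := ℝ) (φ := fun _ : S ↦ ℝ) ⟨_, h1 x⟩ -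
    ContinuousLinearMap.proj (R := ℝ) (φ := fun _ : S ↦ ℝ) ⟨_, h2 x⟩), fun ω ↦ ?_⟩
  unfold blockProcess
  rw [← Finset.sum_coe_sort]
  simp

/-- The law of the block process does not depend on the block and on the base line. -/
lemma isShiftGaussian_block (hW : IsBrownianField L W μ) {Λ o : ℕ} (ho : o + Λ ≤ L)
    (m : ℕ → ℝ) :
    IsShiftGaussian (pathVar Λ) (μ.map fun ω k ↦ blockProcess W Λ o m k ω) := by
  have := hW.isProbabilityMeasure
  refine IsShiftGaussian.of_process
    (hW.isGaussianProcess_block (T := RatPath Λ) (Λ := fun _ ↦ Λ) (fun _ ↦ ho) (fun _ ↦ m) id)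
    (fun k ↦ ?_) ?_ fun h g ↦ ?_
  · unfold blockProcess
    rw [integral_finsetSum _ fun x hx ↦ (hW.memLp_sub (add_mem ho hx) _ _).integrable one_le_two]
    refine Finset.sum_eq_zero fun x hx ↦ ?_
    have hi := fun t ↦ (hW.memLp_two (add_mem ho hx) t).integrable one_le_two
    rw [integral_sub (hi _) (hi _), (hW.brownian _ (add_mem ho hx)).integral_eq_zero,
      (hW.brownian _ (add_mem ho hx)).integral_eq_zero, sub_zero]
  · refine ae_of_all _ fun ω ↦ ?_
    simp [blockProcess, RatPath.toFun_zero]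
  · have e : (fun ω ↦ blockProcess W Λ o m h ω - blockProcess W Λ o m g ω) =
        fun ω ↦ ∑ x ∈ Finset.Ioo 0 Λ,
          (W (o + x) (m x + h.toFun x) ω - W (o + x) (m x + g.toFun x) ω) := by
      funext ω
      simp only [blockProcess, ← Finset.sum_sub_distrib]
      exact Finset.sum_congr rfl fun x _ ↦ by ring
    rw [e, variance_fun_sum' fun x hx ↦ hW.memLp_sub (add_mem ho hx) _ _, pathVar]
    refine Finset.sum_congr rfl fun x hx ↦ ?_
    rw [Finset.sum_eq_single x]
    · rw [covariance_self (hW.memLp_sub (add_mem ho hx) _ _).aemeasurable]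
      refine (hW.variance_sub (add_mem ho hx) _ _).trans ?_
      rw [RatPath.toFun_sub, Pi.sub_apply, add_sub_add_left_eq_sub]
    · intro y hy hyx
      exact hW.covariance_sub_of_ne (add_mem ho hx) (add_mem ho hy) (by omega) _ _ _ _
    · exact fun h ↦ absurd hx h

/-- The processes over disjoint blocks are independent. -/
lemma iIndepFun_block (hW : IsBrownianField L W μ) {ι : Type*} {Λ : ℕ} {o : ι → ℕ}
    (ho : ∀ i, o i + Λ ≤ L) (hd : ∀ i j, i ≠ j → o i + Λ ≤ o j ∨ o j + Λ ≤ o i)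
    (m : ι → ℕ → ℝ) : iIndepFun (fun i ω k ↦ blockProcess W Λ (o i) (m i) k ω) μ := by
  have := hW.isProbabilityMeasure
  refine IsGaussianProcess.iIndepFun_of_covariance_eq_zero
    (X := fun i (k : RatPath Λ) ω ↦ blockProcess W Λ (o i) (m i) k ω) ?_
    (fun i k ↦ (hW.memLp_blockProcess (ho i) (m i) k).aemeasurable) fun i j hij h g ↦ ?_
  · exact hW.isGaussianProcess_block (T := (_ : ι) × RatPath Λ) (Λ := fun _ ↦ Λ)
      (fun t ↦ ho t.1) (fun t ↦ m t.1) fun t ↦ t.2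
  · simp only [blockProcess]
    rw [covariance_fun_sum_fun_sum'
      (fun x hx ↦ hW.memLp_sub (add_mem (ho i) hx) _ _)
      (fun x hx ↦ hW.memLp_sub (add_mem (ho j) hx) _ _)]
    refine Finset.sum_eq_zero fun x hx ↦ Finset.sum_eq_zero fun y hy ↦ ?_
    refine hW.covariance_sub_of_ne (add_mem (ho i) hx) (add_mem (ho j) hy) ?_ _ _ _ _
    rw [Finset.mem_Ioo] at hx hy
    rcases hd i j hij with h | h <;> omega

end IsBrownianField

end Field

/-! ### The mean response of the maximum to a tilt -/

namespace IsShiftGaussian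

section Abstract

variable {H : Type*} [AddCommGroup H] [Countable H] {v : H → ℝ} {P : Measure (H → ℝ)}
  {D g : H → ℝ} {η : H} {γ : ℝ}

lemma integrable_maxVal (hP : IsShiftGaussian v P) (hM : HasExpMoments P D) (hD : D 0 = 0) :
    Integrable (maxVal D) P := by
  refine ⟨(measurable_maxVal D).aestronglyMeasurable, ?_⟩
  refine lt_of_le_of_lt (lintegral_mono_ae ?_) (hM.ne_top 1 zero_le_one).lt_top
  filter_upwards [hM.bddAbove, hP.zero] with x hx hx0
  have h0 : 0 ≤ maxVal D x := by
    have := le_ciSup hx 0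
    simp only [hx0, hD, sub_zero] at this
    exact this
  rw [Real.enorm_of_nonneg h0, one_mul]
  exact ENNReal.ofReal_le_ofReal (by linarith [Real.add_one_le_exp (maxVal D x)])

/-- The mean of the tilted maximum is explicit, by stationarity of the increments. -/
lemma integrable_and_integral_maxVal_sub (hP : IsShiftGaussian v P) (hM : HasExpMoments P D)
    (hD : D 0 = 0) (hg : ∀ k, D (k + η) - g (k + η) = D k - γ) :
    Integrable (maxVal (D - g)) P ∧ ∫ x, maxVal (D - g) x ∂P = γ + ∫ x, maxVal D x ∂P := by
  have := hP.isProbabilityMeasure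
  have hi := hP.integrable_maxVal hM hD
  have hs : Integrable (fun x : H → ℝ ↦ maxVal D (fun h ↦ x (h + η) - x η)) P := by
    have := hi
    rw [← hP.map_shift η] at this
    exact this.comp_measurable (measurable_shift η)
  have hη : Integrable (fun x : H → ℝ ↦ x η) P := (hP.memLp_two η).integrable one_le_two
  have hae := (hP.ae_maxVal_sub_eq hM hg).mono fun x hx ↦ hx.2
  refine ⟨(((integrable_const γ).add hη).add hs).congr (hae.mono fun x hx ↦ hx.symm), ?_⟩
  rw [integral_congr_ae hae, integral_add (f := fun x : H → ℝ ↦ γ + x η)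
    ((integrable_const γ).add hη) hs,
    integral_add (integrable_const γ) hη, hP.integral_eq_zero]
  have : ∫ x : H → ℝ, maxVal D (fun h ↦ x (h + η) - x η) ∂P = ∫ x, maxVal D x ∂P := by
    conv_rhs => rw [← hP.map_shift η]
    rw [integral_map (measurable_shift η).aemeasurable
      (measurable_maxVal D).aestronglyMeasurable]
  rw [this]
  simp

end Abstract

end IsShiftGaussian

/-- The maximum over all paths in a block, with the energy tilted by `θ` at the site `x`. -/
def tiltMax (Λ x : ℕ) (θ : ℚ) (y : RatPath Λ → ℝ) : ℝ :=
  maxVal (pathEnergy Λ - (θ : ℝ) • pathEval x) y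

lemma tiltMax_eq (Λ x : ℕ) (θ : ℚ) (y : RatPath Λ → ℝ) :
    tiltMax Λ x θ y = ⨆ k, (y k - (pathEnergy Λ k - θ * k.toFun x)) := rfl

@[fun_prop]
lemma measurable_tiltMax (Λ x : ℕ) (θ : ℚ) : Measurable (tiltMax Λ x θ) := measurable_maxVal _

namespace IsShiftGaussian

variable {Λ : ℕ} {P : Measure (RatPath Λ → ℝ)}

lemma ae_bddAbove_tilt (hP : IsShiftGaussian (pathVar Λ) P) :
    ∀ᵐ y ∂P, ∀ x ∈ Finset.Ioo 0 Λ, ∀ θ : ℚ,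
      BddAbove (Set.range fun k ↦ y k - (pathEnergy Λ k - θ * k.toFun x)) := by
  have h : ∀ x : Finset.Ioo 0 Λ, ∀ θ : ℚ, ∀ᵐ y ∂P,
      BddAbove (Set.range fun k ↦ y k - (pathEnergy Λ k - θ * k.toFun x)) :=
    fun x θ ↦ (hP.ae_maxVal_sub_eq hP.hasExpMoments_pathEnergy
      (pathEnergy_shear x.2 θ)).mono fun y hy ↦ hy.1
  filter_upwards [ae_all_iff.2 fun x ↦ ae_all_iff.2 fun θ ↦ h x θ] with y hy x hx θ
  exact hy ⟨x, hx⟩ θ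

/-- The upper and the lower difference quotients of the maximum with respect to a tilt get
arbitrarily close: the maximum is a convex function of the tilt, and its mean is differentiable. -/
lemma ae_exists_quotient_lt (hP : IsShiftGaussian (pathVar Λ) P) :
    ∀ᵐ y ∂P, ∀ x ∈ Finset.Ioo 0 Λ, ∀ ε > 0, ∃ n : ℕ, ((n : ℝ) + 1) *
      (tiltMax Λ x ((n : ℚ) + 1)⁻¹ y + tiltMax Λ x (-((n : ℚ) + 1)⁻¹) y -
        2 * maxVal (pathEnergy Λ) y) < ε := by
  have := hP.isProbabilityMeasure
  have hM := hP.hasExpMoments_pathEnergy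
  have hN := hP.integrable_maxVal hM pathEnergy_zero
  -- `G x n` is a second difference of a convex function, hence nonnegative, and its mean is
  -- `O (1 / n)`; so its infimum over `n` vanishes almost surely.
  set G : ℕ → ℕ → (RatPath Λ → ℝ) → ℝ := fun x n y ↦ ((n : ℝ) + 1) *
      (tiltMax Λ x ((n : ℚ) + 1)⁻¹ y + tiltMax Λ x (-((n : ℚ) + 1)⁻¹) y -
        2 * maxVal (pathEnergy Λ) y) with hG
  have hGm : ∀ x n, Measurable (G x n) := fun x n ↦ by fun_prop
  have hG0 : ∀ᵐ y ∂P, ∀ x ∈ Finset.Ioo 0 Λ, ∀ n, 0 ≤ G x n y := by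
    filter_upwards [hP.ae_bddAbove_tilt] with y hy x hx n
    refine mul_nonneg (by positivity) ?_
    have hle : maxVal (pathEnergy Λ) y ≤
        (tiltMax Λ x ((n : ℚ) + 1)⁻¹ y + tiltMax Λ x (-((n : ℚ) + 1)⁻¹) y) / 2 := by
      refine ciSup_le fun k ↦ ?_
      have h1 := le_ciSup (hy x hx ((n : ℚ) + 1)⁻¹) k
      have h2 := le_ciSup (hy x hx (-((n : ℚ) + 1)⁻¹)) k
      rw [← tiltMax_eq] at h1 h2
      push_cast at h1 h2
      linarith
    linarith
  have hGint : ∀ x ∈ Finset.Ioo 0 Λ, ∀ n, ∫⁻ y, ENNReal.ofReal (G x n y) ∂P =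
      ENNReal.ofReal ((green Λ x).toFun x / (n + 1)) := by
    intro x hx n
    obtain ⟨h1, h1'⟩ := hP.integrable_and_integral_maxVal_sub hM pathEnergy_zero
      (pathEnergy_shear hx ((n : ℚ) + 1)⁻¹)
    obtain ⟨h2, h2'⟩ := hP.integrable_and_integral_maxVal_sub hM pathEnergy_zero
      (pathEnergy_shear hx (-((n : ℚ) + 1)⁻¹))
    have hi : Integrable (fun y ↦ tiltMax Λ x ((n : ℚ) + 1)⁻¹ y +
        tiltMax Λ x (-((n : ℚ) + 1)⁻¹) y) P := h1.add h2
    have hGi : Integrable (G x n) P := (hi.sub (hN.const_mul 2)).const_mul _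
    rw [← ofReal_integral_eq_lintegral_ofReal hGi (hG0.mono fun y hy ↦ hy x hx n)]
    congr 1
    rw [hG]
    simp only
    rw [integral_const_mul, integral_sub hi (hN.const_mul 2), integral_const_mul,
      integral_add (f := tiltMax Λ x ((n : ℚ) + 1)⁻¹) (g := tiltMax Λ x (-((n : ℚ) + 1)⁻¹)) h1 h2]
    unfold tiltMax
    rw [h1', h2']
    push_cast
    have : (n : ℝ) + 1 ≠ 0 := by positivity
    field_simp
    ring
  have hinf : ∀ x : Finset.Ioo 0 Λ, ∀ᵐ y ∂P, ⨅ n, ENNReal.ofReal (G x n y) = 0 := by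
    intro x
    refine (lintegral_eq_zero_iff (Measurable.iInf fun n ↦ (hGm x n).ennreal_ofReal)).1 ?_
    refine le_antisymm (ge_of_tendsto' (x := Filter.atTop)
      (f := fun n : ℕ ↦ ENNReal.ofReal ((green Λ x).toFun x / (n + 1))) ?_ fun n ↦ ?_) bot_le
    · rw [← ENNReal.ofReal_zero]
      exact (ENNReal.continuous_ofReal.tendsto 0).comp
        (((tendsto_const_div_atTop_nhds_zero_nat ((green Λ x).toFun x)).comp
          (Filter.tendsto_add_atTop_nat 1)).congr fun n ↦ by simp)
    · rw [← hGint x x.2 n]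
      exact lintegral_mono fun y ↦ iInf_le _ n
  filter_upwards [ae_all_iff.2 hinf] with y hy x hx ε hε
  have h1 := hy ⟨x, hx⟩
  have h2 : ⨅ n, ENNReal.ofReal (G x n y) < ENNReal.ofReal ε := by
    rw [h1]
    exact ENNReal.ofReal_pos.2 hε
  obtain ⟨n, hn⟩ := iInf_lt_iff.1 h2
  exact ⟨n, (ENNReal.ofReal_lt_ofReal_iff hε).1 hn⟩

/-- The response of the maximum to a tilt, as in `measure_response_le`, for the law of any process
with the right covariances. -/
lemma measure_tiltMax_sub_le (hP : IsShiftGaussian (pathVar Λ) P) {x : ℕ}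
    (hx : x ∈ Finset.Ioo 0 Λ) (θ : ℚ) :
    P {y | (θ : ℝ) ^ 2 * Λ ≤ tiltMax Λ x θ y - maxVal (pathEnergy Λ) y} ≤
      ENNReal.ofReal (2 * Real.exp (-(|(θ : ℝ)| ^ 3 / 200))) :=
  hP.measure_response_le hP.hasExpMoments_pathEnergy hx θ

end IsShiftGaussian

/-! ### Comparison of the minimizer with the tilted maxima -/

/-- The linear function on `{0, …, Λ}` with boundary values `a` and `b`. -/
def baseLine (Λ : ℕ) (a b : ℝ) (x : ℕ) : ℝ := a + (b - a) * x / Λ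

/-- The contribution of the field along the path `m + r`, compared to the path `m`. -/
def fieldGain (Λ : ℕ) (w : ℕ → ℝ → ℝ) (m r : ℕ → ℝ) : ℝ :=
  fieldTerm Λ w (m + r) - fieldTerm Λ w m

/-- The path with the given real values at the interior points, extended by zero. -/
def extendZero {Λ : ℕ} (r : Finset.Ioo 0 Λ → ℝ) (x : ℕ) : ℝ :=
  if h : x ∈ Finset.Ioo 0 Λ then r ⟨x, h⟩ else 0

section Deterministic

variable {Λ : ℕ} {w : ℕ → ℝ → ℝ}

lemma baseLine_zero_left (Λ : ℕ) (a b : ℝ) : baseLine Λ a b 0 = a := by simp [baseLine]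

lemma baseLine_self (hΛ : Λ ≠ 0) (a b : ℝ) : baseLine Λ a b Λ = b := by
  have : (Λ : ℝ) ≠ 0 := by exact_mod_cast hΛ
  rw [baseLine]
  field_simp
  ring

lemma baseLine_zero_zero (Λ : ℕ) : baseLine Λ 0 0 = 0 := by
  funext x
  simp [baseLine]

lemma sum_Icc_sub (r : ℕ → ℝ) (n : ℕ) : ∑ x ∈ Finset.Icc 1 n, (r x - r (x - 1)) = r n - r 0 := by
  induction n with
  | zero => simp
  | succ n ih =>
    rw [Finset.sum_Icc_succ_top (by omega), ih, Nat.add_sub_cancel]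
    ring

/-- Linear functions are orthogonal to the configurations. -/
lemma dirichletForm_baseLine (a b : ℝ) {r : ℕ → ℝ} (hr : IsConfiguration Λ r) :
    dirichletForm Λ (baseLine Λ a b) r = 0 := by
  have : dirichletForm Λ (baseLine Λ a b) r =
      ∑ x ∈ Finset.Icc 1 Λ, (b - a) / Λ * (r x - r (x - 1)) := by
    refine Finset.sum_congr rfl fun x hx ↦ ?_
    rw [baseLine, baseLine, Nat.cast_sub (Finset.mem_Icc.1 hx).1]
    push_cast
    ring
  rw [this, ← Finset.mul_sum, sum_Icc_sub, hr.1, hr.2 Λ le_rfl]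
  simp

lemma energy_baseLine_add (a b : ℝ) {r : ℕ → ℝ} (hr : IsConfiguration Λ r) :
    energy Λ w (baseLine Λ a b + r) = energy Λ w (baseLine Λ a b) -
      (fieldGain Λ w (baseLine Λ a b) r - dirichletEnergy Λ r) := by
  rw [energy, dirichletEnergy_add, dirichletForm_baseLine a b hr, energy, fieldGain]
  ring

lemma extendZero_isConfiguration (r : Finset.Ioo 0 Λ → ℝ) : IsConfiguration Λ (extendZero r) :=
  ⟨dif_neg (by simp), fun x hx ↦ dif_neg (by simp; omega)⟩

lemma extendZero_restrict {r : ℕ → ℝ} (hr : IsConfiguration Λ r) :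
    extendZero (fun x : Finset.Ioo 0 Λ ↦ r x) = r := by
  funext x
  unfold extendZero
  split_ifs with h
  · rfl
  · rw [Finset.mem_Ioo, not_and_or, not_lt, not_lt] at h
    rcases h with h | h
    · rw [Nat.le_zero.1 h, hr.1]
    · rw [hr.2 x h]

@[fun_prop]
lemma continuous_extendZero (x : ℕ) : Continuous fun r : Finset.Ioo 0 Λ → ℝ ↦ extendZero r x := by
  unfold extendZero
  split_ifs <;> fun_prop

@[fun_prop]
lemma continuous_dirichletEnergy_extendZero :
    Continuous fun r : Finset.Ioo 0 Λ → ℝ ↦ dirichletEnergy Λ (extendZero r) := by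
  unfold dirichletEnergy
  fun_prop

lemma continuous_fieldTerm_extendZero (hw : ∀ x ∈ Finset.Ioo 0 Λ, Continuous (w x))
    (m : ℕ → ℝ) :
    Continuous fun r : Finset.Ioo 0 Λ → ℝ ↦ fieldTerm Λ w (m + extendZero r) := by
  unfold fieldTerm
  refine continuous_finsetSum _ fun x hx ↦ (hw x hx).comp ?_
  simp only [Pi.add_apply]
  fun_prop

/-- By density, the maximum over the rational paths dominates all real paths. -/
lemma fieldGain_sub_le_iSup (hw : ∀ x ∈ Finset.Ioo 0 Λ, Continuous (w x)) (m : ℕ → ℝ) (θ : ℝ)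
    (x : ℕ) (hb : BddAbove (Set.range fun k : RatPath Λ ↦
      fieldGain Λ w m k.toFun - (pathEnergy Λ k - θ * k.toFun x))) {r : ℕ → ℝ}
    (hr : IsConfiguration Λ r) :
    fieldGain Λ w m r - (dirichletEnergy Λ r - θ * r x) ≤
      ⨆ k : RatPath Λ, (fieldGain Λ w m k.toFun - (pathEnergy Λ k - θ * k.toFun x)) := by
  have hd : DenseRange (Pi.map fun (_ : Finset.Ioo 0 Λ) (q : ℚ) ↦ (q : ℝ)) :=
    DenseRange.piMap fun _ ↦ Rat.denseRange_cast
  have hf : Continuous fun r : Finset.Ioo 0 Λ → ℝ ↦ fieldGain Λ w m (extendZero r) -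
      (dirichletEnergy Λ (extendZero r) - θ * extendZero r x) := by
    have := continuous_fieldTerm_extendZero hw m
    unfold fieldGain
    fun_prop
  have key : ∀ r : Finset.Ioo 0 Λ → ℝ, fieldGain Λ w m (extendZero r) -
      (dirichletEnergy Λ (extendZero r) - θ * extendZero r x) ≤
      ⨆ k : RatPath Λ, (fieldGain Λ w m k.toFun - (pathEnergy Λ k - θ * k.toFun x)) :=
    fun r ↦ hd.induction_on r (isClosed_le hf continuous_const) fun k ↦ le_ciSup hb k
  have := key fun x ↦ r x
  rwa [extendZero_restrict hr] at this

lemma max_sub_max_sq_add_le (a b c d : ℝ) :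
    (max a b - max c d) ^ 2 + (min a b - min c d) ^ 2 ≤ (a - c) ^ 2 + (b - d) ^ 2 := by
  rcases le_total a b with h1 | h1 <;> rcases le_total c d with h2 | h2 <;>
    simp only [max_eq_left, max_eq_right, min_eq_left, min_eq_right, h1, h2] <;>
    nlinarith [mul_nonneg (sub_nonneg.2 h1) (sub_nonneg.2 h2)]

/-- The energy is submodular. -/
lemma energy_sup_add_energy_inf_le (L : ℕ) (w : ℕ → ℝ → ℝ) (f h : ℕ → ℝ) :
    energy L w (f ⊔ h) + energy L w (f ⊓ h) ≤ energy L w f + energy L w h := by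
  have h1 : fieldTerm L w (f ⊔ h) + fieldTerm L w (f ⊓ h) = fieldTerm L w f + fieldTerm L w h := by
    simp only [fieldTerm, ← Finset.sum_add_distrib, Pi.sup_apply, Pi.inf_apply]
    refine Finset.sum_congr rfl fun x _ ↦ ?_
    rcases le_total (f x) (h x) with h | h <;> simp [h, add_comm]
  have h2 : dirichletEnergy L (f ⊔ h) + dirichletEnergy L (f ⊓ h) ≤
      dirichletEnergy L f + dirichletEnergy L h := by
    simp only [dirichletEnergy, ← mul_add, ← Finset.sum_add_distrib, Pi.sup_apply, Pi.inf_apply]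
    refine mul_le_mul_of_nonneg_left (Finset.sum_le_sum fun x _ ↦ ?_) (by norm_num)
    exact max_sub_max_sq_add_le _ _ _ _
  unfold energy
  linarith

/-- The key comparison. If the boundary values of a block are moved away from those of a minimizer
`h` in the direction of the tilt, then the response of the maximum to the tilt bounds the deviation
of `h` from the linear interpolation of the new boundary values. -/
theorem mul_sub_baseLine_le (hΛ : Λ ≠ 0) (hw : ∀ x ∈ Finset.Ioo 0 Λ, Continuous (w x))
    {h : ℕ → ℝ} (hmin : ∀ g : ℕ → ℝ, g 0 = h 0 → g Λ = h Λ → energy Λ w h ≤ energy Λ w g)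
    {a b θ : ℝ} (hab : 0 ≤ θ ∧ h 0 ≤ a ∧ h Λ ≤ b ∨ θ ≤ 0 ∧ a ≤ h 0 ∧ b ≤ h Λ) {x : ℕ} (hx : x ≤ Λ)
    (hb : BddAbove (Set.range fun k : RatPath Λ ↦ fieldGain Λ w (baseLine Λ a b) k.toFun -
      (pathEnergy Λ k - θ * k.toFun x))) :
    θ * (h x - baseLine Λ a b x) ≤
      (⨆ k : RatPath Λ, (fieldGain Λ w (baseLine Λ a b) k.toFun -
        (pathEnergy Λ k - θ * k.toFun x))) -
      ⨆ k : RatPath Λ, (fieldGain Λ w (baseLine Λ a b) k.toFun - pathEnergy Λ k) := by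
  set m := baseLine Λ a b with hm
  have hm0 : m 0 = a := baseLine_zero_left _ _ _
  have hmΛ : m Λ = b := baseLine_self hΛ _ _
  rw [le_sub_comm]
  refine ciSup_le fun k ↦ ?_
  -- a competitor with the boundary values of the block, on the right side of the minimizer
  obtain ⟨g, hg0, hgΛ, hgE, hgx⟩ : ∃ g : ℕ → ℝ, g 0 = a ∧ g Λ = b ∧
      energy Λ w g ≤ energy Λ w (m + k.toFun) ∧ θ * h x ≤ θ * g x := by
    have h0 : (m + k.toFun) 0 = a := by
      rw [Pi.add_apply, hm0, k.isConfiguration.1, add_zero]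
    have hL : (m + k.toFun) Λ = b := by
      rw [Pi.add_apply, hmΛ, k.isConfiguration.2 Λ le_rfl, add_zero]
    have hsub := energy_sup_add_energy_inf_le Λ w (m + k.toFun) h
    rcases hab with ⟨hθ, ha, hb⟩ | ⟨hθ, ha, hb⟩
    · refine ⟨(m + k.toFun) ⊔ h, ?_, ?_, ?_, mul_le_mul_of_nonneg_left le_sup_right hθ⟩
      · rw [Pi.sup_apply, h0, sup_eq_left.2 ha]
      · rw [Pi.sup_apply, hL, sup_eq_left.2 hb]
      · have := hmin ((m + k.toFun) ⊓ h) (by rw [Pi.inf_apply, h0, inf_eq_right.2 ha])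
          (by rw [Pi.inf_apply, hL, inf_eq_right.2 hb])
        linarith
    · refine ⟨(m + k.toFun) ⊓ h, ?_, ?_, ?_, mul_le_mul_of_nonpos_left inf_le_right hθ⟩
      · rw [Pi.inf_apply, h0, inf_eq_left.2 ha]
      · rw [Pi.inf_apply, hL, inf_eq_left.2 hb]
      · have := hmin ((m + k.toFun) ⊔ h) (by rw [Pi.sup_apply, h0, sup_eq_right.2 ha])
          (by rw [Pi.sup_apply, hL, sup_eq_right.2 hb])
        linarith
  have hr := extendZero_isConfiguration (Λ := Λ) fun y ↦ (g - m) y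
  set r := extendZero (Λ := Λ) fun y ↦ (g - m) y with hrdef
  have hgr : ∀ y ≤ Λ, (m + r) y = g y := by
    intro y hy
    rw [Pi.add_apply, hrdef, extendZero]
    split_ifs with hy'
    · rw [Pi.sub_apply]
      ring
    · rw [Finset.mem_Ioo, not_and_or, not_lt, not_lt] at hy'
      rcases hy' with h' | h'
      · rw [Nat.le_zero.1 h', hm0, hg0, add_zero]
      · rw [le_antisymm hy h', hmΛ, hgΛ, add_zero]
  have hE : energy Λ w (m + r) = energy Λ w g := by
    have e1 : ∑ y ∈ Finset.Icc 1 Λ, ((m + r) y - (m + r) (y - 1)) ^ 2 =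
        ∑ y ∈ Finset.Icc 1 Λ, (g y - g (y - 1)) ^ 2 := by
      refine Finset.sum_congr rfl fun y hy ↦ ?_
      rw [Finset.mem_Icc] at hy
      rw [hgr y hy.2, hgr (y - 1) (by omega)]
    have e2 : ∑ y ∈ Finset.Ioo 0 Λ, w y ((m + r) y) = ∑ y ∈ Finset.Ioo 0 Λ, w y (g y) :=
      Finset.sum_congr rfl fun y hy ↦ by rw [hgr y (Finset.mem_Ioo.1 hy).2.le]
    unfold energy dirichletEnergy fieldTerm
    rw [e1, e2]
  have h1 := fieldGain_sub_le_iSup hw m θ x hb hr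
  have h2 := energy_baseLine_add (w := w) a b hr
  have h3 := energy_baseLine_add (w := w) a b k.isConfiguration
  rw [← hm] at h2 h3
  rw [hE] at h2
  have h4 : θ * r x = θ * (g x - m x) := by
    rw [← hgr x hx, Pi.add_apply]
    ring
  change fieldGain Λ w m k.toFun - dirichletEnergy Λ k.toFun ≤ _
  linarith

/-- The restriction of a minimizer to a block minimizes the energy of the block. -/
lemma IsMinimizer.energy_block_le {L o : ℕ} {h : ℕ → ℝ} (hh : IsMinimizer L w h)
    (ho : o + Λ ≤ L) {g : ℕ → ℝ} (hg0 : g 0 = h o) (hgΛ : g Λ = h (o + Λ)) :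
    energy Λ (fun x ↦ w (o + x)) (fun x ↦ h (o + x)) ≤ energy Λ (fun x ↦ w (o + x)) g := by
  set f : ℕ → ℝ := fun x ↦ if o ≤ x ∧ x ≤ o + Λ then g (x - o) else h x with hf
  have hfc : IsConfiguration L f := by
    refine ⟨?_, fun x hx ↦ ?_⟩
    · simp only [hf]
      split_ifs with h0
      · obtain rfl : o = 0 := by omega
        rw [Nat.sub_self, hg0, hh.1.1]
      · exact hh.1.1
    · simp only [hf]
      split_ifs with h0
      · obtain rfl : x = o + Λ := by omega
        rw [Nat.add_sub_cancel_left, hgΛ, hh.1.2 _ hx]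
      · exact hh.1.2 x hx
  have hfo : ∀ x ≤ Λ, f (o + x) = g x := by
    intro x hx
    simp only [hf]
    rw [if_pos ⟨by omega, by omega⟩, Nat.add_sub_cancel_left]
  have hfout : ∀ x, x ≤ o ∨ o + Λ ≤ x → f x = h x := by
    intro x hx
    simp only [hf]
    split_ifs with h0
    · rcases hx with hx | hx
      · obtain rfl : x = o := by omega
        rw [Nat.sub_self, hg0]
      · obtain rfl : x = o + Λ := by omega
        rw [Nat.add_sub_cancel_left, hgΛ]
    · rfl
  have hmin := hh.2 f hfc
  have hsplit : ∀ (u : ℕ → ℝ), ∑ x ∈ Finset.Icc 1 L, u x =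
      ∑ x ∈ Finset.Icc 1 Λ, u (o + x) +
        ∑ x ∈ Finset.Icc 1 L with ¬ (o + 1 ≤ x ∧ x ≤ o + Λ), u x := by
    intro u
    rw [← Finset.sum_filter_add_sum_filter_not (Finset.Icc 1 L) fun x ↦ o + 1 ≤ x ∧ x ≤ o + Λ]
    congr 1
    refine (Finset.sum_bij (fun x _ ↦ o + x) ?_ ?_ ?_ ?_).symm
    · intro x hx
      simp only [Finset.mem_Icc, Finset.mem_filter] at hx ⊢
      omega
    · intro x _ y _ hxy
      omega
    · intro x hx
      simp only [Finset.mem_Icc, Finset.mem_filter] at hx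
      exact ⟨x - o, by simp only [Finset.mem_Icc]; omega, by omega⟩
    · intro x _
      rfl
  have hsplit' : ∀ (u : ℕ → ℝ), ∑ x ∈ Finset.Ioo 0 L, u x =
      ∑ x ∈ Finset.Ioo 0 Λ, u (o + x) +
        ∑ x ∈ Finset.Ioo 0 L with ¬ (o < x ∧ x < o + Λ), u x := by
    intro u
    rw [← Finset.sum_filter_add_sum_filter_not (Finset.Ioo 0 L) fun x ↦ o < x ∧ x < o + Λ]
    congr 1
    refine (Finset.sum_bij (fun x _ ↦ o + x) ?_ ?_ ?_ ?_).symm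
    · intro x hx
      simp only [Finset.mem_Ioo, Finset.mem_filter] at hx ⊢
      omega
    · intro x _ y _ hxy
      omega
    · intro x hx
      simp only [Finset.mem_Ioo, Finset.mem_filter] at hx
      exact ⟨x - o, by simp only [Finset.mem_Ioo]; omega, by omega⟩
    · intro x _
      rfl
  have h1 : ∑ x ∈ Finset.Icc 1 L with ¬ (o + 1 ≤ x ∧ x ≤ o + Λ), (f x - f (x - 1)) ^ 2 =
      ∑ x ∈ Finset.Icc 1 L with ¬ (o + 1 ≤ x ∧ x ≤ o + Λ), (h x - h (x - 1)) ^ 2 := by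
    refine Finset.sum_congr rfl fun x hx ↦ ?_
    simp only [Finset.mem_Icc, Finset.mem_filter] at hx
    rw [hfout x (by omega), hfout (x - 1) (by omega)]
  have h2 : ∑ x ∈ Finset.Ioo 0 L with ¬ (o < x ∧ x < o + Λ), w x (f x) =
      ∑ x ∈ Finset.Ioo 0 L with ¬ (o < x ∧ x < o + Λ), w x (h x) := by
    refine Finset.sum_congr rfl fun x hx ↦ ?_
    simp only [Finset.mem_Ioo, Finset.mem_filter] at hx
    rw [hfout x (by omega)]
  have h3 : ∑ x ∈ Finset.Icc 1 Λ, (f (o + x) - f (o + x - 1)) ^ 2 =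
      ∑ x ∈ Finset.Icc 1 Λ, (g x - g (x - 1)) ^ 2 := by
    refine Finset.sum_congr rfl fun x hx ↦ ?_
    rw [Finset.mem_Icc] at hx
    rw [hfo x hx.2, Nat.add_sub_assoc hx.1, hfo (x - 1) (by omega)]
  have h4 : ∑ x ∈ Finset.Ioo 0 Λ, w (o + x) (f (o + x)) =
      ∑ x ∈ Finset.Ioo 0 Λ, w (o + x) (g x) := by
    refine Finset.sum_congr rfl fun x hx ↦ ?_
    rw [hfo x (Finset.mem_Ioo.1 hx).2.le]
  have h5 : ∑ x ∈ Finset.Icc 1 Λ, (h (o + x) - h (o + x - 1)) ^ 2 =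
      ∑ x ∈ Finset.Icc 1 Λ, (h (o + x) - h (o + (x - 1))) ^ 2 := by
    refine Finset.sum_congr rfl fun x hx ↦ ?_
    rw [Nat.add_sub_assoc (Finset.mem_Icc.1 hx).1]
  unfold energy dirichletEnergy fieldTerm at hmin ⊢
  rw [hsplit fun x ↦ (h x - h (x - 1)) ^ 2, hsplit fun x ↦ (f x - f (x - 1)) ^ 2,
    hsplit' fun x ↦ w x (h x), hsplit' fun x ↦ w x (f x), h1, h2, h3, h4, h5] at hmin
  linarith

end Deterministic

/-! ### Existence, uniqueness and measurability of the minimizer -/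

lemma blockProcess_eq {Ω : Type*} (W : ℕ → ℝ → Ω → ℝ) (Λ o : ℕ) (m : ℕ → ℝ) (k : RatPath Λ)
    (ω : Ω) : blockProcess W Λ o m k ω = fieldGain Λ (fun x y ↦ W (o + x) y ω) m k.toFun := by
  unfold blockProcess fieldGain fieldTerm
  rw [Finset.sum_sub_distrib]
  rfl

namespace IsBrownianField

variable {Ω : Type*} [MeasurableSpace Ω] {μ : Measure Ω} {L : ℕ} {W : ℕ → ℝ → Ω → ℝ}

lemma ae_continuous (hW : IsBrownianField L W μ) :
    ∀ᵐ ω ∂μ, ∀ x ∈ Finset.Ioo 0 L, Continuous fun y ↦ W x y ω := by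
  have : ∀ x : Finset.Ioo 0 L, ∀ᵐ ω ∂μ, Continuous fun y ↦ W x y ω := fun x ↦
    (hW.brownian x x.2).ae_continuous.mono fun ω hω ↦ hω.2
  filter_upwards [ae_all_iff.2 this] with ω hω x hx using hω ⟨x, hx⟩

lemma aemeasurable_block (hW : IsBrownianField L W μ) {Λ o : ℕ} (ho : o + Λ ≤ L) (m : ℕ → ℝ) :
    AEMeasurable (fun ω (k : RatPath Λ) ↦ blockProcess W Λ o m k ω) μ :=
  aemeasurable_pi_lambda _ fun k ↦ (hW.memLp_blockProcess ho m k).aemeasurable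

lemma ae_bddAbove_block (hW : IsBrownianField L W μ) {Λ o : ℕ} (ho : o + Λ ≤ L) (m : ℕ → ℝ) :
    ∀ᵐ ω ∂μ, ∀ x ∈ Finset.Ioo 0 Λ, ∀ θ : ℚ, BddAbove (Set.range fun k : RatPath Λ ↦
      fieldGain Λ (fun x y ↦ W (o + x) y ω) m k.toFun - (pathEnergy Λ k - θ * k.toFun x)) := by
  filter_upwards [ae_of_ae_map (hW.aemeasurable_block ho m)
    (hW.isShiftGaussian_block ho m).ae_bddAbove_tilt] with ω hω
  simpa only [blockProcess_eq] using hω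

/-- The deviation of a minimizer from the linear interpolation over a block is bounded by the
response of the maximum on the block to a tilt. -/
lemma ae_mul_sub_baseLine_le (hW : IsBrownianField L W μ) {Λ o : ℕ} (ho : o + Λ ≤ L)
    (a b : ℝ) (θ : ℚ) {x : ℕ} (hx : x ∈ Finset.Ioo 0 Λ) :
    ∀ᵐ ω ∂μ, ∀ h, IsMinimizer L (fun x y ↦ W x y ω) h →
      ((0 : ℝ) ≤ θ ∧ h o ≤ a ∧ h (o + Λ) ≤ b ∨ (θ : ℝ) ≤ 0 ∧ a ≤ h o ∧ b ≤ h (o + Λ)) →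
      θ * (h (o + x) - baseLine Λ a b x) ≤
        tiltMax Λ x θ (fun k ↦ blockProcess W Λ o (baseLine Λ a b) k ω) -
          maxVal (pathEnergy Λ) fun k ↦ blockProcess W Λ o (baseLine Λ a b) k ω := by
  filter_upwards [hW.ae_continuous, hW.ae_bddAbove_block ho (baseLine Λ a b)] with ω hc hb h hh hab
  have hx' := Finset.mem_Ioo.1 hx
  have := mul_sub_baseLine_le (w := fun x y ↦ W (o + x) y ω) (h := fun x ↦ h (o + x)) (a := a)
    (b := b) (θ := θ) (x := x) (by omega) (fun y hy ↦ hc (o + y) (add_mem ho hy))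
    (fun g hg0 hgΛ ↦ hh.energy_block_le ho hg0 hgΛ) hab hx'.2.le (hb x hx θ)
  rw [tiltMax_eq]
  unfold maxVal
  simpa only [blockProcess_eq] using this

/-- The upper difference quotient of the maximum with respect to a tilt at the site `x`. -/
def upperQuotient (L x n : ℕ) (y : RatPath L → ℝ) : ℝ :=
  ((n : ℝ) + 1) * (tiltMax L x ((n : ℚ) + 1)⁻¹ y - maxVal (pathEnergy L) y)

/-- The lower difference quotient of the maximum with respect to a tilt at the site `x`. -/
def lowerQuotient (L x n : ℕ) (y : RatPath L → ℝ) : ℝ :=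
  ((n : ℝ) + 1) * (maxVal (pathEnergy L) y - tiltMax L x (-((n : ℚ) + 1)⁻¹) y)

/-- The minimizer is squeezed between the difference quotients of the maximum. -/
lemma ae_quotient_bounds (hW : IsBrownianField L W μ) :
    ∀ᵐ ω ∂μ, ∀ h, IsMinimizer L (fun x y ↦ W x y ω) h → ∀ x ∈ Finset.Ioo 0 L,
      (∀ n, lowerQuotient L x n (fun k ↦ blockProcess W L 0 (baseLine L 0 0) k ω) ≤ h x ∧
        h x ≤ upperQuotient L x n fun k ↦ blockProcess W L 0 (baseLine L 0 0) k ω) ∧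
      ∀ ε > 0, ∃ n, upperQuotient L x n (fun k ↦ blockProcess W L 0 (baseLine L 0 0) k ω) -
        lowerQuotient L x n (fun k ↦ blockProcess W L 0 (baseLine L 0 0) k ω) < ε := by
  have hL : 0 + L ≤ L := by omega
  have h1 : ∀ (x : Finset.Ioo 0 L) (θ : ℚ), _ := fun x θ ↦
    hW.ae_mul_sub_baseLine_le hL 0 0 θ x.2
  have h2 := ae_of_ae_map (hW.aemeasurable_block hL (baseLine L 0 0))
    (hW.isShiftGaussian_block hL (baseLine L 0 0)).ae_exists_quotient_lt
  filter_upwards [ae_all_iff.2 fun x ↦ ae_all_iff.2 fun θ ↦ h1 x θ, h2] with ω hω hω2 h hh x hx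
  have hb : baseLine L 0 0 x = 0 := by rw [baseLine_zero_zero, Pi.zero_apply]
  refine ⟨fun n ↦ ⟨?_, ?_⟩, fun ε hε ↦ ?_⟩
  · have h3 := hω ⟨x, hx⟩ (-((n : ℚ) + 1)⁻¹) h hh (Or.inr ⟨?_, ?_, ?_⟩)
    · simp only [zero_add, hb] at h3
      push_cast at h3
      unfold lowerQuotient
      have hn : (0 : ℝ) < n + 1 := by positivity
      rw [mul_comm, ← le_div_iff₀ hn, div_eq_inv_mul]
      linarith
    · push_cast
      have : (0 : ℝ) ≤ ((n : ℝ) + 1)⁻¹ := by positivity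
      linarith
    · exact hh.1.1.ge
    · rw [zero_add]
      exact (hh.1.2 L le_rfl).ge
  · have h3 := hω ⟨x, hx⟩ (((n : ℚ) + 1)⁻¹) h hh (Or.inl ⟨?_, ?_, ?_⟩)
    · simp only [zero_add, hb] at h3
      push_cast at h3
      unfold upperQuotient
      have hn : (0 : ℝ) < n + 1 := by positivity
      rw [mul_comm, ← div_le_iff₀ hn, div_eq_inv_mul]
      linarith
    · push_cast
      positivity
    · exact hh.1.1.le
    · rw [zero_add]
      exact (hh.1.2 L le_rfl).le
  · obtain ⟨n, hn⟩ := hω2 x hx ε hε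
    refine ⟨n, lt_of_le_of_lt (le_of_eq ?_) hn⟩
    unfold upperQuotient lowerQuotient
    ring

/-- Almost surely, there is a minimizer: the tilted maxima are finite, hence the energy grows at
least linearly. -/
lemma ae_exists_isMinimizer (hW : IsBrownianField L W μ) :
    ∀ᵐ ω ∂μ, ∃ h, IsMinimizer L (fun x y ↦ W x y ω) h := by
  have hL : 0 + L ≤ L := by omega
  filter_upwards [hW.ae_continuous, hW.ae_bddAbove_block hL (baseLine L 0 0)] with ω hc hb
  simp only [zero_add] at hb
  set w : ℕ → ℝ → ℝ := fun x y ↦ W x y ω with hw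
  have hE : ∀ r : Finset.Ioo 0 L → ℝ, energy L w (extendZero r) = energy L w 0 -
      (fieldGain L w (baseLine L 0 0) (extendZero r) - dirichletEnergy L (extendZero r)) := by
    intro r
    have := energy_baseLine_add (w := w) 0 0 (extendZero_isConfiguration r)
    rw [baseLine_zero_zero, zero_add] at this
    rw [baseLine_zero_zero, this]
  have hcont : Continuous fun r : Finset.Ioo 0 L → ℝ ↦ energy L w (extendZero r) := by
    have h1 := continuous_fieldTerm_extendZero hc 0
    simp only [zero_add] at h1
    exact continuous_dirichletEnergy_extendZero.sub h1
  have hbound : ∀ x : Finset.Ioo 0 L, ∃ C, ∀ r : Finset.Ioo 0 L → ℝ,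
      |r x| ≤ energy L w (extendZero r) + C := by
    intro x
    have h1 := fun r : Finset.Ioo 0 L → ℝ ↦ fieldGain_sub_le_iSup hc (baseLine L 0 0) _ _
      (hb x x.2 1) (extendZero_isConfiguration r)
    have h2 := fun r : Finset.Ioo 0 L → ℝ ↦ fieldGain_sub_le_iSup hc (baseLine L 0 0) _ _
      (hb x x.2 (-1)) (extendZero_isConfiguration r)
    set M1 := ⨆ k : RatPath L, (fieldGain L w (baseLine L 0 0) k.toFun -
      (pathEnergy L k - ((1 : ℚ) : ℝ) * k.toFun x))
    set M2 := ⨆ k : RatPath L, (fieldGain L w (baseLine L 0 0) k.toFun -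
      (pathEnergy L k - ((-1 : ℚ) : ℝ) * k.toFun x))
    refine ⟨max M1 M2 - energy L w 0, fun r ↦ ?_⟩
    have h3 := h1 r
    have h4 := h2 r
    have h5 := hE r
    have h6 : extendZero r x = r x := dif_pos x.2
    push_cast at h3 h4
    rw [h6] at h3 h4
    have h7 := le_max_left M1 M2
    have h8 := le_max_right M1 M2
    rw [abs_le]
    constructor <;> linarith
  choose C hC using hbound
  set e := energy L w (extendZero (0 : Finset.Ioo 0 L → ℝ)) with he
  have hbdd : Bornology.IsBounded {r : Finset.Ioo 0 L → ℝ | energy L w (extendZero r) ≤ e} := by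
    refine (Metric.isBounded_iff_subset_closedBall 0).2
      ⟨∑ x, |e + C x|, fun r hr ↦ ?_⟩
    rw [mem_closedBall_zero_iff, pi_norm_le_iff_of_nonneg (by positivity)]
    intro x
    rw [Real.norm_eq_abs]
    refine (hC x r).trans ?_
    have h1 : energy L w (extendZero r) ≤ e := hr
    have h2 := Finset.single_le_sum (f := fun x ↦ |e + C x|)
      (fun _ _ ↦ abs_nonneg _) (Finset.mem_univ x)
    have h3 := le_abs_self (e + C x)
    linarith
  obtain ⟨r, hr⟩ := hcont.exists_forall_le_of_isBounded 0 hbdd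
  refine ⟨extendZero r, extendZero_isConfiguration r, fun g hg ↦ ?_⟩
  have := hr fun x ↦ g x
  rwa [extendZero_restrict hg] at this

/-- Almost surely, the minimizer is unique. -/
theorem ae_existsUnique_isMinimizer (hW : IsBrownianField L W μ) :
    ∀ᵐ ω ∂μ, ∃! h, IsMinimizer L (fun x y ↦ W x y ω) h := by
  filter_upwards [hW.ae_exists_isMinimizer, hW.ae_quotient_bounds] with ω ⟨h, hh⟩ hq
  refine ⟨h, hh, fun g hg ↦ funext fun x ↦ ?_⟩
  by_cases hx : x ∈ Finset.Ioo 0 L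
  · refine eq_of_forall_dist_le fun ε hε ↦ ?_
    obtain ⟨h1, h2⟩ := hq h hh x hx
    obtain ⟨g1, -⟩ := hq g hg x hx
    obtain ⟨n, hn⟩ := h2 ε hε
    rw [Real.dist_eq, abs_le]
    have := h1 n
    have := g1 n
    constructor <;> linarith
  · rw [Finset.mem_Ioo, not_and_or, not_lt, not_lt] at hx
    rcases hx with hx | hx
    · rw [Nat.le_zero.1 hx, hg.1.1, hh.1.1]
    · rw [hg.1.2 x hx, hh.1.2 x hx]

/-- The minimizer is measurable up to a null set: it is the infimum of the upper difference
quotients. -/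
theorem aemeasurable_of_isMinimizer (hW : IsBrownianField L W μ) {hstar : Ω → ℕ → ℝ}
    (hmin : ∀ᵐ ω ∂μ, IsMinimizer L (fun x y ↦ W x y ω) (hstar ω)) : AEMeasurable hstar μ := by
  have hL : 0 + L ≤ L := by omega
  refine aemeasurable_pi_lambda _ fun x ↦ ?_
  by_cases hx : x ∈ Finset.Ioo 0 L
  · have hu : Measurable fun y : RatPath L → ℝ ↦ ⨅ n, upperQuotient L x n y :=
      Measurable.iInf fun n ↦ by
        unfold upperQuotient
        fun_prop
    refine (hu.comp_aemeasurable (hW.aemeasurable_block hL (baseLine L 0 0))).congr ?_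
    filter_upwards [hmin, hW.ae_quotient_bounds] with ω hω hq
    obtain ⟨h1, h2⟩ := hq _ hω x hx
    refine ciInf_eq_of_forall_ge_of_forall_gt_exists_lt (fun n ↦ (h1 n).2) fun c hc ↦ ?_
    obtain ⟨n, hn⟩ := h2 (c - hstar ω x) (by linarith)
    exact ⟨n, by linarith [(h1 n).1]⟩
  · refine (aemeasurable_const (b := (0 : ℝ))).congr ?_
    filter_upwards [hmin] with ω hω
    rw [Finset.mem_Ioo, not_and_or, not_lt, not_lt] at hx
    rcases hx with hx | hx
    · rw [Nat.le_zero.1 hx, hω.1.1]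
    · rw [hω.1.2 x hx]

end IsBrownianField

/-! ### Summation over dyadic nets -/

/-- The possible values of an integer net at the interior points of `{0, …, 2 ^ M}`, arranged in a
binary tree: the value at the midpoint, and the values on the two halves. -/
def NetTree : ℕ → Type
  | 0 => Unit
  | M + 1 => ℤ × NetTree M × NetTree M

instance NetTree.countable : ∀ M, Countable (NetTree M)
  | 0 => inferInstanceAs (Countable Unit)
  | M + 1 =>
    have := NetTree.countable M
    inferInstanceAs (Countable (ℤ × NetTree M × NetTree M))

/-- The values of the net `c` at the interior points of `{0, …, 2 ^ M}`. -/
def netTree : (M : ℕ) → (ℕ → ℤ) → NetTree M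
  | 0, _ => ()
  | M + 1, c => (c (2 ^ M), netTree M c, netTree M fun j ↦ c (j + 2 ^ M))

/-- The deviation of the net `c` at the midpoint of the `a`-th interval of length `2 ^ (j + 1)` from
the linear interpolation, relative to the length of the interval. -/
def bend (j a : ℕ) (c : ℕ → ℤ) : ℚ :=
  (c ((2 * a + 1) * 2 ^ j) - ((c (2 * a * 2 ^ j) : ℚ) + c ((2 * a + 2) * 2 ^ j)) / 2) / 2 ^ (j + 1)

/-- The product of the weights `g` of the deviations over all dyadic intervals, as a function of the
values of the net at the end points and of the tree of the other values. -/
def netWeight (g : ℕ → ℚ → ℝ≥0∞) : (M : ℕ) → ℤ → ℤ → NetTree M → ℝ≥0∞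
  | 0, _, _, _ => 1
  | M + 1, a, b, (c, t, t') =>
    g M ((c - ((a : ℚ) + b) / 2) / 2 ^ (M + 1)) * (netWeight g M a c t * netWeight g M c b t')

lemma eq_of_netTree_eq {M : ℕ} : ∀ {c c' : ℕ → ℤ}, netTree M c = netTree M c' → c 0 = c' 0 →
    c (2 ^ M) = c' (2 ^ M) → ∀ j ≤ 2 ^ M, c j = c' j := by
  induction M with
  | zero =>
    intro c c' _ h0 h1 j hj
    have : j = 0 ∨ j = 1 := by omega
    rcases this with rfl | rfl
    · exact h0
    · exact h1
  | succ M ih =>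
    intro c c' h h0 h1 j hj
    obtain ⟨hm, hl, hr⟩ : c (2 ^ M) = c' (2 ^ M) ∧ netTree M c = netTree M c' ∧
        (netTree M fun j ↦ c (j + 2 ^ M)) = netTree M fun j ↦ c' (j + 2 ^ M) :=
      ⟨congrArg Prod.fst h, congrArg (fun t ↦ t.2.1) h, congrArg (fun t ↦ t.2.2) h⟩
    rcases le_total j (2 ^ M) with hj' | hj'
    · exact ih hl h0 hm j hj'
    · have h2 := ih hr (by simpa using hm) (by
        rw [pow_succ, mul_two] at h1
        exact h1) (j - 2 ^ M) (by rw [pow_succ] at hj; omega)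
      simpa only [Nat.sub_add_cancel hj'] using h2

lemma netWeight_netTree (g : ℕ → ℚ → ℝ≥0∞) (M : ℕ) : ∀ c : ℕ → ℤ,
    netWeight g M (c 0) (c (2 ^ M)) (netTree M c) =
      ∏ j ∈ Finset.range M, ∏ a ∈ Finset.range (2 ^ (M - 1 - j)), g j (bend j a c) := by
  induction M with
  | zero => simp [netWeight]
  | succ M ih =>
    intro c
    rw [Finset.prod_range_succ]
    have e1 : ∏ a ∈ Finset.range (2 ^ (M + 1 - 1 - M)), g M (bend M a c) =
        g M ((c (2 ^ M) - ((c 0 : ℚ) + c (2 ^ (M + 1))) / 2) / 2 ^ (M + 1)) := by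
      simp [bend, pow_succ, mul_comm]
    have e2 : ∀ j ∈ Finset.range M, ∏ a ∈ Finset.range (2 ^ (M + 1 - 1 - j)), g j (bend j a c) =
        (∏ a ∈ Finset.range (2 ^ (M - 1 - j)), g j (bend j a c)) *
          ∏ a ∈ Finset.range (2 ^ (M - 1 - j)), g j (bend j a fun j ↦ c (j + 2 ^ M)) := by
      intro j hj
      rw [Finset.mem_range] at hj
      have hp : 2 ^ (M + 1 - 1 - j) = 2 ^ (M - 1 - j) + 2 ^ (M - 1 - j) := by
        rw [← mul_two, ← pow_succ]
        congr 1
        omega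
      have hp2 : 2 ^ M = 2 ^ (M - 1 - j) * 2 * 2 ^ j := by
        rw [← pow_succ, ← pow_add]
        congr 1
        omega
      rw [hp, Finset.prod_range_add]
      congr 1
      refine Finset.prod_congr rfl fun a _ ↦ ?_
      simp only [bend]
      rw [hp2]
      ring_nf
    rw [e1, Finset.prod_congr rfl e2, Finset.prod_mul_distrib, ← ih c,
      ← ih fun j ↦ c (j + 2 ^ M)]
    simp only [netTree, netWeight, zero_add]
    rw [mul_comm, pow_succ, mul_two]

/-- The total weight of all nets, from bounds on the total weight of the values at one point. -/
lemma tsum_netWeight_le {g : ℕ → ℚ → ℝ≥0∞} {S B : ℕ → ℝ≥0∞}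
    (hS : ∀ j (s : ℚ), ∑' c : ℤ, g j ((c - s) / 2 ^ (j + 1)) ≤ S j) (hB0 : 1 ≤ B 0)
    (hB : ∀ M, S M * (B M * B M) ≤ B (M + 1)) (M : ℕ) :
    ∀ a b : ℤ, ∑' t, netWeight g M a b t ≤ B M := by
  induction M with
  | zero =>
    intro a b
    have : ∑' t : NetTree 0, netWeight g 0 a b t = 1 := by
      change ∑' t : Unit, (1 : ℝ≥0∞) = 1
      simp
    rw [this]
    exact hB0
  | succ M ih =>
    intro a b
    calc ∑' t, netWeight g (M + 1) a b t
        = ∑' (c : ℤ) (t : NetTree M) (t' : NetTree M),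
            g M ((c - ((a : ℚ) + b) / 2) / 2 ^ (M + 1)) *
              (netWeight g M a c t * netWeight g M c b t') := by
          refine (ENNReal.tsum_prod'
            (f := fun t : ℤ × NetTree M × NetTree M ↦ netWeight g (M + 1) a b t)).trans ?_
          exact tsum_congr fun c ↦ ENNReal.tsum_prod'
            (f := fun t : NetTree M × NetTree M ↦ netWeight g (M + 1) a b (c, t))
      _ = ∑' c : ℤ, g M ((c - ((a : ℚ) + b) / 2) / 2 ^ (M + 1)) *
            ((∑' t, netWeight g M a c t) * ∑' t', netWeight g M c b t') := by
          simp only [ENNReal.tsum_mul_left, ENNReal.tsum_mul_right]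
      _ ≤ ∑' c : ℤ, g M ((c - ((a : ℚ) + b) / 2) / 2 ^ (M + 1)) * (B M * B M) :=
          ENNReal.tsum_le_tsum fun c ↦ mul_le_mul_right (mul_le_mul' (ih a c) (ih c b)) _
      _ ≤ S M * (B M * B M) := by
          rw [ENNReal.tsum_mul_right]
          exact mul_le_mul_left (hS M _) _
      _ ≤ B (M + 1) := hB M

/-- A Riemann sum for a two-sided exponential. -/
lemma tsum_exp_neg_abs_sub_le (s : ℝ) {δ : ℝ} (h0 : 0 < δ) (h1 : δ ≤ 1) :
    ∑' c : ℤ, ENNReal.ofReal (Real.exp (-(δ * |c - s|))) ≤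
      ENNReal.ofReal (4 * Real.exp 1 / δ) := by
  have hnat : ∑' n : ℕ, ENNReal.ofReal (Real.exp (-(δ * n))) ≤ ENNReal.ofReal (2 / δ) := by
    have hr : Real.exp (-δ) < 1 := Real.exp_lt_one_iff.2 (by linarith)
    have e : ∀ n : ℕ, Real.exp (-(δ * n)) = Real.exp (-δ) ^ n := by
      intro n
      rw [← Real.exp_nat_mul]
      congr 1
      ring
    simp only [e]
    rw [← ENNReal.ofReal_tsum_of_nonneg (fun _ ↦ by positivity)
      (summable_geometric_of_lt_one (by positivity) hr),
      tsum_geometric_of_lt_one (by positivity) hr]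
    refine ENNReal.ofReal_le_ofReal ?_
    have h2 : Real.exp (-δ) ≤ 1 / (1 + δ) := by
      rw [Real.exp_neg, inv_eq_one_div]
      exact one_div_le_one_div_of_le (by linarith) (by linarith [Real.add_one_le_exp δ])
    have h3 : δ / 2 ≤ 1 - Real.exp (-δ) := by
      have : δ / 2 ≤ 1 - 1 / (1 + δ) := by
        rw [le_sub_iff_add_le, ← le_sub_iff_add_le', div_le_iff₀ (by linarith)]
        nlinarith
      linarith
    rw [inv_eq_one_div, show 2 / δ = 1 / (δ / 2) by field_simp]
    exact one_div_le_one_div_of_le (by linarith) h3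
  have hle : ∀ c : ℤ, ENNReal.ofReal (Real.exp (-(δ * |((c + ⌊s⌋ : ℤ) : ℝ) - s|))) ≤
      ENNReal.ofReal (Real.exp 1) * ENNReal.ofReal (Real.exp (-(δ * |(c : ℝ)|))) := by
    intro c
    rw [← ENNReal.ofReal_mul (Real.exp_nonneg _), ← Real.exp_add]
    refine ENNReal.ofReal_le_ofReal (Real.exp_le_exp.2 ?_)
    have h2 : |(c : ℝ)| ≤ |((c + ⌊s⌋ : ℤ) : ℝ) - s| + 1 := by
      have h3 := Int.floor_le s
      have h4 := Int.lt_floor_add_one s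
      have h5 : (c : ℝ) = (((c + ⌊s⌋ : ℤ) : ℝ) - s) + (s - ⌊s⌋) := by
        push_cast
        ring
      calc |(c : ℝ)| ≤ |((c + ⌊s⌋ : ℤ) : ℝ) - s| + |s - ⌊s⌋| := by
            conv_lhs => rw [h5]
            exact abs_add_le _ _
        _ ≤ _ := by
            rw [abs_of_nonneg (by linarith : (0 : ℝ) ≤ s - ⌊s⌋)]
            linarith
    nlinarith [mul_le_mul_of_nonneg_left h2 h0.le]
  have hint : ∑' c : ℤ, ENNReal.ofReal (Real.exp (-(δ * |(c : ℝ)|))) ≤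
      2 * ENNReal.ofReal (2 / δ) := by
    rw [tsum_of_nat_of_neg_add_one ENNReal.summable ENNReal.summable, two_mul]
    refine add_le_add (le_trans (le_of_eq ?_) hnat) (le_trans ?_ hnat)
    · simp
    · refine ENNReal.tsum_le_tsum fun n ↦ ENNReal.ofReal_le_ofReal (Real.exp_le_exp.2 ?_)
      push_cast
      rw [abs_neg, abs_of_nonneg (by positivity)]
      nlinarith
  rw [← (Equiv.addRight ⌊s⌋).tsum_eq]
  refine (ENNReal.tsum_le_tsum hle).trans ?_
  rw [ENNReal.tsum_mul_left]
  refine (mul_le_mul_right hint _).trans (le_of_eq ?_)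
  rw [show (2 : ℝ≥0∞) = ENNReal.ofReal 2 by simp, ← ENNReal.ofReal_mul (by norm_num),
    ← ENNReal.ofReal_mul (Real.exp_nonneg _)]
  congr 1
  ring

/-- The weight of a deviation on scale `j`. -/
def bendWeight (j : ℕ) (u : ℚ) : ℝ≥0∞ :=
  ENNReal.ofReal (3 * Real.exp (-(|(u : ℝ)| ^ 3 / (1600 * 2 ^ (j + 1)))))

lemma tsum_bendWeight_le (j : ℕ) (s : ℚ) :
    ∑' c : ℤ, bendWeight j ((c - s) / 2 ^ (j + 1)) ≤
      ENNReal.ofReal (Real.exp (46 * (j + 1))) := by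
  set q : ℝ := 2 ^ (j + 1) with hq
  have hq2 : 2 ≤ q := by
    rw [hq, pow_succ]
    have : (1 : ℝ) ≤ 2 ^ j := one_le_pow₀ (by norm_num)
    linarith
  have hq0 : 0 < q := by linarith
  have hle : ∀ c : ℤ, bendWeight j ((c - s) / 2 ^ (j + 1)) ≤ ENNReal.ofReal (3 * Real.exp 40) *
      ENNReal.ofReal (Real.exp (-(1 / q ^ 2 * |c - (s : ℝ)|))) := by
    intro c
    rw [bendWeight, ← ENNReal.ofReal_mul (by positivity), mul_assoc, ← Real.exp_add]
    refine ENNReal.ofReal_le_ofReal (mul_le_mul_of_nonneg_left (Real.exp_le_exp.2 ?_)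
      (by norm_num))
    push_cast
    rw [abs_div, ← hq, abs_of_pos hq0]
    set u := |(c : ℝ) - s| / q with hu
    have hu0 : 0 ≤ u := by positivity
    have h1 : 1 / q ^ 2 * |(c : ℝ) - s| = u / q := by
      rw [hu]
      field_simp
    -- The cubic is bounded below by a linear function, to which a geometric series applies.
    have h2 : u - 80 ≤ u ^ 3 / 1600 := by
      rw [le_div_iff₀ (by norm_num)]
      nlinarith [mul_nonneg (sq_nonneg (u - 40)) (by linarith : (0 : ℝ) ≤ u + 80)]
    have h3 : (u - 80) / q ≤ u ^ 3 / (1600 * q) := by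
      rw [← div_div]
      exact div_le_div_of_nonneg_right h2 hq0.le
    have h4 : 80 / q ≤ 40 := by
      rw [div_le_iff₀ hq0]
      linarith
    rw [h1]
    rw [sub_div] at h3
    linarith
  refine (ENNReal.tsum_le_tsum hle).trans ?_
  rw [ENNReal.tsum_mul_left]
  refine (mul_le_mul_right (tsum_exp_neg_abs_sub_le (s : ℝ) (by positivity) ?_) _).trans ?_
  · rw [div_le_one (by positivity)]
    nlinarith
  · rw [← ENNReal.ofReal_mul (by positivity)]
    refine ENNReal.ofReal_le_ofReal ?_
    have h12 : (12 : ℝ) ≤ Real.exp 3 := by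
      have := Real.add_one_le_exp (1 : ℝ)
      have h2 : (2.7 : ℝ) ≤ Real.exp 1 := by linarith [Real.exp_one_gt_d9]
      have h3 : Real.exp 3 = Real.exp 1 ^ 3 := by
        rw [← Real.exp_nat_mul]
        norm_num
      rw [h3]
      calc (12 : ℝ) ≤ 2.7 ^ 3 := by norm_num
        _ ≤ _ := pow_le_pow_left₀ (by norm_num) h2 3
    have hqe : q ≤ Real.exp (j + 1) := by
      rw [hq, ← Nat.cast_add_one, ← Real.exp_one_pow]
      exact pow_le_pow_left₀ (by norm_num) (by linarith [Real.add_one_le_exp (1 : ℝ)]) _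
    calc 3 * Real.exp 40 * (4 * Real.exp 1 / (1 / q ^ 2))
        = 12 * (Real.exp 40 * Real.exp 1) * q ^ 2 := by
          field_simp
          ring
      _ ≤ Real.exp 3 * (Real.exp 40 * Real.exp 1) * Real.exp (j + 1) ^ 2 := by gcongr
      _ = Real.exp (44 + 2 * (j + 1)) := by
          rw [← Real.exp_nat_mul, ← Real.exp_add, ← Real.exp_add, ← Real.exp_add]
          congr 1
          push_cast
          ring
      _ ≤ Real.exp (46 * (j + 1)) := by
          refine Real.exp_le_exp.2 ?_
          have : (0 : ℝ) ≤ j := by positivity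
          linarith

/-- The total weight of all nets grows exponentially in the number of points only. -/
lemma tsum_netWeight_bendWeight_le (M : ℕ) (a b : ℤ) :
    ∑' t, netWeight bendWeight M a b t ≤ ENNReal.ofReal (Real.exp (92 * 2 ^ M)) := by
  -- This `B` solves the recursion `S M * B M ^ 2 = B (M + 1)` for `S j = exp (46 * (j + 1))`: there
  -- are only `2 ^ (M - j - 1)` intervals on the scale `j`.
  refine (tsum_netWeight_le (B := fun M ↦ ENNReal.ofReal (Real.exp (46 * (2 * 2 ^ M - M - 2))))
    tsum_bendWeight_le ?_ ?_ M a b).trans ?_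
  · simp
  · intro M
    rw [← ENNReal.ofReal_mul (by positivity), ← ENNReal.ofReal_mul (by positivity),
      ← Real.exp_add, ← Real.exp_add]
    refine ENNReal.ofReal_le_ofReal (Real.exp_le_exp.2 (le_of_eq ?_))
    push_cast
    ring
  · refine ENNReal.ofReal_le_ofReal (Real.exp_le_exp.2 ?_)
    have : (0 : ℝ) ≤ M := by positivity
    linarith

/-! ### The multi-scale union bound -/

/-- The heights of a configuration on the lattice `l ℤ`, in units of `l` and rounded up. -/
def netHeight (l : ℕ) (h : ℕ → ℝ) (j : ℕ) : ℤ := ⌈h (j * l) / l⌉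

/-- The strength of the tilt used to detect the deviation `u`: one unit is lost to rounding. -/
def bendTilt (u : ℚ) : ℚ := if 0 ≤ u then max (u - 1) 0 else -max (-u - 1) 0

lemma exp_bendTilt_le (u : ℚ) :
    2 * Real.exp (-(|(bendTilt u : ℝ)| ^ 3 / 200)) ≤ 3 * Real.exp (-(|(u : ℝ)| ^ 3 / 800)) := by
  have h1 : |(bendTilt u : ℝ)| = max (|(u : ℝ)| - 1) 0 := by
    unfold bendTilt
    split_ifs with h
    · have hu : (0 : ℝ) ≤ u := by exact_mod_cast h
      push_cast
      rw [abs_of_nonneg hu, abs_of_nonneg (le_max_right _ _)]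
    · have hu : (u : ℝ) ≤ 0 := by exact_mod_cast (not_le.1 h).le
      push_cast
      rw [abs_neg, abs_of_nonpos hu, abs_of_nonneg (le_max_right _ _)]
  rw [h1]
  set v := |(u : ℝ)| with hv
  have hv0 : 0 ≤ v := abs_nonneg _
  have h2 : v ^ 3 / 4 - 1 ≤ max (v - 1) 0 ^ 3 := by
    rcases le_total v 1 with h | h
    · rw [max_eq_right (by linarith)]
      have : v ^ 3 ≤ 1 := pow_le_one₀ hv0 h
      norm_num
      linarith
    · rw [max_eq_left (by linarith)]
      nlinarith [mul_nonneg (sq_nonneg (v - 2)) hv0]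
  have h3 : Real.exp (1 / 200) ≤ 3 / 2 := by
    have := Real.exp_bound_div_one_sub_of_interval (x := 1 / 200) (by norm_num) (by norm_num)
    linarith
  calc 2 * Real.exp (-(max (v - 1) 0 ^ 3 / 200))
      ≤ 2 * Real.exp (1 / 200 + -(v ^ 3 / 800)) := by
        gcongr
        linarith
    _ = 2 * (Real.exp (1 / 200) * Real.exp (-(v ^ 3 / 800))) := by rw [Real.exp_add]
    _ ≤ 2 * (3 / 2 * Real.exp (-(v ^ 3 / 800))) := by gcongr
    _ = _ := by ring

lemma lt_of_netHeight_eq {l : ℕ} (hl : 0 < l) {h : ℕ → ℝ} {j : ℕ} {c : ℤ}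
    (hc : netHeight l h j = c) : ((c : ℝ) - 1) * l < h (j * l) ∧ h (j * l) ≤ c * l := by
  have hl' : (0 : ℝ) < l := by exact_mod_cast hl
  rw [netHeight, Int.ceil_eq_iff] at hc
  exact ⟨(lt_div_iff₀ hl').1 hc.1, (div_le_iff₀ hl').1 hc.2⟩

/-- A number is at most the geometric mean of upper bounds, with the weights `2 ^ (-j - 1)`. -/
lemma le_prod_rpow {p : ℝ≥0∞} (hp : p ≤ 1) {Q : ℕ → ℝ≥0∞} {M : ℕ} (h : ∀ j < M, p ≤ Q j) :
    p ≤ ∏ j ∈ Finset.range M, Q j ^ ((1 / 2 : ℝ) ^ (j + 1)) := by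
  have key : ∀ N ≤ M, p ^ (1 - (1 / 2 : ℝ) ^ N) ≤
      ∏ j ∈ Finset.range N, Q j ^ ((1 / 2 : ℝ) ^ (j + 1)) := by
    intro N hN
    induction N with
    | zero => simp
    | succ N ih =>
      have e : (1 - (1 / 2 : ℝ) ^ (N + 1)) = (1 - (1 / 2 : ℝ) ^ N) + (1 / 2 : ℝ) ^ (N + 1) := by
        ring
      rw [Finset.prod_range_succ, e, ENNReal.rpow_add_of_nonneg _ _
        (sub_nonneg.2 (pow_le_one₀ (by norm_num) (by norm_num))) (by positivity)]
      exact mul_le_mul' (ih (by omega)) (ENNReal.rpow_le_rpow (h N (by omega)) (by positivity))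
  refine le_trans ?_ (key M le_rfl)
  conv_lhs => rw [← ENNReal.rpow_one p]
  refine ENNReal.rpow_le_rpow_of_exponent_ge hp ?_
  have : (0 : ℝ) ≤ (1 / 2 : ℝ) ^ M := by positivity
  linarith

namespace IsBrownianField

variable {Ω : Type*} [MeasurableSpace Ω] {μ : Measure Ω} {M l : ℕ} {W : ℕ → ℝ → Ω → ℝ}
  {hstar : Ω → ℕ → ℝ}

/-- The probability of given net heights, estimated on a single dyadic scale: there the deviations
are controlled by the responses on disjoint blocks, which are independent. -/
lemma measure_netHeight_eq_le (hW : IsBrownianField (2 ^ M * l) W μ) (hl : 0 < l)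
    (hmin : ∀ᵐ ω ∂μ, IsMinimizer (2 ^ M * l) (fun x y ↦ W x y ω) (hstar ω)) (c : ℕ → ℤ)
    {j : ℕ} (hj : j < M) :
    μ {ω | ∀ i ≤ 2 ^ M, netHeight l (hstar ω) i = c i} ≤
      ∏ a ∈ Finset.range (2 ^ (M - 1 - j)),
        ENNReal.ofReal (3 * Real.exp (-(|(bend j a c : ℝ)| ^ 3 / 800))) := by
  have := hW.isProbabilityMeasure
  set N := 2 ^ (M - 1 - j) with hN
  have hpow : 2 ^ M = N * 2 * 2 ^ j := by
    rw [hN, ← pow_succ, ← pow_add]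
    congr 1
    omega
  set Λ := 2 ^ (j + 1) * l with hΛ
  set x := 2 ^ j * l with hx
  have hx0 : 0 < x := by positivity
  have hΛx : Λ = 2 * x := by
    rw [hΛ, hx, pow_succ]
    ring
  have hxm : x ∈ Finset.Ioo 0 Λ := Finset.mem_Ioo.2 ⟨hx0, by omega⟩
  have hlR : (0 : ℝ) < l := by exact_mod_cast hl
  set o : Fin N → ℕ := fun a ↦ a * Λ with ho
  have hoL : ∀ a, o a + Λ ≤ 2 ^ M * l := by
    intro a
    have h1 : (a : ℕ) + 1 ≤ N := a.2
    calc o a + Λ = (a + 1) * Λ := by rw [ho]; ring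
      _ ≤ N * Λ := Nat.mul_le_mul_right _ h1
      _ = 2 ^ M * l := by rw [hpow, hΛ, pow_succ]; ring
  have hod : ∀ a b, a ≠ b → o a + Λ ≤ o b ∨ o b + Λ ≤ o a := by
    intro a b hab
    have key : ∀ a b : Fin N, a < b → o a + Λ ≤ o b := by
      intro a b hab
      have h1 : (a : ℕ) + 1 ≤ b := hab
      calc o a + Λ = (a + 1) * Λ := by rw [ho]; ring
        _ ≤ b * Λ := Nat.mul_le_mul_right _ h1
    rcases lt_or_gt_of_ne hab with h | h
    · exact Or.inl (key a b h)
    · exact Or.inr (key b a h)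
  -- The deviations, the tilts that detect them, and the boundary values: the heights are known up
  -- to `l` only, and they are rounded up or down according to the sign of the tilt, since the
  -- comparison with the tilted maximum needs boundary values on the right side of the minimizer.
  set u : Fin N → ℚ := fun a ↦ bend j a c with hu
  set θ : Fin N → ℚ := fun a ↦ bendTilt (u a) with hθ
  set A : Fin N → ℝ := fun a ↦ ((c (2 * a * 2 ^ j) : ℝ) - if 0 ≤ u a then 0 else 1) * l with hA
  set B : Fin N → ℝ := fun a ↦ ((c ((2 * a + 2) * 2 ^ j) : ℝ) - if 0 ≤ u a then 0 else 1) * l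
    with hB
  set X : Fin N → Ω → (RatPath Λ → ℝ) := fun a ω k ↦
    blockProcess W Λ (o a) (baseLine Λ (A a) (B a)) k ω with hX
  set S : Fin N → Set (RatPath Λ → ℝ) := fun a ↦
    {y | (θ a : ℝ) ^ 2 * Λ ≤ tiltMax Λ x (θ a) y - maxVal (pathEnergy Λ) y} with hS
  have hSm : ∀ a, MeasurableSet (S a) := fun a ↦
    measurableSet_le measurable_const ((measurable_tiltMax _ _ _).sub (measurable_maxVal _))
  have hindep : iIndepFun X μ := hW.iIndepFun_block hoL hod fun a ↦ baseLine Λ (A a) (B a)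
  have hsub : {ω | ∀ i ≤ 2 ^ M, netHeight l (hstar ω) i = c i} ≤ᵐ[μ]
      (⋂ a ∈ (Finset.univ : Finset (Fin N)), X a ⁻¹' S a : Set Ω) := by
    filter_upwards [hmin, ae_all_iff.2 fun a ↦
      hW.ae_mul_sub_baseLine_le (hoL a) (A a) (B a) (θ a) hxm] with ω hω hresp hnet
    change ∀ i ≤ 2 ^ M, netHeight l (hstar ω) i = c i at hnet
    refine Set.mem_iInter₂.2 fun a _ ↦ ?_
    have haN : (a : ℕ) + 1 ≤ N := a.2
    have hr2 : (2 * (a : ℕ) + 2) * 2 ^ j ≤ 2 ^ M := by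
      calc (2 * (a : ℕ) + 2) * 2 ^ j = (a + 1) * 2 * 2 ^ j := by ring
        _ ≤ N * 2 * 2 ^ j := by gcongr
        _ = 2 ^ M := hpow.symm
    have hr1 : (2 * (a : ℕ) + 1) * 2 ^ j ≤ 2 ^ M := le_trans (by gcongr; omega) hr2
    have hr0 : 2 * (a : ℕ) * 2 ^ j ≤ 2 ^ M := le_trans (by gcongr; omega) hr2
    have n0 := lt_of_netHeight_eq hl (hnet _ hr0)
    have n1 := lt_of_netHeight_eq hl (hnet _ hr1)
    have n2 := lt_of_netHeight_eq hl (hnet _ hr2)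
    have e0 : 2 * (a : ℕ) * 2 ^ j * l = o a := by
      rw [ho, hΛ, pow_succ]
      ring
    have e1 : (2 * (a : ℕ) + 1) * 2 ^ j * l = o a + x := by
      rw [ho, hx, hΛ, pow_succ]
      ring
    have e2 : (2 * (a : ℕ) + 2) * 2 ^ j * l = o a + Λ := by
      rw [ho, hΛ, pow_succ]
      ring
    rw [e0] at n0
    rw [e1] at n1
    rw [e2] at n2
    have hΛR : (Λ : ℝ) = 2 * x := by exact_mod_cast hΛx
    have hxR : (0 : ℝ) < x := by exact_mod_cast hx0
    have hxl : (l : ℝ) ≤ x := by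
      rw [hx]
      exact_mod_cast Nat.le_mul_of_pos_left l (by positivity)
    have hbase : baseLine Λ (A a) (B a) x = (A a + B a) / 2 := by
      rw [baseLine, hΛR]
      field_simp
      ring
    have hdev : ((c ((2 * a + 1) * 2 ^ j) : ℝ) -
        ((c (2 * a * 2 ^ j) : ℝ) + c ((2 * a + 2) * 2 ^ j)) / 2) * l = u a * Λ := by
      rw [hu, hΛ]
      simp only [bend]
      push_cast
      field_simp
    have hr := hresp a (hstar ω) hω
    rw [hbase] at hr
    change (θ a : ℝ) ^ 2 * Λ ≤ tiltMax Λ x (θ a) (X a ω) - maxVal (pathEnergy Λ) (X a ω)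
    rcases le_or_gt 0 (u a) with h0 | h0
    · have hθa : (θ a : ℝ) = max ((u a : ℝ) - 1) 0 := by
        simp only [hθ, bendTilt, if_pos h0]
        push_cast
        rfl
      have hθ0 : (0 : ℝ) ≤ θ a := hθa ▸ le_max_right _ _
      refine le_trans ?_ (hr (Or.inl ⟨hθ0, ?_, ?_⟩))
      · simp only [hA, hB, if_pos h0, sub_zero]
        have h3 : ((u a : ℝ) - 1) * Λ ≤ hstar ω (o a + x) -
            ((c (2 * a * 2 ^ j) : ℝ) * l + c ((2 * a + 2) * 2 ^ j) * l) / 2 := by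
          linarith [n1.1]
        have h4 := mul_le_mul_of_nonneg_left h3 hθ0
        refine le_trans (le_of_eq ?_) h4
        rw [hθa]
        rcases le_total ((u a : ℝ) - 1) 0 with h5 | h5
        · rw [max_eq_right h5]
          ring
        · rw [max_eq_left h5]
          ring
      · simp only [hA, if_pos h0, sub_zero]
        exact n0.2
      · simp only [hB, if_pos h0, sub_zero]
        exact n2.2
    · have hθa : (θ a : ℝ) = -max (-(u a : ℝ) - 1) 0 := by
        simp only [hθ, bendTilt, if_neg (not_le.2 h0)]
        push_cast
        rfl
      have hθ0 : (θ a : ℝ) ≤ 0 := by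
        rw [hθa]
        exact neg_nonpos.2 (le_max_right _ _)
      refine le_trans ?_ (hr (Or.inr ⟨hθ0, ?_, ?_⟩))
      · simp only [hA, hB, if_neg (not_le.2 h0)]
        have h3 : hstar ω (o a + x) - (((c (2 * a * 2 ^ j) : ℝ) - 1) * l +
            ((c ((2 * a + 2) * 2 ^ j) : ℝ) - 1) * l) / 2 ≤ ((u a : ℝ) + 1) * Λ := by
          linarith [n1.2]
        have h4 := mul_le_mul_of_nonpos_left h3 hθ0
        refine le_trans (le_of_eq ?_) h4
        rw [hθa]
        rcases le_total (-(u a : ℝ) - 1) 0 with h5 | h5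
        · rw [max_eq_right h5]
          ring
        · rw [max_eq_left h5]
          ring
      · simp only [hA, if_neg (not_le.2 h0)]
        exact n0.1.le
      · simp only [hB, if_neg (not_le.2 h0)]
        exact n2.1.le
  refine (measure_mono_ae hsub).trans ?_
  rw [hindep.measure_inter_preimage_eq_mul Finset.univ fun a _ ↦ hSm a,
    ← Fin.prod_univ_eq_prod_range
      (fun a ↦ ENNReal.ofReal (3 * Real.exp (-(|(bend j a c : ℝ)| ^ 3 / 800)))) N]
  refine Finset.prod_le_prod' fun a _ ↦ ?_
  rw [← Measure.map_apply_of_aemeasurable (hW.aemeasurable_block (hoL a) _) (hSm a)]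
  refine ((hW.isShiftGaussian_block (hoL a) _).measure_tiltMax_sub_le hxm (θ a)).trans ?_
  exact ENNReal.ofReal_le_ofReal (exp_bendTilt_le (u a))

/-- The probability of given net heights, estimated on all dyadic scales simultaneously, with some
room on the finest scale. -/
lemma measure_netHeight_eq_mul_le (hW : IsBrownianField (2 ^ M * l) W μ) (hl : 0 < l) (hM : 0 < M)
    (hmin : ∀ᵐ ω ∂μ, IsMinimizer (2 ^ M * l) (fun x y ↦ W x y ω) (hstar ω)) (c : ℕ → ℤ) :
    μ {ω | ∀ i ≤ 2 ^ M, netHeight l (hstar ω) i = c i} * ENNReal.ofReal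
        (Real.exp (1 / 3200 * ∑ a ∈ Finset.range (2 ^ (M - 1)), |(bend 0 a c : ℝ)| ^ 3)) ≤
      ∏ j ∈ Finset.range M, ∏ a ∈ Finset.range (2 ^ (M - 1 - j)), bendWeight j (bend j a c) := by
  have := hW.isProbabilityMeasure
  -- The weight of the finest scale `j = 0` in the geometric mean is `1 / 2`, which leaves the
  -- exponent `|u| ^ 3 / 1600`; half of it compensates the exponential on the left.
  have h1 := le_prod_rpow prob_le_one fun j hj ↦ hW.measure_netHeight_eq_le hl hmin c (j := j) hj
  have h2 : ENNReal.ofReal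
      (Real.exp (1 / 3200 * ∑ a ∈ Finset.range (2 ^ (M - 1)), |(bend 0 a c : ℝ)| ^ 3)) =
      ∏ j ∈ Finset.range M, if j = 0 then ∏ a ∈ Finset.range (2 ^ (M - 1 - j)),
        ENNReal.ofReal (Real.exp (1 / 3200 * |(bend j a c : ℝ)| ^ 3)) else 1 := by
    rw [Finset.prod_ite_eq' (Finset.range M) 0, if_pos (Finset.mem_range.2 hM), Finset.mul_sum,
      Real.exp_sum, ENNReal.ofReal_prod_of_nonneg fun _ _ ↦ Real.exp_nonneg _]
    rfl
  rw [h2]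
  refine (mul_le_mul_left h1 _).trans ?_
  rw [← Finset.prod_mul_distrib]
  refine Finset.prod_le_prod' fun j _ ↦ ?_
  have h3 : ∀ a, ENNReal.ofReal (3 * Real.exp (-(|(bend j a c : ℝ)| ^ 3 / 800))) ^
      ((1 / 2 : ℝ) ^ (j + 1)) ≤ ENNReal.ofReal
        (3 * Real.exp (-(|(bend j a c : ℝ)| ^ 3 / (800 * 2 ^ (j + 1))))) := by
    intro a
    rw [ENNReal.ofReal_rpow_of_pos (by positivity), Real.mul_rpow (by norm_num)
      (Real.exp_nonneg _), ← Real.exp_mul]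
    refine ENNReal.ofReal_le_ofReal (mul_le_mul ?_ (le_of_eq ?_) (Real.exp_nonneg _) (by norm_num))
    · conv_rhs => rw [← Real.rpow_one 3]
      exact Real.rpow_le_rpow_of_exponent_le (by norm_num)
        (pow_le_one₀ (by norm_num) (by norm_num))
    · congr 1
      rw [one_div, inv_pow]
      field_simp
  rw [← ENNReal.prod_rpow_of_nonneg (by positivity)]
  refine (mul_le_mul_left (Finset.prod_le_prod' fun a _ ↦ h3 a) _).trans ?_
  split_ifs with h0
  · subst h0
    rw [← Finset.prod_mul_distrib]
    refine Finset.prod_le_prod' fun a _ ↦ ?_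
    rw [bendWeight, ← ENNReal.ofReal_mul (by positivity), mul_assoc, ← Real.exp_add]
    refine ENNReal.ofReal_le_ofReal (mul_le_mul_of_nonneg_left (Real.exp_le_exp.2 (le_of_eq ?_))
      (by norm_num))
    ring
  · rw [mul_one]
    refine Finset.prod_le_prod' fun a _ ↦ ?_
    refine ENNReal.ofReal_le_ofReal (mul_le_mul_of_nonneg_left (Real.exp_le_exp.2 ?_)
      (by norm_num))
    refine neg_le_neg (div_le_div_of_nonneg_left (by positivity) (by positivity) ?_)
    gcongr
    norm_num

/-- Exponential moments of the sum of the cubes of the deviations on the finest scale: the union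
bound over all nets, whose cost is of the order of the number `2 ^ M` of points. -/
theorem lintegral_exp_sum_bend_le (hW : IsBrownianField (2 ^ M * l) W μ) (hl : 0 < l) (hM : 0 < M)
    (hmin : ∀ᵐ ω ∂μ, IsMinimizer (2 ^ M * l) (fun x y ↦ W x y ω) (hstar ω)) :
    ∫⁻ ω, ENNReal.ofReal (Real.exp (1 / 3200 * ∑ a ∈ Finset.range (2 ^ (M - 1)),
      |(bend 0 a (netHeight l (hstar ω)) : ℝ)| ^ 3)) ∂μ ≤
    ENNReal.ofReal (Real.exp (92 * 2 ^ M)) := by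
  set f : Ω → ℝ≥0∞ := fun ω ↦ ENNReal.ofReal (Real.exp (1 / 3200 *
    ∑ a ∈ Finset.range (2 ^ (M - 1)), |(bend 0 a (netHeight l (hstar ω)) : ℝ)| ^ 3)) with hf
  set A : NetTree M → Set Ω := fun t ↦ {ω | IsMinimizer (2 ^ M * l) (fun x y ↦ W x y ω) (hstar ω) ∧
    netTree M (netHeight l (hstar ω)) = t} with hA
  have hends : ∀ ω, IsMinimizer (2 ^ M * l) (fun x y ↦ W x y ω) (hstar ω) →
      netHeight l (hstar ω) 0 = 0 ∧ netHeight l (hstar ω) (2 ^ M) = 0 := by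
    intro ω hω
    simp [netHeight, hω.1.1, hω.1.2 _ le_rfl]
  -- The values of the net heights split the integral. Measurable hulls avoid any discussion of the
  -- measurability of these events.
  have hle : ∫⁻ ω, f ω ∂μ ≤ ∫⁻ ω, ∑' t, (toMeasurable μ (A t)).indicator
      (fun _ ↦ ⨆ ω' ∈ A t, f ω') ω ∂μ := by
    refine lintegral_mono_ae ?_
    filter_upwards [hmin] with ω hω
    have hmem : ω ∈ A (netTree M (netHeight l (hstar ω))) := ⟨hω, rfl⟩
    refine le_trans ?_ (ENNReal.le_tsum (netTree M (netHeight l (hstar ω))))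
    rw [Set.indicator_of_mem (subset_toMeasurable _ _ hmem)]
    exact le_iSup₂ (f := fun ω' _ ↦ f ω') ω hmem
  refine hle.trans ?_
  rw [lintegral_tsum fun t ↦
    (measurable_const.indicator (measurableSet_toMeasurable _ _)).aemeasurable]
  refine le_trans (ENNReal.tsum_le_tsum fun t ↦ ?_) (tsum_netWeight_bendWeight_le M 0 0)
  rw [lintegral_indicator (measurableSet_toMeasurable _ _), setLIntegral_const,
    measure_toMeasurable]
  simp only [ENNReal.iSup_mul]
  refine iSup₂_le fun ω hω ↦ ?_
  have hsub : A t ⊆ {ω' | ∀ i ≤ 2 ^ M, netHeight l (hstar ω') i = netHeight l (hstar ω) i} := by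
    intro ω' hω'
    refine eq_of_netTree_eq (hω'.2.trans hω.2.symm) ?_ ?_
    · rw [(hends ω hω.1).1, (hends ω' hω'.1).1]
    · rw [(hends ω hω.1).2, (hends ω' hω'.1).2]
  rw [mul_comm]
  refine (mul_le_mul_left (measure_mono hsub) _).trans ?_
  refine (hW.measure_netHeight_eq_mul_le hl hM hmin (netHeight l (hstar ω))).trans (le_of_eq ?_)
  rw [← netWeight_netTree, (hends ω hω.1).1, (hends ω hω.1).2, hω.2]

end IsBrownianField

/-! ### The energy of the scale components -/

/-- The slope of the interpolation `coarse l h` on the `j`-th interval of length `l`. -/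
def slope (l : ℕ) (h : ℕ → ℝ) (j : ℕ) : ℝ := (h ((j + 1) * l) - h (j * l)) / l

lemma slope_two_mul (l : ℕ) (h : ℕ → ℝ) (a : ℕ) :
    slope (2 * l) h a = (slope l h (2 * a) + slope l h (2 * a + 1)) / 2 := by
  unfold slope
  rw [show (a + 1) * (2 * l) = (2 * a + 1 + 1) * l by ring,
    show a * (2 * l) = 2 * a * l by ring]
  push_cast
  rw [mul_comm (2 : ℝ), ← div_div]
  ring

lemma coarse_mul_add {l : ℕ} (hl : 0 < l) (h : ℕ → ℝ) (j : ℕ) {i : ℕ} (hi : i ≤ l) :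
    coarse l h (j * l + i) = h (j * l) + i * slope l h j := by
  have hl' : (l : ℝ) ≠ 0 := by positivity
  unfold coarse slope
  rcases hi.lt_or_eq with hi | rfl
  · have hd : (j * l + i) / l = j := by
      rw [mul_comm, Nat.mul_add_div hl, Nat.div_eq_of_lt hi, add_zero]
    have hm : (j * l + i) % l = i := by
      rw [mul_comm, Nat.mul_add_mod, Nat.mod_eq_of_lt hi]
    rw [hd, hm]
    ring
  · rw [← Nat.succ_mul, Nat.mul_div_cancel _ hl, Nat.mul_mod_left]
    field_simp
    simp [mul_comm]

lemma coarse_succ_sub {l : ℕ} (hl : 0 < l) (h : ℕ → ℝ) (x : ℕ) :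
    coarse l h (x + 1) - coarse l h x = slope l h (x / l) := by
  obtain ⟨j, i, hi, rfl⟩ : ∃ j i, i < l ∧ x = j * l + i :=
    ⟨x / l, x % l, Nat.mod_lt _ hl, by rw [mul_comm, Nat.div_add_mod]⟩
  have hd : (j * l + i) / l = j := by
    rw [mul_comm, Nat.mul_add_div hl, Nat.div_eq_of_lt hi, add_zero]
  rw [add_assoc, coarse_mul_add hl h j hi, coarse_mul_add hl h j hi.le, hd]
  push_cast
  ring

lemma sum_range_mul_div {l : ℕ} (hl : 0 < l) (f : ℕ → ℝ) (N : ℕ) :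
    ∑ x ∈ Finset.range (N * l), f (x / l) = l * ∑ j ∈ Finset.range N, f j := by
  induction N with
  | zero => simp
  | succ N ih =>
    rw [Nat.succ_mul, Finset.sum_range_add, ih, Finset.sum_range_succ, mul_add]
    congr 1
    rw [Finset.sum_congr rfl (g := fun _ ↦ f N), Finset.sum_const, Finset.card_range, nsmul_eq_mul]
    intro i hi
    rw [mul_comm N, Nat.mul_add_div hl, Nat.div_eq_of_lt (Finset.mem_range.1 hi), add_zero]

lemma sum_range_mul_two (f : ℕ → ℝ) (N : ℕ) : ∑ j ∈ Finset.range (N * 2), f j =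
    ∑ a ∈ Finset.range N, (f (2 * a) + f (2 * a + 1)) := by
  induction N with
  | zero => simp
  | succ N ih =>
    rw [Nat.succ_mul, Finset.sum_range_succ, Finset.sum_range_succ, ih, Finset.sum_range_succ,
      mul_comm N 2, add_assoc]

lemma pDirichletEnergy_eq_sum_range (p : ℝ) (L : ℕ) (h : ℕ → ℝ) : pDirichletEnergy p L h =
    1 / (2 : ℝ) ^ (p / 2) * ∑ x ∈ Finset.range L, |h (x + 1) - h x| ^ p := by
  unfold pDirichletEnergy
  rw [Finset.range_eq_Ico]
  congr 1
  exact (Finset.sum_Ico_add' (fun x ↦ |h x - h (x - 1)| ^ p) 0 L 1).symm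

lemma pDirichletEnergy_nonneg (p : ℝ) (L : ℕ) (h : ℕ → ℝ) : 0 ≤ pDirichletEnergy p L h := by
  unfold pDirichletEnergy
  positivity

lemma pDirichletEnergy_coarse (p : ℝ) {l : ℕ} (hl : 0 < l) (N : ℕ) (h : ℕ → ℝ) :
    pDirichletEnergy p (N * l) (coarse l h) =
      1 / (2 : ℝ) ^ (p / 2) * (l * ∑ j ∈ Finset.range N, |slope l h j| ^ p) := by
  rw [pDirichletEnergy_eq_sum_range, ← sum_range_mul_div hl]
  simp_rw [coarse_succ_sub hl]

/-- On the `a`-th interval of length `2 * l`, the component of scale `l` is a tent. This is the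
slope of its two sides. -/
def tentSlope (l : ℕ) (h : ℕ → ℝ) (a : ℕ) : ℝ := (slope l h (2 * a) - slope l h (2 * a + 1)) / 2

lemma pDirichletEnergy_scaleComponent (p : ℝ) {l : ℕ} (hl : 0 < l) (N : ℕ) (h : ℕ → ℝ) :
    pDirichletEnergy p (N * (2 * l)) (scaleComponent l h) =
      1 / (2 : ℝ) ^ (p / 2) * ((2 * l : ℕ) * ∑ a ∈ Finset.range N, |tentSlope l h a| ^ p) := by
  have h1 (x : ℕ) : |scaleComponent l h (x + 1) - scaleComponent l h x| ^ p =
      |slope l h (x / l) - slope (2 * l) h (x / l / 2)| ^ p := by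
    rw [Nat.div_div_eq_div_mul, mul_comm l 2, ← coarse_succ_sub hl,
      ← coarse_succ_sub (by positivity : 0 < 2 * l)]
    unfold scaleComponent
    congr 2
    ring
  rw [pDirichletEnergy_eq_sum_range]
  simp_rw [h1]
  rw [← mul_assoc, sum_range_mul_div hl fun j ↦ |slope l h j - slope (2 * l) h (j / 2)| ^ p,
    sum_range_mul_two]
  have h2 (a : ℕ) : |slope l h (2 * a) - slope (2 * l) h (2 * a / 2)| ^ p +
      |slope l h (2 * a + 1) - slope (2 * l) h ((2 * a + 1) / 2)| ^ p =
      2 * |tentSlope l h a| ^ p := by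
    rw [Nat.mul_div_cancel_left _ two_pos, show (2 * a + 1) / 2 = a by omega, slope_two_mul,
      show slope l h (2 * a) - (slope l h (2 * a) + slope l h (2 * a + 1)) / 2 =
        tentSlope l h a by unfold tentSlope; ring,
      show slope l h (2 * a + 1) - (slope l h (2 * a) + slope l h (2 * a + 1)) / 2 =
        -tentSlope l h a by unfold tentSlope; ring, abs_neg]
    ring
  simp_rw [h2, ← Finset.mul_sum]
  push_cast
  ring

lemma abs_tentSlope_le {l : ℕ} (hl : 0 < l) (h : ℕ → ℝ) (a : ℕ) :
    |tentSlope l h a| ≤ 2 * |(bend 0 a (netHeight l h) : ℝ)| + 1 := by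
  have hl' : (0 : ℝ) < l := by exact_mod_cast hl
  have hc (j : ℕ) : (netHeight l h j : ℝ) - 1 < h (j * l) / l ∧ h (j * l) / l ≤ netHeight l h j :=
    (lt_of_netHeight_eq hl rfl).imp (lt_div_iff₀ hl').2 (div_le_iff₀ hl').2
  obtain ⟨h0, h0'⟩ := hc (2 * a)
  obtain ⟨h1, h1'⟩ := hc (2 * a + 1)
  obtain ⟨h2, h2'⟩ := hc (2 * a + 2)
  have e : tentSlope l h a = h ((2 * a + 1) * l) / l -
      (h (2 * a * l) / l + h ((2 * a + 2) * l) / l) / 2 := by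
    unfold tentSlope slope
    rw [show 2 * a + 1 + 1 = 2 * a + 2 by rfl]
    ring
  have e' : 2 * (bend 0 a (netHeight l h) : ℝ) = netHeight l h (2 * a + 1) -
      ((netHeight l h (2 * a) : ℝ) + netHeight l h (2 * a + 2)) / 2 := by
    unfold bend
    push_cast
    simp only [mul_one, pow_one]
    ring
  rw [show 2 * |(bend 0 a (netHeight l h) : ℝ)| = |2 * (bend 0 a (netHeight l h) : ℝ)| by
    rw [abs_mul, abs_two], e', e]
  set u : ℝ := netHeight l h (2 * a + 1) -
      ((netHeight l h (2 * a) : ℝ) + netHeight l h (2 * a + 2)) / 2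
  have : |h ((2 * a + 1) * l) / l - (h (2 * a * l) / l + h ((2 * a + 2) * l) / l) / 2 - u| ≤ 1 := by
    rw [abs_le]
    constructor <;> simp only [u] <;> linarith
  linarith [abs_sub_abs_le_abs_sub
    (h ((2 * a + 1) * l) / l - (h (2 * a * l) / l + h ((2 * a + 2) * l) / l) / 2) u]

/-- The energy density of the component of scale `l` is controlled by the bends of the net. -/
lemma pDirichletEnergy_scaleComponent_le {p : ℝ} (hp2 : 2 ≤ p) (hp3 : p < 3) {l : ℕ} (hl : 0 < l)
    {N : ℕ} (hN : 0 < N) (h : ℕ → ℝ) :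
    pDirichletEnergy p (N * (2 * l)) (scaleComponent l h) / ((N * (2 * l) : ℕ) : ℝ) ≤
      4 + 32 * (∑ a ∈ Finset.range N, |(bend 0 a (netHeight l h) : ℝ)| ^ 3) / N := by
  have hl' : (0 : ℝ) < l := by exact_mod_cast hl
  have hN' : (0 : ℝ) < N := by exact_mod_cast hN
  have h1 (a : ℕ) : |tentSlope l h a| ^ p ≤ 32 * |(bend 0 a (netHeight l h) : ℝ)| ^ 3 + 4 := by
    set u := |(bend 0 a (netHeight l h) : ℝ)| with hu
    have hu0 : 0 ≤ u := abs_nonneg _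
    calc |tentSlope l h a| ^ p ≤ (2 * u + 1) ^ p :=
          Real.rpow_le_rpow (abs_nonneg _) (abs_tentSlope_le hl h a) (by linarith)
      _ ≤ (2 * u + 1) ^ (3 : ℝ) := Real.rpow_le_rpow_of_exponent_le (by linarith) hp3.le
      _ = (2 * u + 1) ^ 3 := by norm_cast
      _ ≤ 32 * u ^ 3 + 4 := by
          nlinarith [mul_nonneg (sq_nonneg (2 * u - 1)) hu0, sq_nonneg (2 * u - 1)]
  have h2 : 1 / (2 : ℝ) ^ (p / 2) ≤ 1 := by
    rw [div_le_one (by positivity)]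
    exact Real.one_le_rpow (by norm_num) (by linarith)
  rw [pDirichletEnergy_scaleComponent p hl]
  calc 1 / (2 : ℝ) ^ (p / 2) * ((2 * l : ℕ) * ∑ a ∈ Finset.range N, |tentSlope l h a| ^ p) /
        ((N * (2 * l) : ℕ) : ℝ)
      ≤ 1 * ((2 * l : ℕ) * ∑ a ∈ Finset.range N, (32 * |(bend 0 a (netHeight l h) : ℝ)| ^ 3 + 4)) /
        ((N * (2 * l) : ℕ) : ℝ) := by
        gcongr
        exact h1 _
    _ = _ := by
        rw [Finset.sum_add_distrib, ← Finset.mul_sum, Finset.sum_const, Finset.card_range,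
          nsmul_eq_mul]
        push_cast
        field_simp
        ring

/-! ### The energy of the interpolations -/

/-- A two-point inequality of hypercontractive type, from the concavity of `x ↦ x ^ (p / 4)` and the
case `p = 4`. -/
lemma add_rpow_abs_le {p : ℝ} (hp2 : 2 ≤ p) (hp4 : p ≤ 4) (a b : ℝ) :
    |a + b| ^ p + |a - b| ^ p ≤ 2 * (a ^ 2 + 3 * b ^ 2) ^ (p / 2) := by
  have key (x : ℝ) : |x| ^ p = (x ^ 4) ^ (p / 4) := by
    rw [← (show Even 4 by decide).pow_abs, ← Real.rpow_natCast, ← Real.rpow_mul (abs_nonneg _)]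
    congr 1
    push_cast
    ring
  have hc := (Real.concaveOn_rpow (p := p / 4) (by linarith) (by linarith)).2
    (show (a + b) ^ 4 ∈ Set.Ici 0 by simp only [Set.mem_Ici]; positivity)
    (show (a - b) ^ 4 ∈ Set.Ici 0 by simp only [Set.mem_Ici]; positivity)
    (show (0 : ℝ) ≤ 1 / 2 by norm_num) (show (0 : ℝ) ≤ 1 / 2 by norm_num) (by norm_num)
  simp only [smul_eq_mul] at hc
  have h2 : (1 / 2 * (a + b) ^ 4 + 1 / 2 * (a - b) ^ 4) ^ (p / 4) ≤
      (a ^ 2 + 3 * b ^ 2) ^ (p / 2) := by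
    calc (1 / 2 * (a + b) ^ 4 + 1 / 2 * (a - b) ^ 4) ^ (p / 4)
        ≤ ((a ^ 2 + 3 * b ^ 2) ^ 2) ^ (p / 4) := by
          refine Real.rpow_le_rpow (by positivity) ?_ (by linarith)
          nlinarith [sq_nonneg (b ^ 2)]
      _ = _ := by
          rw [← Real.rpow_natCast, ← Real.rpow_mul (by positivity)]
          congr 1
          push_cast
          ring
  rw [key, key]
  linarith

/-- Minkowski's inequality in `ℓ^{p/2}` and the two-point inequality bound the increase of the
energy from one dyadic scale to the next. -/
lemma rpow_pDirichletEnergy_coarse_le {p : ℝ} (hp2 : 2 ≤ p) (hp4 : p ≤ 4) {l : ℕ} (hl : 0 < l)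
    (N : ℕ) (h : ℕ → ℝ) :
    pDirichletEnergy p (N * (2 * l)) (coarse l h) ^ (2 / p) ≤
      pDirichletEnergy p (N * (2 * l)) (coarse (2 * l) h) ^ (2 / p) +
        3 * pDirichletEnergy p (N * (2 * l)) (scaleComponent l h) ^ (2 / p) := by
  have hq : 1 / (p / 2) = 2 / p := by field_simp
  have key (x : ℝ) : |x| ^ p = (x ^ 2) ^ (p / 2) := by
    rw [← sq_abs, ← Real.rpow_natCast, ← Real.rpow_mul (abs_nonneg _)]
    congr 1
    push_cast
    ring
  set A : ℝ := 1 / (2 : ℝ) ^ (p / 2) * (2 * l : ℕ) with hA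
  have hA0 : 0 ≤ A := by positivity
  have e1 : pDirichletEnergy p (N * (2 * l)) (coarse l h) ≤ A * ∑ a ∈ Finset.range N,
      (slope (2 * l) h a ^ 2 + 3 * tentSlope l h a ^ 2) ^ (p / 2) := by
    rw [← mul_assoc, pDirichletEnergy_coarse p hl, sum_range_mul_two, hA, mul_assoc]
    refine mul_le_mul_of_nonneg_left ?_ (by positivity)
    push_cast
    rw [mul_comm (2 : ℝ) l, mul_assoc, Finset.mul_sum (a := (2 : ℝ))]
    refine mul_le_mul_of_nonneg_left (Finset.sum_le_sum fun a _ ↦ ?_) (by positivity)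
    have h1 : slope l h (2 * a) = slope (2 * l) h a + tentSlope l h a := by
      rw [slope_two_mul, tentSlope]
      ring
    have h2 : slope l h (2 * a + 1) = slope (2 * l) h a - tentSlope l h a := by
      rw [slope_two_mul, tentSlope]
      ring
    rw [h1, h2]
    exact add_rpow_abs_le hp2 hp4 _ _
  have e2 : pDirichletEnergy p (N * (2 * l)) (coarse (2 * l) h) = A * ∑ a ∈ Finset.range N,
      (slope (2 * l) h a ^ 2) ^ (p / 2) := by
    rw [pDirichletEnergy_coarse p (by positivity : 0 < 2 * l), ← mul_assoc, ← hA]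
    simp_rw [key]
  have e3 : pDirichletEnergy p (N * (2 * l)) (scaleComponent l h) = A * ∑ a ∈ Finset.range N,
      (tentSlope l h a ^ 2) ^ (p / 2) := by
    rw [pDirichletEnergy_scaleComponent p hl, ← mul_assoc, ← hA]
    simp_rw [key]
  have hmink := Real.Lp_add_le_of_nonneg (p := p / 2) (Finset.range N)
    (f := fun a ↦ slope (2 * l) h a ^ 2) (g := fun a ↦ 3 * tentSlope l h a ^ 2) (by linarith)
    (fun _ _ ↦ by positivity) (fun _ _ ↦ by positivity)
  have h3 : (∑ a ∈ Finset.range N, (3 * tentSlope l h a ^ 2) ^ (p / 2)) ^ (2 / p) =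
      3 * (∑ a ∈ Finset.range N, (tentSlope l h a ^ 2) ^ (p / 2)) ^ (2 / p) := by
    rw [Finset.sum_congr rfl fun a _ ↦ Real.mul_rpow (show (0 : ℝ) ≤ 3 by norm_num)
      (sq_nonneg (tentSlope l h a)), ← Finset.mul_sum, Real.mul_rpow (by positivity)
      (Finset.sum_nonneg fun _ _ ↦ by positivity), ← Real.rpow_mul (by norm_num),
      show p / 2 * (2 / p) = 1 by field_simp, Real.rpow_one]
  rw [hq, h3] at hmink
  have hp0 : 0 ≤ 2 / p := by positivity
  rw [e2, e3, Real.mul_rpow hA0 (Finset.sum_nonneg fun _ _ ↦ by positivity),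
    Real.mul_rpow hA0 (Finset.sum_nonneg fun _ _ ↦ by positivity)]
  calc _ ≤ (A * ∑ a ∈ Finset.range N,
        (slope (2 * l) h a ^ 2 + 3 * tentSlope l h a ^ 2) ^ (p / 2)) ^ (2 / p) :=
        Real.rpow_le_rpow (pDirichletEnergy_nonneg _ _ _) e1 hp0
    _ = A ^ (2 / p) * (∑ a ∈ Finset.range N,
        (slope (2 * l) h a ^ 2 + 3 * tentSlope l h a ^ 2) ^ (p / 2)) ^ (2 / p) :=
        Real.mul_rpow hA0 (Finset.sum_nonneg fun _ _ ↦ by positivity)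
    _ ≤ _ := mul_le_mul_of_nonneg_left hmink (by positivity)
    _ = _ := by ring

lemma pDirichletEnergy_coarse_self {p : ℝ} (hp : p ≠ 0) {L : ℕ} (hL : 0 < L) {h : ℕ → ℝ}
    (hh : IsConfiguration L h) : pDirichletEnergy p L (coarse L h) = 0 := by
  have := pDirichletEnergy_coarse p hL 1 h
  rw [one_mul] at this
  rw [this]
  simp [slope, hh.1, hh.2 L le_rfl, Real.zero_rpow hp]

/-- The energy of the interpolation is controlled by the energies of its scale components. -/
lemma pDirichletEnergy_coarse_le {p : ℝ} (hp2 : 2 ≤ p) (hp4 : p ≤ 4) {n k : ℕ} (hk : k < n)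
    {h : ℕ → ℝ} (hh : IsConfiguration (2 ^ n) h) :
    pDirichletEnergy p (2 ^ n) (coarse (2 ^ k) h) ≤
      (3 : ℝ) ^ (p / 2) * ((n - k : ℕ) : ℝ) ^ (p / 2) *
        ((∑ i ∈ Finset.Ico k n, pDirichletEnergy p (2 ^ n) (scaleComponent (2 ^ i) h)) /
          ((n - k : ℕ) : ℝ)) := by
  have hp0 : 0 < p := by linarith
  set T : ℕ → ℝ := fun i ↦ pDirichletEnergy p (2 ^ n) (scaleComponent (2 ^ i) h) with hT
  have hT0 (i : ℕ) : 0 ≤ T i := pDirichletEnergy_nonneg _ _ _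
  have h1 : ∀ j ≤ n, pDirichletEnergy p (2 ^ n) (coarse (2 ^ j) h) ^ (2 / p) ≤
      3 * ∑ i ∈ Finset.Ico j n, T i ^ (2 / p) := by
    intro j hj
    induction hj using Nat.decreasingInduction with
    | self =>
      rw [pDirichletEnergy_coarse_self hp0.ne' (by positivity) hh, Real.zero_rpow (by positivity)]
      simp
    | of_succ j hj ih =>
      have e : 2 ^ n = 2 ^ (n - (j + 1)) * (2 * 2 ^ j) := by
        rw [← pow_succ', ← pow_add]
        congr 1
        omega
      have := rpow_pDirichletEnergy_coarse_le hp2 hp4 (l := 2 ^ j) (by positivity)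
        (2 ^ (n - (j + 1))) h
      rw [← e, ← pow_succ'] at this
      rw [Finset.sum_eq_sum_Ico_succ_bot hj, mul_add]
      linarith
  have hM : (0 : ℝ) < (n - k : ℕ) := by exact_mod_cast Nat.sub_pos_of_lt hk
  have h2 := Real.rpow_sum_le_const_mul_sum_rpow_of_nonneg (Finset.Ico k n)
    (f := fun i ↦ T i ^ (2 / p)) (p := p / 2) (by linarith) fun i _ ↦ by have := hT0 i; positivity
  have e2 (x : ℝ) (hx : 0 ≤ x) : (x ^ (2 / p)) ^ (p / 2) = x := by
    rw [← Real.rpow_mul hx, show 2 / p * (p / 2) = 1 by field_simp, Real.rpow_one]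
  simp_rw [fun i ↦ e2 (T i) (hT0 i)] at h2
  rw [Nat.card_Ico] at h2
  have hs0 : 0 ≤ ∑ i ∈ Finset.Ico k n, T i ^ (2 / p) :=
    Finset.sum_nonneg fun i _ ↦ by have := hT0 i; positivity
  calc pDirichletEnergy p (2 ^ n) (coarse (2 ^ k) h)
      = (pDirichletEnergy p (2 ^ n) (coarse (2 ^ k) h) ^ (2 / p)) ^ (p / 2) :=
        (e2 _ (pDirichletEnergy_nonneg _ _ _)).symm
    _ ≤ (3 * ∑ i ∈ Finset.Ico k n, T i ^ (2 / p)) ^ (p / 2) :=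
        Real.rpow_le_rpow (Real.rpow_nonneg (pDirichletEnergy_nonneg _ _ _) _) (h1 k hk.le)
          (by positivity)
    _ = 3 ^ (p / 2) * (∑ i ∈ Finset.Ico k n, T i ^ (2 / p)) ^ (p / 2) :=
        Real.mul_rpow (by norm_num) hs0
    _ ≤ 3 ^ (p / 2) * (((n - k : ℕ) : ℝ) ^ (p / 2 - 1) * ∑ i ∈ Finset.Ico k n, T i) := by
        gcongr
    _ = _ := by
        rw [Real.rpow_sub_one hM.ne']
        ring

/-! ### Orlicz norms -/

variable {Ω : Type*} [MeasurableSpace Ω] {μ : Measure Ω}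

lemma orliczNorm_one_le {X : Ω → ℝ} {ν : ℝ≥0} (hν : 0 < ν) (hX : 0 ≤ X)
    (h : ∫⁻ ω, ENNReal.ofReal (Real.exp (X ω / ν)) ∂μ ≤ ENNReal.ofReal (Real.exp 1)) :
    orliczNorm 1 X μ ≤ ν := by
  refine iInf₂_le ν ⟨hν, ?_⟩
  have hω (ω : Ω) : |X ω / ν| = X ω / ν := abs_of_nonneg (div_nonneg (hX ω) ν.2)
  simpa only [Real.rpow_one, hω] using h

/-- Jensen's inequality for the concave function `x ↦ x ^ (1 / r)`. -/
lemma lintegral_exp_div_le [IsProbabilityMeasure μ] {Y : Ω → ℝ} {r b : ℝ} (hr : 1 ≤ r)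
    (h : ∫⁻ ω, ENNReal.ofReal (Real.exp (Y ω)) ∂μ ≤ ENNReal.ofReal (Real.exp (b * r))) :
    ∫⁻ ω, ENNReal.ofReal (Real.exp (Y ω / r)) ∂μ ≤ ENNReal.ofReal (Real.exp b) := by
  have hr0 : 0 < r := by linarith
  -- Bernoulli's inequality `z ^ (1 / r) ≤ 1 + (z - 1) / r` at `z = exp (Y - b * r)`.
  have key (y : ℝ) : ENNReal.ofReal (Real.exp (y / r)) ≤ ENNReal.ofReal (Real.exp b * (1 - 1 / r)) +
      ENNReal.ofReal (Real.exp b * Real.exp (-(b * r)) / r) * ENNReal.ofReal (Real.exp y) := by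
    have h1 : 0 ≤ 1 - 1 / r := by
      rw [sub_nonneg, div_le_one hr0]
      exact hr
    rw [← ENNReal.ofReal_mul (by positivity), ← ENNReal.ofReal_add (by positivity) (by positivity)]
    refine ENNReal.ofReal_le_ofReal ?_
    have hc := convexOn_exp.2 (Set.mem_univ 0) (Set.mem_univ (y - b * r)) h1
      (show (0 : ℝ) ≤ 1 / r by positivity) (by ring)
    simp only [smul_eq_mul, mul_zero, zero_add, Real.exp_zero, mul_one] at hc
    calc Real.exp (y / r) = Real.exp b * Real.exp (1 / r * (y - b * r)) := by
          rw [← Real.exp_add]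
          congr 1
          field_simp
          ring
      _ ≤ Real.exp b * (1 - 1 / r + 1 / r * Real.exp (y - b * r)) := by gcongr
      _ = _ := by
          rw [sub_eq_neg_add y, Real.exp_add]
          ring
  have h1 : 0 ≤ 1 - 1 / r := by
    rw [sub_nonneg, div_le_one hr0]
    exact hr
  calc ∫⁻ ω, ENNReal.ofReal (Real.exp (Y ω / r)) ∂μ
      ≤ ∫⁻ ω, (ENNReal.ofReal (Real.exp b * (1 - 1 / r)) +
        ENNReal.ofReal (Real.exp b * Real.exp (-(b * r)) / r) *
          ENNReal.ofReal (Real.exp (Y ω))) ∂μ := lintegral_mono fun ω ↦ key (Y ω)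
    _ = ENNReal.ofReal (Real.exp b * (1 - 1 / r)) +
        ENNReal.ofReal (Real.exp b * Real.exp (-(b * r)) / r) *
          ∫⁻ ω, ENNReal.ofReal (Real.exp (Y ω)) ∂μ := by
        rw [lintegral_add_left measurable_const, lintegral_const, measure_univ, mul_one,
          lintegral_const_mul' _ _ ENNReal.ofReal_ne_top]
    _ ≤ ENNReal.ofReal (Real.exp b * (1 - 1 / r)) +
        ENNReal.ofReal (Real.exp b * Real.exp (-(b * r)) / r) *
          ENNReal.ofReal (Real.exp (b * r)) := by gcongr
    _ = ENNReal.ofReal (Real.exp b) := by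
        rw [← ENNReal.ofReal_mul (by positivity),
          ← ENNReal.ofReal_add (by positivity) (by positivity)]
        congr 1
        rw [Real.exp_neg]
        field_simp
        ring

lemma lintegral_exp_average_le {ι : Type*} {s : Finset ι} (hs : s.Nonempty) {A : ι → Ω → ℝ}
    (hA : ∀ i ∈ s, AEMeasurable (A i) μ) {b : ℝ≥0∞}
    (h : ∀ i ∈ s, ∫⁻ ω, ENNReal.ofReal (Real.exp (A i ω)) ∂μ ≤ b) :
    ∫⁻ ω, ENNReal.ofReal (Real.exp ((∑ i ∈ s, A i ω) / s.card)) ∂μ ≤ b := by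
  have hc : (0 : ℝ) < s.card := by exact_mod_cast hs.card_pos
  calc ∫⁻ ω, ENNReal.ofReal (Real.exp ((∑ i ∈ s, A i ω) / s.card)) ∂μ
      ≤ ∫⁻ ω, ENNReal.ofReal (s.card : ℝ)⁻¹ * ∑ i ∈ s, ENNReal.ofReal (Real.exp (A i ω)) ∂μ := by
        refine lintegral_mono fun ω ↦ ?_
        rw [← ENNReal.ofReal_sum_of_nonneg fun _ _ ↦ (Real.exp_pos _).le,
          ← ENNReal.ofReal_mul (by positivity), Finset.sum_div]
        refine ENNReal.ofReal_le_ofReal ((exp_sum_le s hs _).trans_eq ?_)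
        simp_rw [mul_div_cancel₀ _ hc.ne']
    _ = ENNReal.ofReal (s.card : ℝ)⁻¹ * ∑ i ∈ s, ∫⁻ ω, ENNReal.ofReal (Real.exp (A i ω)) ∂μ := by
        rw [lintegral_const_mul' _ _ ENNReal.ofReal_ne_top, lintegral_finsetSum' (f := fun i ω ↦
          ENNReal.ofReal (Real.exp (A i ω))) _ fun i hi ↦
          (Real.measurable_exp.comp_aemeasurable (hA i hi)).ennreal_ofReal]
    _ ≤ ENNReal.ofReal (s.card : ℝ)⁻¹ * ∑ _i ∈ s, b := by
        gcongr with i hi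
        exact h i hi
    _ = b := by
        rw [Finset.sum_const, nsmul_eq_mul, ← mul_assoc, ← ENNReal.ofReal_natCast,
          ← ENNReal.ofReal_mul (by positivity), inv_mul_cancel₀ hc.ne', ENNReal.ofReal_one, one_mul]

/-! ### The bounds for the minimizer -/

lemma measurable_pDirichletEnergy_scaleComponent (p : ℝ) (L l : ℕ) :
    Measurable fun h ↦ pDirichletEnergy p L (scaleComponent l h) := by
  unfold pDirichletEnergy scaleComponent coarse
  fun_prop

/-- A bound for the Orlicz norms of the energy densities of the scale components, from the exponents
in `pDirichletEnergy_scaleComponent_le` and `IsBrownianField.lintegral_exp_sum_bend_le`: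
`2 * 32 * 3200 * 100`. -/
def orliczBound : ℝ≥0 := 20480000

namespace IsBrownianField

variable {W : ℕ → ℝ → Ω → ℝ} {hstar : Ω → ℕ → ℝ} {n : ℕ} {p : ℝ}

theorem lintegral_exp_scaleComponent_le (hW : IsBrownianField (2 ^ n) W μ)
    (hmin : ∀ᵐ ω ∂μ, IsMinimizer (2 ^ n) (fun x y ↦ W x y ω) (hstar ω)) (hp2 : 2 ≤ p) (hp3 : p < 3)
    {k : ℕ} (hk : k < n) :
    ∫⁻ ω, ENNReal.ofReal (Real.exp (pDirichletEnergy p (2 ^ n) (scaleComponent (2 ^ k) (hstar ω)) /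
      (2 : ℝ) ^ n / orliczBound)) ∂μ ≤ ENNReal.ofReal (Real.exp 1) := by
  obtain ⟨m, rfl⟩ : ∃ m, n = m + 1 + k := ⟨n - k - 1, by omega⟩
  have e : 2 ^ (m + 1 + k) = 2 ^ (m + 1) * 2 ^ k := pow_add _ _ _
  have e' : 2 ^ (m + 1 + k) = 2 ^ m * (2 * 2 ^ k) := by ring
  rw [e] at hW
  simp_rw [e] at hmin
  have hprob := hW.isProbabilityMeasure
  have h1 := hW.lintegral_exp_sum_bend_le (by positivity) m.succ_pos hmin
  rw [Nat.add_sub_cancel] at h1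
  -- The factor `100` turns the exponential rate `92` into `92 / 100`, and leaves room for the
  -- deterministic term.
  have h2 := lintegral_exp_div_le (b := 92 / 100) (r := 100 * 2 ^ (m + 1))
    (by linarith [one_le_pow₀ (one_le_two (α := ℝ)) (n := m + 1)])
    (h1.trans_eq (by congr 2; ring))
  have hexp (x : ℝ) : ENNReal.ofReal (Real.exp (8 / 100 + x)) =
      ENNReal.ofReal (Real.exp (8 / 100)) * ENNReal.ofReal (Real.exp x) := by
    rw [Real.exp_add, ENNReal.ofReal_mul (by positivity)]
  refine (lintegral_mono fun ω ↦ (ENNReal.ofReal_le_ofReal (Real.exp_le_exp.2 ?_)).trans_eq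
    (hexp _)).trans ((lintegral_const_mul' _ _ ENNReal.ofReal_ne_top).trans_le
      ((mul_le_mul_right h2 _).trans_eq ?_))
  · have := pDirichletEnergy_scaleComponent_le hp2 hp3 (l := 2 ^ k) (by positivity) (N := 2 ^ m)
      (by positivity) (hstar ω)
    rw [← e'] at this
    push_cast at this
    rw [orliczBound, div_le_iff₀ (by norm_num)]
    refine this.trans ?_
    rw [pow_succ]
    field_simp
    rw [NNReal.coe_ofNat]
    linarith [pow_pos (two_pos (α := ℝ)) m]
  · rw [← hexp]
    norm_num

/-- Convexity of the exponential function passes from the components to the interpolation. -/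
theorem lintegral_exp_coarse_le (hW : IsBrownianField (2 ^ n) W μ)
    (hmin : ∀ᵐ ω ∂μ, IsMinimizer (2 ^ n) (fun x y ↦ W x y ω) (hstar ω)) (hp2 : 2 ≤ p) (hp3 : p < 3)
    {k : ℕ} (hk : k < n) :
    ∫⁻ ω, ENNReal.ofReal (Real.exp (pDirichletEnergy p (2 ^ n) (coarse (2 ^ k) (hstar ω)) /
      (2 : ℝ) ^ n / (orliczBound * ((3 : ℝ) ^ (p / 2) * ((n - k : ℕ) : ℝ) ^ (p / 2))))) ∂μ ≤
    ENNReal.ofReal (Real.exp 1) := by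
  have hM : (0 : ℝ) < (n - k : ℕ) := by exact_mod_cast Nat.sub_pos_of_lt hk
  have hc : (0 : ℝ) < (3 : ℝ) ^ (p / 2) * ((n - k : ℕ) : ℝ) ^ (p / 2) := by positivity
  have hν : (0 : ℝ) < orliczBound := by norm_num [orliczBound]
  have hmeas := hW.aemeasurable_of_isMinimizer hmin
  refine le_trans (lintegral_mono_ae (hmin.mono fun ω hω ↦ ENNReal.ofReal_le_ofReal
    (Real.exp_le_exp.2 ?_))) (lintegral_exp_average_le (s := Finset.Ico k n)
      (Finset.nonempty_Ico.2 hk)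
      (fun i _ ↦ (((measurable_pDirichletEnergy_scaleComponent p (2 ^ n) (2 ^ i)).comp_aemeasurable
        hmeas).div_const ((2 : ℝ) ^ n)).div_const (orliczBound : ℝ))
      fun i hi ↦ hW.lintegral_exp_scaleComponent_le hmin hp2 hp3 (Finset.mem_Ico.1 hi).2)
  have := pDirichletEnergy_coarse_le hp2 (by linarith) hk hω.1
  rw [Nat.card_Ico, div_div, div_le_iff₀ (by positivity)]
  refine this.trans_eq ?_
  simp only [Function.comp_apply]
  rw [← Finset.sum_div, ← Finset.sum_div]
  field_simp

end IsBrownianField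

end BrownianField

end

theorem theorem1 (p : ℝ) (hp2 : 2 ≤ p) (hp3 : p < 3) :
    ∃ C : ℝ≥0, ∀ (n : ℕ) (Ω : Type*) [MeasurableSpace Ω] (μ : Measure Ω) [IsProbabilityMeasure μ]
      (W : ℕ → ℝ → Ω → ℝ), BrownianField.IsBrownianField (2 ^ n) W μ →
      (∀ᵐ ω ∂μ, ∃! h : ℕ → ℝ, BrownianField.IsMinimizer (2 ^ n) (fun x y ↦ W x y ω) h) ∧
      ∀ hstar : Ω → ℕ → ℝ,
        (∀ᵐ ω ∂μ, BrownianField.IsMinimizer (2 ^ n) (fun x y ↦ W x y ω) (hstar ω)) →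
        AEMeasurable hstar μ ∧
        ∀ k < n,
          BrownianField.orliczNorm 1
            (fun ω ↦ BrownianField.pDirichletEnergy p (2 ^ n)
              (BrownianField.scaleComponent (2 ^ k) (hstar ω)) / (2 : ℝ) ^ n) μ
            ≤ (C : ℝ≥0∞) ∧
          BrownianField.orliczNorm 1
            (fun ω ↦ BrownianField.pDirichletEnergy p (2 ^ n)
              (BrownianField.coarse (2 ^ k) (hstar ω)) / (2 : ℝ) ^ n) μ
            ≤ (C : ℝ≥0∞) *
              ENNReal.ofReal (Real.log ((2 : ℝ) ^ n / (2 : ℝ) ^ k) ^ (p / 2)) := by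
  have hlog : 0 < Real.log 2 := Real.log_pos one_lt_two
  have hlog1 : Real.log 2 ≤ 1 := by linarith [Real.log_le_sub_one_of_pos (two_pos (α := ℝ))]
  have hν : (0 : ℝ) < BrownianField.orliczBound := by norm_num [BrownianField.orliczBound]
  -- The number of dyadic scales above `2 ^ k` is `log (2 ^ n / 2 ^ k) / log 2`.
  refine ⟨BrownianField.orliczBound * (3 / Real.log 2).toNNReal ^ (p / 2),
    fun n Ω _ μ _ W hW ↦ ⟨hW.ae_existsUnique_isMinimizer, fun hstar hmin ↦
      ⟨hW.aemeasurable_of_isMinimizer hmin, fun k hk ↦ ⟨?_, ?_⟩⟩⟩⟩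
  · refine (BrownianField.orliczNorm_one_le (NNReal.coe_pos.1 hν)
      (fun ω ↦ div_nonneg (BrownianField.pDirichletEnergy_nonneg _ _ _) (by positivity))
      (hW.lintegral_exp_scaleComponent_le hmin hp2 hp3 hk)).trans ?_
    refine ENNReal.coe_le_coe.2 (le_mul_of_one_le_right zero_le ?_)
    refine NNReal.one_le_rpow ?_ (by linarith)
    rw [Real.one_le_toNNReal, le_div_iff₀ hlog]
    linarith
  · have hM : (0 : ℝ) < (n - k : ℕ) := by exact_mod_cast Nat.sub_pos_of_lt hk
    have e : Real.log ((2 : ℝ) ^ n / (2 : ℝ) ^ k) = (n - k : ℕ) * Real.log 2 := by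
      rw [← Real.log_pow, pow_sub₀ _ two_ne_zero hk.le, div_eq_mul_inv]
    set ν : ℝ := BrownianField.orliczBound *
      ((3 : ℝ) ^ (p / 2) * ((n - k : ℕ) : ℝ) ^ (p / 2)) with hνdef
    have hν0 : 0 < ν := by positivity
    have hcoe : (ν.toNNReal : ℝ) = ν := Real.coe_toNNReal _ hν0.le
    have h1 := hW.lintegral_exp_coarse_le hmin hp2 hp3 hk
    rw [← hνdef, ← hcoe] at h1
    refine (BrownianField.orliczNorm_one_le (Real.toNNReal_pos.2 hν0)
      (fun ω ↦ div_nonneg (BrownianField.pDirichletEnergy_nonneg _ _ _) (by positivity))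
      h1).trans_eq ?_
    rw [ENNReal.ofReal, ← ENNReal.coe_mul, ENNReal.coe_inj]
    refine NNReal.coe_injective ?_
    rw [hcoe, NNReal.coe_mul, NNReal.coe_mul, NNReal.coe_rpow, Real.coe_toNNReal _ (by positivity),
      Real.coe_toNNReal _ (by rw [e]; positivity), e, hνdef,
      Real.div_rpow (by norm_num) hlog.le, Real.mul_rpow hM.le hlog.le]
    field_simp
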